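/- **Setting.** Let $n=2^m$ with $m\ge1$, let $\ell,k\ge1$ be integers, and write $\log n=m$ (base 2) in the definition of $\mathcal K$. Let $\Delta^n$ be the probability simplex in $\mathbb R^n$. Let $H$ be the matrix whose rows are the orthonormal Haar wavelets of $\mathbb R^n$: the father wavelet $n^{-1/2}\mathbf 1$ and, for $0\le i<m$ and $0\le j<2^i$, the wavelet $\psi_{i,j}$ equal to $2^{-(m-i)/2}$ on coordinates $2^{m-i}j+1,\dots,2^{m-i}j+2^{m-i-1}$, to $-2^{-(m-i)/2}$ on the next $2^{m-i-1}$ coordinates, and to $0$ elsewhere. The weight of a wavelet is $h=n^{-1/2}$ for the father and $h=2^{-(m-i)/2}$ for $\psi_{i,j}$. For a matrix $L$ indexed by wavelets put $L'_{ab}=h_ah_bL_{ab}$ and let $\|L\|_{*;h}=\|L'\|_*$. Let $\mathcal K$ be the set of $\Sigma\in\mathbb R^{n\times n}$ with $\Sigma\succeq0$, $\|\Sigma\|_{\max}\le1$ and $$\|H\Sigma H^\top\|_{1,1;h}\le(\ell\log n+1)^2,\qquad \|H\Sigma H^\top\|_{F;h}^2\le(\ell\log n+1)^2,\qquad \|H\Sigma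 H^\top\|_{\max;h}\le1,$$ where $\|\cdot\|_{1,1}$ is the sum of the absolute values of the entries. Put $\|M\|_{\mathcal K}=\sup_{\Sigma\in\mathcal K}|\langle M,\Sigma\rangle|$ for matrices and $\|v\|_{\mathcal K}=\|vv^\top\|_{\mathcal K}^{1/2}$ for vectors. For $p\in\Delta^n$ let $\mathrm{Mul}_k(p)$ be the law of the frequency vector (counts divided by $k$) of $k$ i.i.d. draws from $p$, and let $B(p)=\mathbb E_{X\sim \mathrm{Mul}_k(p)}[(X-p)(X-p)^\top]$. For vectors $X_i$ and $\mu_i\in\Delta^n$ ($i\in U$, $U$ a finite set) and for $S\subseteq U$, put $$\mu(S)=\tfrac1{|S|}\sum_{i\in S}X_i,\quad \overline\mu_S=\tfrac1{|S|}\sum_{i\in S}\mu_i,\quad \overline\mu=\overline\mu_U,\quad A_S=\tfrac1{|S|}\sum_{i\in S}(X_i-\mu_i)(X_i-\mu_i)^\top,\quad B_U=\tfrac1{|U|}\sum_{i\in U}B(\mu_i).$$ For $C_0>0$, $0<\epsilon<1/2$ and $\omega\ge0$, call $U$ *$\epsilon$-good with constant $C_0$* if for every $W\subseteq U$ with $|W|=\epsilon|U|$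 (rounded up or down if this is not an integer): * (I) $\|\mu(U)-\overline\mu\|_{\mathcal K}\le C_0\,\epsilon\sqrt{\log(1/\epsilon)}/\sqrt k$ and $\|\mu(W)-\overline\mu_W\|_{\mathcal K}\le C_0\sqrt{\log(1/\epsilon)}/\sqrt k$; * (II) $\|A_U-B_U\|_{\mathcal K}\le C_0\,\epsilon\log(1/\epsilon)/k$ and $\|A_W\|_{\mathcal K}\le C_0\log(1/\epsilon)/k$; * (III) $\|B(\mu(U))-B_U\|_{\mathcal K}\le C_0(\omega^2/k+\epsilon/k)$; * (IV) $\sup_{\Sigma\in\mathcal K}\frac1{|U|}\sum_{i\in U}(\mu_i-\overline\mu)^\top\Sigma(X_i-\mu_i)\le C_0\,\omega\,\epsilon\sqrt{\log(1/\epsilon)}/\sqrt k$ and $\sup_{\Sigma\in\mathcal K}\frac1{|W|}\sum_{i\in W}(\mu_i-\overline\mu)^\top\Sigma(X_i-\mu_i)\le C_0\,\omega\sqrt{\log(1/\epsilon)}/\sqrt k$. **Lemma 4.5 (Regularity of good samples).** There are absolute constants $C_0,C>0$ and $c\in\mathbb N$ such that the following holds for all integers $m,\ell,k\ge1$ and all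 $0<\epsilon<1/2$, $0<\delta<1$, $\omega\ge0$. Put $n=2^m$ and $$f=\log(2/\delta)\cdot\frac{\ell^2}{\epsilon^2}\cdot\log^3 n .$$ Let $U$ be a finite set with $|U|\ge C\,f\,\log^c(2+f)$ (that is, $|U|=\widetilde\Omega(f)$), let $\mu_i\in\Delta^n$ for $i\in U$, and suppose that all $\mu_i$ are within total variation distance $\omega$ of a common distribution in $\Delta^n$. If $X_i\sim\mathrm{Mul}_k(\mu_i)$, $i\in U$, are independent, then $U$ is $\epsilon$-good with constant $C_0$ with probability at least $1-\delta$. -/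

import Mathlib

open MeasureTheory ProbabilityTheory

noncomputable section

namespace UntrustedBatches

/-! ## Haar wavelets on `ℝⁿ`, `n = 2 ^ m` -/

/-- Indices of the Haar wavelet basis of `ℝ^(2^m)`: `none` is the father wavelet, and
`some ⟨i, j⟩` is the wavelet at scale `i`, position `j`; scale `0` is the mother wavelet. -/
abbrev HaarIdx (m : ℕ) : Type := Option (Σ i : Fin m, Fin (2 ^ (i : ℕ)))

/-- The weight `2^{-(m-i)/2}` of a Haar wavelet at scale `i` (the father has scale `0`). -/
def haarWeight (m : ℕ) : HaarIdx m → ℝ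
  | none => 1 / Real.sqrt ((2 : ℝ) ^ m)
  | some ⟨i, _⟩ => 1 / Real.sqrt ((2 : ℝ) ^ (m - (i : ℕ)))

/-- The sign pattern of a Haar wavelet (coordinates are numbered from `0`): `1` on the first half
of its support, `-1` on the second half, `0` elsewhere; the father is constantly `1`. -/
def haarSign (m : ℕ) : HaarIdx m → Fin (2 ^ m) → ℝ
  | none, _ => 1
  | some ⟨i, j⟩, x =>
      if 2 ^ (m - (i : ℕ)) * (j : ℕ) ≤ (x : ℕ) ∧
          (x : ℕ) < 2 ^ (m - (i : ℕ)) * (j : ℕ) + 2 ^ (m - (i : ℕ) - 1) then 1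
      else if 2 ^ (m - (i : ℕ)) * (j : ℕ) + 2 ^ (m - (i : ℕ) - 1) ≤ (x : ℕ) ∧
          (x : ℕ) < 2 ^ (m - (i : ℕ)) * (j : ℕ) + 2 ^ (m - (i : ℕ)) then -1
      else 0

/-- The matrix `H` whose rows are the (orthonormal) Haar wavelets. -/
def haarMatrix (m : ℕ) : Matrix (HaarIdx m) (Fin (2 ^ m)) ℝ :=
  fun a x => haarWeight m a * haarSign m a x

/-- The Haar-weighted Haar transform of `S`: the entry `(a, b)` of `H S Hᵀ`, multiplied by the
weights of the `a`-th and the `b`-th wavelet. The Haar-weighted norms of `H S Hᵀ` are the ordinary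
norms of this matrix. -/
def weightedHaar (m : ℕ) (S : Matrix (Fin (2 ^ m)) (Fin (2 ^ m)) ℝ) :
    Matrix (HaarIdx m) (HaarIdx m) ℝ :=
  fun a b => haarWeight m a * haarWeight m b *
    (haarMatrix m * S * (haarMatrix m).transpose) a b

/-! ## The set of test matrices and its norm -/

/-- The convex set `𝒦` of test matrices, where `n = 2 ^ m` and so `log n = m`. -/
structure IsTest (m ℓ : ℕ) (S : Matrix (Fin (2 ^ m)) (Fin (2 ^ m)) ℝ) : Prop where
  max_le : ∀ x y, |S x y| ≤ 1
  haar_sum_le : ∑ a, ∑ b, |weightedHaar m S a b| ≤ ((ℓ : ℝ) * m + 1) ^ 2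
  haar_frobenius_le : ∑ a, ∑ b, (weightedHaar m S a b) ^ 2 ≤ ((ℓ : ℝ) * m + 1) ^ 2
  haar_max_le : ∀ a b, |weightedHaar m S a b| ≤ 1
  posSemidef : S.PosSemidef

/-- The inner product `⟨M, S⟩ = ∑ M x y * S x y` of matrices. -/
def matInner {n : ℕ} (M S : Matrix (Fin n) (Fin n) ℝ) : ℝ := ∑ x, ∑ y, M x y * S x y

/-- `‖M‖_𝒦 = sup_{S ∈ 𝒦} |⟨M, S⟩|`. The supremum is over a non-empty set (it contains `0`) that is
bounded (the entries of `S` are at most `1` in absolute value). -/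
def normK (m ℓ : ℕ) (M : Matrix (Fin (2 ^ m)) (Fin (2 ^ m)) ℝ) : ℝ :=
  sSup {r : ℝ | ∃ S, IsTest m ℓ S ∧ r = |matInner M S|}

/-- `‖v‖_𝒦 = ‖v vᵀ‖_𝒦 ^ {1/2}`. -/
def vecNormK (m ℓ : ℕ) (v : Fin (2 ^ m) → ℝ) : ℝ :=
  Real.sqrt (normK m ℓ (Matrix.vecMulVec v v))

/-! ## Normalized multinomial distributions -/

/-- The distribution on `{0, …, n-1}` given by a probability vector `p`. -/
def categorical {n : ℕ} (p : Fin n → ℝ) : Measure (Fin n) :=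
  ∑ a, ENNReal.ofReal (p a) • Measure.dirac a

/-- The vector of frequencies of a batch of `k` draws. -/
def freq {n k : ℕ} (y : Fin k → Fin n) : Fin n → ℝ :=
  fun a => ((Finset.univ.filter fun j => y j = a).card : ℝ) / k

/-- `Mul_k(p)`: the law of the frequency vector of `k` independent draws from `p`. -/
def mulDist {n : ℕ} (k : ℕ) (p : Fin n → ℝ) : Measure (Fin n → ℝ) :=
  (Measure.pi fun _ : Fin k => categorical p).map freq

/-- Total variation distance of two probability vectors: `sup_S (p(S) - q(S))`. -/
def tvDist {n : ℕ} (p q : Fin n → ℝ) : ℝ :=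
  ⨆ S : Finset (Fin n), (∑ a ∈ S, p a - ∑ a ∈ S, q a)

/-! ## Empirical means and covariances -/

section

variable {ι : Type*} {n : ℕ}

/-- The average of the vectors `v i`, `i ∈ S`; it is `μ(S)` for the samples and `μ̄_S` for the
distributions they are drawn from. -/
def avg (S : Finset ι) (v : ι → Fin n → ℝ) : Fin n → ℝ :=
  fun a => (1 / (S.card : ℝ)) * ∑ i ∈ S, v i a

/-- `A(ŵ(S), {ν_i}) = (1 / |S|) ∑_{i ∈ S} (X_i - ν_i)(X_i - ν_i)ᵀ`. -/
def matA (S : Finset ι) (X ν : ι → Fin n → ℝ) : Matrix (Fin n) (Fin n) ℝ :=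
  (1 / (S.card : ℝ)) • ∑ i ∈ S, Matrix.vecMulVec (X i - ν i) (X i - ν i)

/-- `B(p) = E_{x ∼ Mul_k(p)} [(x - p)(x - p)ᵀ]`. -/
def matB (k : ℕ) (p : Fin n → ℝ) : Matrix (Fin n) (Fin n) ℝ :=
  fun a b => ∫ x, (x a - p a) * (x b - p b) ∂(mulDist k p)

/-- `B({ν_i}_{i ∈ S}) = (1 / |S|) ∑_{i ∈ S} E_{x ∼ Mul_k(ν_i)} [(x - ν_i)(x - ν_i)ᵀ]`. -/
def matBs (k : ℕ) (S : Finset ι) (ν : ι → Fin n → ℝ) : Matrix (Fin n) (Fin n) ℝ :=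
  (1 / (S.card : ℝ)) • ∑ i ∈ S, matB k (ν i)

/-- `M(ŵ(S), {ν_i}_{i ∈ S}) = A(ŵ(S), {ν_i}) - B({ν_i}_{i ∈ S})`. -/
def matM (k : ℕ) (S : Finset ι) (X ν : ι → Fin n → ℝ) : Matrix (Fin n) (Fin n) ℝ :=
  matA S X ν - matBs k S ν

end

/-- `sup_{S ∈ 𝒦} (1 / |V|) ∑_{i ∈ V} (μ_i - c)ᵀ S (X_i - μ_i)`. -/
def heterogeneity {ι : Type*} (m ℓ : ℕ) (V : Finset ι) (c : Fin (2 ^ m) → ℝ)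
    (μ X : ι → Fin (2 ^ m) → ℝ) : ℝ :=
  sSup {r : ℝ | ∃ S, IsTest m ℓ S ∧
    r = (1 / (V.card : ℝ)) * ∑ i ∈ V, (μ i - c) ⬝ᵥ S.mulVec (X i - μ i)}

/-- `W` is a subset of `U` of size `ε |U|`, rounded up or down if this is not an integer. -/
def IsFraction {ι : Type*} (ε : ℝ) (U W : Finset ι) : Prop :=
  W ⊆ U ∧ ⌊ε * (U.card : ℝ)⌋₊ ≤ W.card ∧ W.card ≤ ⌈ε * (U.card : ℝ)⌉₊

/-- `U` is `ε`-good, with the constant `C` in place of every `O(·)`. -/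
structure IsGood {ι : Type*} (C : ℝ) (m ℓ k : ℕ) (ε ω : ℝ) (U : Finset ι)
    (μ X : ι → Fin (2 ^ m) → ℝ) : Prop where
  mean_all : vecNormK m ℓ (avg U X - avg U μ)
      ≤ C * (ε * Real.sqrt (Real.log (1 / ε)) / Real.sqrt k)
  mean_part : ∀ W, IsFraction ε U W → vecNormK m ℓ (avg W X - avg W μ)
      ≤ C * (Real.sqrt (Real.log (1 / ε)) / Real.sqrt k)
  cov_all : normK m ℓ (matM k U X μ) ≤ C * (ε * Real.log (1 / ε) / k)
  cov_part : ∀ W, IsFraction ε U W → normK m ℓ (matA W X μ) ≤ C * (Real.log (1 / ε) / k)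
  proxy : normK m ℓ (matB k (avg U X) - matBs k U μ) ≤ C * (ω ^ 2 / k + ε / k)
  heterogeneity_all : heterogeneity m ℓ U (avg U μ) μ X
      ≤ C * (ω * (ε * Real.sqrt (Real.log (1 / ε)) / Real.sqrt k))
  heterogeneity_part : ∀ W, IsFraction ε U W → heterogeneity m ℓ W (avg U μ) μ X
      ≤ C * (ω * (Real.sqrt (Real.log (1 / ε)) / Real.sqrt k))

/-- The rate `log(2/δ) · (ℓ² / ε²) · log³ n` for `n = 2 ^ m`. For `δ ≤ 1/2`, `log (2/δ)` and
`log (1/δ)` agree up to a factor of two. -/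
def rate (m ℓ : ℕ) (ε δ : ℝ) : ℝ :=
  Real.log (2 / δ) * ((ℓ : ℝ) ^ 2 / ε ^ 2) * Real.log ((2 : ℝ) ^ m) ^ 3

end UntrustedBatches

end

open UntrustedBatches

/-!
All probabilities reduce to finite sums over the draws, so the lemma is about the weights
`∏ᵢ ∏ⱼ μᵢ(yᵢⱼ)`. Write `Dᵢ = Xᵢ - μᵢ`, `s = (ℓ m + 1)²` and `N = |U|`. Up to constants, every bound
in the definition of a good set follows from uniform bounds over the test matrices `S` for three
families of independent random matrices (`Regular.isGood`): the centered matrices `k Dᵢ Dᵢᵀ`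
(`covDev`), the diagonal matrices of `Dᵢ` (`diagDev`), and `√k νᵢ Dᵢᵀ` with `νᵢ = (μᵢ - μ̄) / ω`
(`crossDev`), together with a bound for the quadratic form of the overall mean.

*The uniform law* (`prob_not_uniformBound_le`). For a fixed matrix `Δ` with entries in `[-1, 1]`
the functional `⟨Mᵢ, Δ⟩` is subexponential with constants that do not depend on the dimension. For
the quadratic form this is `expect_exp_quadForm_le`, proved with an independent copy of the draws,
random swaps, and a Gaussian linearization of squares. The union bound over test matrices must not
pay for their dimension `4 ^ m`, and for this the Haar constraints are used. Call a wavelet heavy if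
its support has mass at least `θ = (ε / (32 s))⁴` under the average of the `μᵢ` and `|νᵢ|`.

* There are only polynomially many heavy wavelets in `s / ε`. The part of `S` on pairs of heavy
  wavelets arises from `S` by averaging over blocks, so it again has entries in `[-1, 1]`
  (`abs_sum_heavy_le`), and it takes only polynomially many distinct values.
  Rounding its coefficients at random to a grid of width `1 / M`, where `M = (m + 1) κ`, changes
  each entry by a sum of independent errors of total variance `κ⁻²`, because each point lies in the
  support of only `m + 1` wavelets. Thus the heavy part is, up to a negligible error, twice a
  mixture of grid matrices with entries in `[-1, 1]` and with coefficients of total size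
  `O(M s)` (`exists_rounding`, `exists_mixture`). There are `exp (O(m s log² (s / ε)))` of
  these, and a union bound over them is affordable. Sums and excesses over a threshold are convex,
  so the bounds pass to mixtures.
* For all other pairs of wavelets `⟨Mᵢ, a ⊗ b⟩` is on average at most `√θ`, and its sum over `i` is
  with high probability at most `ε N / s` for all `4 ^ m` pairs. Since the coefficients of `S` have
  total size at most `s`, these pairs contribute at most `ε N`.

*The mean of all batches* needs a faster rate, `ε² / k` for its quadratic form. It follows from the
Frobenius constraint on the Haar coefficients: the quadratic form of `S` is at most `ℓ m + 1` times
the sum of squares of the inner products with all wavelets, which is `m + 1` times the quadratic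
form of a single matrix with entries in `[-1, 1]` (`prob_not_mean_le`).

*Small parts of the sample.* The uniform law also bounds the sum over the whole sample of the
excesses of `|⟨Mᵢ, S⟩|` over `2 log (1 / ε)` by `O(ε N)`, so the average over any `ε N` batches is
`O(log (1 / ε))` (`Regular.avg_part_le`). The bounds for the means and for the interaction with the
heterogeneity follow from this one by Jensen's inequality and Cauchy-Schwarz, as `S` is positive
semidefinite.
-/

namespace UntrustedBatches

/-! ### Finite probability spaces -/

/-- A probability vector on a finite type. -/
structure IsProb {Y : Type*} [Fintype Y] (w : Y → ℝ) : Prop where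
  nonneg : ∀ y, 0 ≤ w y
  sum_one : ∑ y, w y = 1

/-- The expectation of `f` under the weights `w`. -/
noncomputable def expect {Y : Type*} [Fintype Y] (w f : Y → ℝ) : ℝ := ∑ y, w y * f y

/-- The weights of the product of the distributions `p j`. -/
noncomputable def piW {J α : Type*} [Fintype J] (p : J → α → ℝ) : (J → α) → ℝ :=
  fun y => ∏ j, p j (y j)

open Classical in
/-- The probability of the set of outcomes satisfying `A`. -/
noncomputable def prob {Y : Type*} [Fintype Y] (w : Y → ℝ) (A : Y → Prop) : ℝ :=
  expect w fun y => if A y then 1 else 0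

section expect

variable {Y : Type*} [Fintype Y] {w : Y → ℝ}

lemma expect_add (f g : Y → ℝ) :
    expect w (fun y => f y + g y) = expect w f + expect w g := by
  simp [expect, mul_add, Finset.sum_add_distrib]

lemma expect_sub (f g : Y → ℝ) :
    expect w (fun y => f y - g y) = expect w f - expect w g := by
  simp [expect, mul_sub, Finset.sum_sub_distrib]

lemma expect_const_mul (c : ℝ) (f : Y → ℝ) :
    expect w (fun y => c * f y) = c * expect w f := by
  simp only [expect, Finset.mul_sum]
  exact Finset.sum_congr rfl fun _ _ => by ring

lemma expect_mul_const (c : ℝ) (f : Y → ℝ) :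
    expect w (fun y => f y * c) = expect w f * c := by
  simp only [expect, Finset.sum_mul]
  exact Finset.sum_congr rfl fun _ _ => by ring

lemma expect_sum {ι : Type*} (s : Finset ι) (f : ι → Y → ℝ) :
    expect w (fun y => ∑ i ∈ s, f i y) = ∑ i ∈ s, expect w (f i) := by
  simp only [expect, Finset.mul_sum]
  exact Finset.sum_comm

lemma IsProb.expect_const (hw : IsProb w) (c : ℝ) : expect w (fun _ => c) = c := by
  simp [expect, ← Finset.sum_mul, hw.sum_one]

lemma IsProb.expect_mono (hw : IsProb w) {f g : Y → ℝ} (h : ∀ y, f y ≤ g y) :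
    expect w f ≤ expect w g :=
  Finset.sum_le_sum fun y _ => mul_le_mul_of_nonneg_left (h y) (hw.nonneg y)

lemma IsProb.expect_nonneg (hw : IsProb w) {f : Y → ℝ} (h : ∀ y, 0 ≤ f y) : 0 ≤ expect w f :=
  Finset.sum_nonneg fun y _ => mul_nonneg (hw.nonneg y) (h y)

lemma IsProb.expect_le (hw : IsProb w) {f : Y → ℝ} {c : ℝ} (h : ∀ y, f y ≤ c) :
    expect w f ≤ c :=
  (hw.expect_mono h).trans_eq (hw.expect_const c)

lemma IsProb.abs_expect_le (hw : IsProb w) (f : Y → ℝ) :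
    |expect w f| ≤ expect w fun y => |f y| := by
  refine (Finset.abs_sum_le_sum_abs _ _).trans_eq (Finset.sum_congr rfl fun y _ => ?_)
  rw [abs_mul, abs_of_nonneg (hw.nonneg y)]

/-- Jensen's inequality. -/
lemma IsProb.map_expect_le (hw : IsProb w) {φ : ℝ → ℝ} (hφ : ConvexOn ℝ Set.univ φ)
    (f : Y → ℝ) : φ (expect w f) ≤ expect w fun y => φ (f y) := by
  have := hφ.map_sum_le (t := Finset.univ) (w := w) (p := f) (fun y _ => hw.nonneg y) hw.sum_one
    (fun _ _ => Set.mem_univ _)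
  simpa [expect] using this

lemma IsProb.exp_expect_le (hw : IsProb w) (f : Y → ℝ) :
    Real.exp (expect w f) ≤ expect w fun y => Real.exp (f y) :=
  hw.map_expect_le convexOn_exp f

/-- Markov's inequality, for any nonnegative `f` that is at least one on `A`. -/
lemma IsProb.prob_le_expect (hw : IsProb w) {A : Y → Prop} {f : Y → ℝ} (h0 : ∀ y, 0 ≤ f y)
    (h : ∀ y, A y → 1 ≤ f y) : prob w A ≤ expect w f :=
  hw.expect_mono fun y => by
    split_ifs with hA
    · exact h y hA
    · exact h0 y

lemma IsProb.prob_mono (hw : IsProb w) {A B : Y → Prop} (h : ∀ y, A y → B y) :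
    prob w A ≤ prob w B :=
  hw.expect_mono fun y => by
    split_ifs with h1 h2 h2
    · exact le_rfl
    · exact absurd (h y h1) h2
    · norm_num
    · exact le_rfl

lemma IsProb.prob_or_le (hw : IsProb w) (A B : Y → Prop) :
    prob w (fun y => A y ∨ B y) ≤ prob w A + prob w B := by
  unfold prob
  rw [← expect_add]
  refine hw.expect_mono fun y => ?_
  by_cases hA : A y <;> by_cases hB : B y <;> simp [hA, hB]

/-- The union bound. -/
lemma IsProb.prob_exists_le (hw : IsProb w) {ι : Type*} (s : Finset ι) (A : ι → Y → Prop)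
    {c : ℝ} (h : ∀ i ∈ s, prob w (A i) ≤ c) :
    prob w (fun y => ∃ i ∈ s, A i y) ≤ s.card * c := by
  classical
  calc prob w (fun y => ∃ i ∈ s, A i y)
      ≤ expect w (fun y => ∑ i ∈ s, if A i y then 1 else 0) := by
        refine hw.prob_le_expect (fun y => Finset.sum_nonneg fun i _ => by split_ifs <;> norm_num) ?_
        rintro y ⟨i, hi, hA⟩
        refine le_trans ?_ (Finset.single_le_sum (f := fun i => if A i y then (1 : ℝ) else 0)
          (fun i _ => by split_ifs <;> norm_num) hi)
        simp [hA]
    _ = ∑ i ∈ s, prob w (A i) := by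
        rw [expect_sum]
        refine Finset.sum_congr rfl fun i _ => ?_
        unfold prob
        congr
    _ ≤ s.card * c := by
        simpa using Finset.sum_le_card_nsmul s _ c h

end expect

section product

variable {J α : Type*} [Fintype J] [DecidableEq J] [Fintype α] {p : J → α → ℝ}

lemma expect_piW_prod (p F : J → α → ℝ) :
    expect (piW p) (fun y => ∏ j, F j (y j)) = ∏ j, expect (p j) (F j) := by
  simp only [expect, piW, ← Finset.prod_mul_distrib]
  rw [Finset.prod_univ_sum, Fintype.piFinset_univ]

lemma isProb_piW (hp : ∀ j, IsProb (p j)) : IsProb (piW p) where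
  nonneg y := Finset.prod_nonneg fun j _ => (hp j).nonneg _
  sum_one := by
    have := expect_piW_prod p (fun _ _ => 1)
    simpa [expect, (hp _).sum_one] using this

lemma expect_piW_apply (hp : ∀ j, IsProb (p j)) (j : J) (f : α → ℝ) :
    expect (piW p) (fun y => f (y j)) = expect (p j) f := by
  have := expect_piW_prod p (fun i x => if i = j then f x else 1)
  rw [Finset.prod_eq_single j] at this
  · simpa [Finset.prod_ite_eq'] using this
  · intro i _ hi
    simp [hi, (hp i).expect_const]
  · simp

lemma expect_piW_apply_mul (hp : ∀ j, IsProb (p j)) {i j : J} (hij : i ≠ j) (f g : α → ℝ) :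
    expect (piW p) (fun y => f (y i) * g (y j)) = expect (p i) f * expect (p j) g := by
  have := expect_piW_prod p (fun l x => (if l = i then f x else 1) * (if l = j then g x else 1))
  rw [Finset.prod_eq_mul i j hij] at this
  · simp only [Finset.prod_mul_distrib, Finset.prod_ite_eq', Finset.mem_univ, if_true, if_neg hij,
      if_neg hij.symm, mul_one, one_mul] at this
    exact this
  · intro l _ hl
    simp [hl.1, hl.2, (hp l).expect_const]
  · simp
  · simp

lemma expect_piW_exp_sum (p F : J → α → ℝ) :
    expect (piW p) (fun y => Real.exp (∑ j, F j (y j)))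
      = ∏ j, expect (p j) (fun x => Real.exp (F j x)) := by
  simp only [Real.exp_sum]
  exact expect_piW_prod p fun j x => Real.exp (F j x)

lemma expect_piW_exp_sum_le (hp : ∀ j, IsProb (p j)) (F : J → α → ℝ) {c : J → ℝ}
    (h : ∀ j, expect (p j) (fun x => Real.exp (F j x)) ≤ Real.exp (c j)) :
    expect (piW p) (fun y => Real.exp (∑ j, F j (y j))) ≤ Real.exp (∑ j, c j) := by
  rw [expect_piW_exp_sum, Real.exp_sum]
  exact Finset.prod_le_prod (fun j _ => (hp j).expect_nonneg fun x => (Real.exp_pos _).le)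
    fun j _ => h j

end product

/-- Hoeffding's lemma for a variable with values in `[-b, b]`. -/
lemma IsProb.hoeffding {Y : Type*} [Fintype Y] {w : Y → ℝ} (hw : IsProb w) {f : Y → ℝ} {b : ℝ}
    (hb : ∀ y, |f y| ≤ b) (h0 : expect w f = 0) :
    expect w (fun y => Real.exp (f y)) ≤ Real.exp (b ^ 2 / 2) := by
  rcases lt_or_ge 0 b with hpos | hneg
  · -- the chord of `exp` over `[-b, b]`
    have key : ∀ y, Real.exp (f y) ≤ Real.cosh b + f y * (Real.sinh b / b) := by
      intro y
      obtain ⟨h1, h2⟩ := abs_le.1 (hb y)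
      have hconv := (show ConvexOn ℝ Set.univ Real.exp from convexOn_exp).2 (Set.mem_univ (-b)) (Set.mem_univ b)
        (show 0 ≤ (b - f y) / (2 * b) from div_nonneg (by linarith) (by linarith))
        (show 0 ≤ (b + f y) / (2 * b) from div_nonneg (by linarith) (by linarith))
        (by field_simp; ring)
      have e1 : ((b - f y) / (2 * b)) • (-b) + ((b + f y) / (2 * b)) • b = f y := by
        simp only [smul_eq_mul]; field_simp; ring
      rw [e1] at hconv
      refine hconv.trans_eq ?_
      rw [Real.cosh_eq, Real.sinh_eq]
      simp only [smul_eq_mul]; field_simp; ring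
    calc expect w (fun y => Real.exp (f y))
        ≤ expect w (fun y => Real.cosh b + f y * (Real.sinh b / b)) := hw.expect_mono key
      _ = Real.cosh b := by
        rw [expect_add, hw.expect_const, expect_mul_const, h0]; simp
      _ ≤ _ := Real.cosh_le_exp_half_sq b
  · have : ∀ y, f y = 0 := fun y => abs_nonpos_iff.1 ((hb y).trans hneg)
    simp only [this, Real.exp_zero, hw.expect_const]
    exact Real.one_le_exp (by positivity)

/-! ### Exponential moments of quadratic forms in independent draws -/

lemma integral_exp_neg_sq_add (c : ℝ) :
    ∫ x : ℝ, Real.exp (-(1 / 2) * x ^ 2 + c * x) = √(2 * Real.pi) * Real.exp (c ^ 2 / 2) := by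
  have h : ∀ x : ℝ, Real.exp (-(1 / 2) * x ^ 2 + c * x)
      = Real.exp (-(1 / 2) * (x - c) ^ 2) * Real.exp (c ^ 2 / 2) := by
    intro x; rw [← Real.exp_add]; congr 1; ring
  simp only [h]
  rw [integral_mul_const, integral_sub_right_eq_self (fun x : ℝ => Real.exp (-(1 / 2) * x ^ 2)) c,
    integral_gaussian]
  congr 2
  field_simp

lemma integrable_exp_neg_sq_add (c : ℝ) :
    Integrable fun x : ℝ => Real.exp (-(1 / 2) * x ^ 2 + c * x) := by
  have h : ∀ x : ℝ, Real.exp (-(1 / 2) * x ^ 2 + c * x)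
      = Real.exp (-(1 / 2) * (x - c) ^ 2) * Real.exp (c ^ 2 / 2) := by
    intro x; rw [← Real.exp_add]; congr 1; ring
  simp only [h]
  exact ((integrable_exp_neg_mul_sq (by norm_num : (0 : ℝ) < 1 / 2)).comp_sub_right c).mul_const _

/-- A sub-Gaussian variable has a square-exponential moment. The square is linearized by
integrating over an independent Gaussian variable. -/
lemma expect_exp_sq_le {Y : Type*} [Fintype Y] {w : Y → ℝ} {X : Y → ℝ}
    {v t : ℝ} (hv : 0 ≤ v) (ht : 0 ≤ t) (htv : t * v ≤ 1 / 4)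
    (h : ∀ a : ℝ, expect w (fun y => Real.exp (a * X y)) ≤ Real.exp (a ^ 2 * v / 2)) :
    expect w (fun y => Real.exp (t * X y ^ 2)) ≤ Real.exp (2 * (t * v)) := by
  set r := √(2 * t) with hr
  have hr2 : r ^ 2 = 2 * t := Real.sq_sqrt (by positivity)
  have hpi : 0 < √(2 * Real.pi) := Real.sqrt_pos.2 (by positivity)
  have htv0 : 0 ≤ t * v := mul_nonneg ht hv
  have h1 : √(2 * Real.pi) * expect w (fun y => Real.exp (t * X y ^ 2))
      = ∫ x : ℝ, expect w (fun y => Real.exp (-(1 / 2) * x ^ 2 + (r * X y) * x)) := by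
    simp only [expect]
    rw [integral_finsetSum]
    · rw [Finset.mul_sum]
      refine Finset.sum_congr rfl fun y _ => ?_
      rw [integral_const_mul, integral_exp_neg_sq_add, mul_pow, hr2]
      rw [show 2 * t * X y ^ 2 / 2 = t * X y ^ 2 by ring]
      ring
    · exact fun y _ => (integrable_exp_neg_sq_add _).const_mul _
  have h2 : ∀ x : ℝ, expect w (fun y => Real.exp (-(1 / 2) * x ^ 2 + (r * X y) * x))
      ≤ Real.exp (-(1 / 2 - t * v) * x ^ 2) := by
    intro x
    have : ∀ y, Real.exp (-(1 / 2) * x ^ 2 + (r * X y) * x)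
        = Real.exp (-(1 / 2) * x ^ 2) * Real.exp ((r * x) * X y) := by
      intro y; rw [← Real.exp_add]; congr 1; ring
    simp only [this]
    rw [expect_const_mul]
    refine (mul_le_mul_of_nonneg_left (h (r * x)) (Real.exp_pos _).le).trans_eq ?_
    rw [← Real.exp_add, mul_pow, hr2]
    congr 1; ring
  have hb : 0 < 1 / 2 - t * v := by linarith
  have h3 : √(2 * Real.pi) * expect w (fun y => Real.exp (t * X y ^ 2))
      ≤ √(Real.pi / (1 / 2 - t * v)) := by
    rw [h1, ← integral_gaussian]
    refine integral_mono ?_ (integrable_exp_neg_mul_sq hb) h2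
    simp only [expect]
    exact integrable_finsetSum _ fun y _ => (integrable_exp_neg_sq_add _).const_mul _
  have h4 : √(Real.pi / (1 / 2 - t * v)) ≤ √(2 * Real.pi) * Real.exp (2 * (t * v)) := by
    rw [show Real.exp (2 * (t * v)) = √(Real.exp (4 * (t * v))) by
      rw [Real.sqrt_eq_rpow, ← Real.exp_mul]; congr 1; ring]
    rw [← Real.sqrt_mul (by positivity)]
    refine Real.sqrt_le_sqrt ?_
    rw [div_le_iff₀ hb]
    have h5 : 1 + 4 * (t * v) ≤ Real.exp (4 * (t * v)) := by
      linarith [Real.add_one_le_exp (4 * (t * v))]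
    have h6 : 1 ≤ (1 + 4 * (t * v)) * (2 * (1 / 2 - t * v)) := by nlinarith
    have h7 : (1 + 4 * (t * v)) * (2 * (1 / 2 - t * v))
        ≤ Real.exp (4 * (t * v)) * (2 * (1 / 2 - t * v)) :=
      mul_le_mul_of_nonneg_right h5 (by linarith)
    nlinarith [Real.pi_pos]
  exact le_of_mul_le_mul_left (h3.trans h4) hpi

section

variable {J α : Type*} [Fintype J] [DecidableEq J] [Fintype α] {p : J → α → ℝ}

/-- Conditioning on the `j`-th coordinate: an exponential moment of a sum of functions of the
remaining coordinates, which may depend on the `j`-th coordinate as a parameter. -/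
lemma expect_piW_exp_sum_erase_le [DecidableEq α] (hp : ∀ j, IsProb (p j)) (j : J)
    (f : α → J → α → ℝ) {c : ℝ}
    (hc : 0 ≤ c) (h : ∀ x i, expect (p i) (fun z => Real.exp (f x i z)) ≤ Real.exp c) :
    expect (piW p) (fun y => Real.exp (∑ i ∈ Finset.univ.erase j, f (y j) i (y i)))
      ≤ Real.exp (Fintype.card J * c) := by
  have e1 : ∀ y : J → α, Real.exp (∑ i ∈ Finset.univ.erase j, f (y j) i (y i))
      = ∑ x, ∏ i, (if i = j then (if y i = x then 1 else 0) else Real.exp (f x i (y i))) := by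
    intro y
    rw [Finset.sum_eq_single (y j)]
    · rw [← Finset.mul_prod_erase _ _ (Finset.mem_univ j), Real.exp_sum]
      simp only [if_true, one_mul]
      exact Finset.prod_congr rfl fun i hi => by rw [if_neg (Finset.ne_of_mem_erase hi)]
    · intro x _ hx
      exact Finset.prod_eq_zero (Finset.mem_univ j) (by simp [hx.symm])
    · simp
  have e2 : ∀ x, expect (piW p) (fun y =>
      ∏ i, (if i = j then (if y i = x then 1 else 0) else Real.exp (f x i (y i))))
      ≤ p j x * Real.exp (Fintype.card J * c) := by
    intro x
    rw [expect_piW_prod p (fun i z => if i = j then (if z = x then 1 else 0) else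
      Real.exp (f x i z)), ← Finset.mul_prod_erase _ _ (Finset.mem_univ j)]
    have : expect (p j) (fun z => if j = j then (if z = x then (1 : ℝ) else 0) else
        Real.exp (f x j z)) = p j x := by simp [expect]
    rw [this]
    refine mul_le_mul_of_nonneg_left ?_ ((hp j).nonneg x)
    calc _ ≤ ∏ i ∈ Finset.univ.erase j, Real.exp c := by
          refine Finset.prod_le_prod (fun i hi => (hp i).expect_nonneg fun z => ?_) fun i hi => ?_
          · rw [if_neg (Finset.ne_of_mem_erase hi)]; exact (Real.exp_pos _).le
          · simp only [if_neg (Finset.ne_of_mem_erase hi)]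
            exact h x i
      _ = Real.exp ((Finset.univ.erase j).card * c) := by
          rw [Finset.prod_const, ← Real.exp_nat_mul]
      _ ≤ _ := by
          refine Real.exp_le_exp.2 (mul_le_mul_of_nonneg_right ?_ hc)
          exact_mod_cast Finset.card_le_univ _
  simp only [e1]
  rw [expect_sum]
  refine (Finset.sum_le_sum fun x _ => e2 x).trans_eq ?_
  rw [← Finset.sum_mul, (hp j).sum_one, one_mul]

/-- The product of a distribution with itself. -/
def pairW (p : J → α → ℝ) : J → α × α → ℝ := fun j x => p j x.1 * p j x.2

omit [Fintype J] [DecidableEq J] in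
lemma isProb_pairW (hp : ∀ j, IsProb (p j)) (j : J) : IsProb (pairW p j) where
  nonneg x := mul_nonneg ((hp j).nonneg _) ((hp j).nonneg _)
  sum_one := by
    simp [pairW, Fintype.sum_prod_type, ← Finset.mul_sum, (hp j).sum_one]

lemma expect_expect_piW (F : (J → α) → (J → α) → ℝ) :
    expect (piW p) (fun y => expect (piW p) (F y))
      = expect (piW (pairW p)) (fun w => F (fun j => (w j).1) (fun j => (w j).2)) := by
  simp only [expect, Finset.mul_sum]
  rw [← Fintype.sum_prod_type']
  refine (Fintype.sum_equiv (Equiv.arrowProdEquivProdArrow J (fun _ => α) (fun _ => α)) _ _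
    fun w => ?_).symm
  simp only [piW, pairW, Finset.prod_mul_distrib, Equiv.arrowProdEquivProdArrow, Equiv.coe_fn_mk]
  ring

/-- Exchange the two members of those pairs that are marked by `σ`. -/
def swapPairs (σ : J → Bool) (w : J → α × α) : J → α × α :=
  fun j => if σ j then (w j).swap else w j

lemma expect_swapPairs (σ : J → Bool) (F : (J → α × α) → ℝ) :
    expect (piW (pairW p)) (fun w => F (swapPairs σ w)) = expect (piW (pairW p)) F := by
  have hinv : Function.Involutive (swapPairs (α := α) σ) := by
    intro w; funext j; simp only [swapPairs]; split_ifs <;> simp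
  refine Fintype.sum_equiv hinv.toPerm _ _ fun w => ?_
  have : piW (pairW p) (swapPairs σ w) = piW (pairW p) w := by
    refine Finset.prod_congr rfl fun j _ => ?_
    simp only [swapPairs, pairW]
    split_ifs
    · simp [mul_comm]
    · rfl
  simp only [Function.Involutive.coe_toPerm, this]

/-- The uniform distribution on a nonempty finite type. -/
lemma isProb_uniform (Y : Type*) [Fintype Y] [Nonempty Y] :
    IsProb (fun _ : Y => 1 / (Fintype.card Y : ℝ)) where
  nonneg _ := by positivity
  sum_one := by
    have : (Fintype.card Y : ℝ) ≠ 0 := by exact_mod_cast Fintype.card_ne_zero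
    simp [this]

/-- A sum that changes sign termwise when pairs are exchanged has a sub-Gaussian conditional
moment given the unordered pairs. -/
lemma expect_exp_sum_swap_le (hp : ∀ j, IsProb (p j)) (b : J → (J → α × α) → ℝ)
    (hb : ∀ σ w j, b j (swapPairs σ w) = (if σ j then -1 else 1) * b j w) :
    expect (piW (pairW p)) (fun w => Real.exp (∑ j, b j w))
      ≤ expect (piW (pairW p)) (fun w => Real.exp (∑ j, b j w ^ 2 / 2)) := by
  have hP := isProb_piW (isProb_pairW hp)
  have hu := isProb_uniform Bool
  have hU : IsProb (piW (fun _ : J => fun _ : Bool => 1 / (Fintype.card Bool : ℝ))) :=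
    isProb_piW fun _ => hu
  calc expect (piW (pairW p)) (fun w => Real.exp (∑ j, b j w))
      = expect (piW (fun _ : J => fun _ : Bool => 1 / (Fintype.card Bool : ℝ))) (fun σ =>
          expect (piW (pairW p)) (fun w => Real.exp (∑ j, (if σ j then -1 else 1) * b j w))) := by
        simp only [← hb]
        conv_rhs =>
          enter [2, σ]
          rw [expect_swapPairs σ (fun w => Real.exp (∑ j, b j w))]
        rw [hU.expect_const]
    _ = expect (piW (pairW p)) (fun w =>
          expect (piW (fun _ : J => fun _ : Bool => 1 / (Fintype.card Bool : ℝ)))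
            (fun σ => Real.exp (∑ j, (if σ j then -1 else 1) * b j w))) := by
        simp only [expect, Finset.mul_sum]
        rw [Finset.sum_comm]
        exact Finset.sum_congr rfl fun _ _ => Finset.sum_congr rfl fun _ _ => by ring
    _ ≤ _ := by
        refine hP.expect_mono fun w => ?_
        refine expect_piW_exp_sum_le (fun _ => hu)
          (fun j s => (if s then -1 else 1) * b j w) fun j => ?_
        refine (hu.hoeffding (b := |b j w|) (fun s => ?_) ?_).trans_eq (by rw [sq_abs])
        · cases s <;> simp
        · simp [expect]

end

section

variable {α : Type*} [Fintype α]

/-- `|fᵀ Δ g| ≤ ‖f‖₁ ‖g‖₁` if the entries of `Δ` are at most one. -/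
lemma abs_bilin_le {Δ : Matrix α α ℝ} (hΔ : ∀ u v, |Δ u v| ≤ 1) (f g : α → ℝ) :
    |f ⬝ᵥ Δ.mulVec g| ≤ (∑ u, |f u|) * ∑ v, |g v| := by
  simp only [dotProduct, Matrix.mulVec]
  rw [Finset.sum_mul]
  refine (Finset.abs_sum_le_sum_abs _ _).trans (Finset.sum_le_sum fun u _ => ?_)
  rw [abs_mul]
  refine mul_le_mul_of_nonneg_left ?_ (abs_nonneg _)
  refine (Finset.abs_sum_le_sum_abs _ _).trans (Finset.sum_le_sum fun v _ => ?_)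
  rw [abs_mul]
  exact mul_le_of_le_one_left (abs_nonneg _) (hΔ u v)

lemma bilin_eq_sum (Δ : Matrix α α ℝ) (f g : α → ℝ) :
    f ⬝ᵥ Δ.mulVec g = ∑ u, ∑ v, f u * g v * Δ u v := by
  simp only [dotProduct, Matrix.mulVec, Finset.mul_sum]
  exact Finset.sum_congr rfl fun _ _ => Finset.sum_congr rfl fun _ _ => by ring

lemma bilin_transpose (Δ : Matrix α α ℝ) (f g : α → ℝ) :
    f ⬝ᵥ Δ.transpose.mulVec g = g ⬝ᵥ Δ.mulVec f := by
  rw [bilin_eq_sum, bilin_eq_sum, Finset.sum_comm]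
  exact Finset.sum_congr rfl fun _ _ => Finset.sum_congr rfl fun _ _ => by
    rw [Matrix.transpose_apply]; ring

variable [DecidableEq α] {p : α → ℝ}

/-- The centered indicator vector of a draw `x` from `p`. -/
def centered (p : α → ℝ) (x : α) : α → ℝ := Pi.single x 1 - p

lemma sum_abs_centered_le (hp : IsProb p) (x : α) : ∑ u, |centered p x u| ≤ 2 := by
  calc ∑ u, |centered p x u| ≤ ∑ u, ((Pi.single x (1 : ℝ) : α → ℝ) u + p u) := by
        refine Finset.sum_le_sum fun u _ => ?_
        rw [centered, Pi.sub_apply]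
        have h1 : 0 ≤ (Pi.single x (1 : ℝ) : α → ℝ) u := by
          rw [Pi.single_apply]; split_ifs <;> norm_num
        have h2 := hp.nonneg u
        rw [abs_le]; constructor <;> linarith
    _ = 2 := by
        rw [Finset.sum_add_distrib, hp.sum_one, Finset.sum_pi_single']
        norm_num

omit [Fintype α] in
lemma centered_apply (x u : α) : centered p x u = (if u = x then 1 else 0) - p u := by
  simp [centered, Pi.single_apply]

lemma expect_centered (hp : IsProb p) (u : α) : expect p (fun x => centered p x u) = 0 := by
  simp only [centered_apply]
  rw [expect_sub, hp.expect_const]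
  simp [expect]

lemma dotProduct_centered (φ : α → ℝ) (x : α) :
    centered p x ⬝ᵥ φ = φ x - p ⬝ᵥ φ := by
  rw [centered, sub_dotProduct, single_one_dotProduct]

lemma expect_centered_dotProduct (hp : IsProb p) (φ : α → ℝ) :
    expect p (fun x => centered p x ⬝ᵥ φ) = 0 := by
  simp only [dotProduct_centered]
  rw [expect_sub, hp.expect_const]
  simp [expect, dotProduct]

end

section

variable {J α : Type*} [Fintype J] [DecidableEq J] [Fintype α] [DecidableEq α] {p : J → α → ℝ}

/-- The sum of the centered indicator vectors of the draws `y j`. -/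
def drawSum (p : J → α → ℝ) (y : J → α) : α → ℝ := ∑ j, centered (p j) (y j)

/-- The normalized quadratic form `K⁻¹ sᵀ Δ s` in the sum `s` of `K` centered draws. -/
noncomputable def quadForm (p : J → α → ℝ) (Δ : Matrix α α ℝ) (y : J → α) : ℝ :=
  1 / (Fintype.card J : ℝ) * (drawSum p y ⬝ᵥ Δ.mulVec (drawSum p y))

omit [Fintype J] [DecidableEq J] [DecidableEq α] in
/-- Difference of squares for a quadratic form. -/
lemma bilin_sub_bilin (Δ : Matrix α α ℝ) (f g : α → ℝ) :
    f ⬝ᵥ Δ.mulVec f - g ⬝ᵥ Δ.mulVec g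
      = (f + g) ⬝ᵥ ((1 / 2 : ℝ) • (Δ + Δ.transpose)).mulVec (f - g) := by
  simp only [Matrix.smul_mulVec, Matrix.add_mulVec, Matrix.mulVec_sub, dotProduct_smul,
    dotProduct_add, dotProduct_sub, add_dotProduct, bilin_transpose, smul_eq_mul]
  ring

/-- **Exponential moments of a quadratic form** in independent, not necessarily identically
distributed, categorical variables. After symmetrization by an independent copy of the sample
the form becomes linear in the signs that exchange the members of the pairs. -/
theorem expect_exp_quadForm_le [Nonempty J] (hp : ∀ j, IsProb (p j)) {Δ : Matrix α α ℝ}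
    (hΔ : ∀ u v, |Δ u v| ≤ 1) {t : ℝ} (ht : |t| ≤ 1 / 16) :
    expect (piW p) (fun y => Real.exp (t * (quadForm p Δ y - expect (piW p) (quadForm p Δ))))
      ≤ Real.exp (192 * t ^ 2) := by
  have hP := isProb_piW hp
  have hP2 := isProb_pairW hp
  have hPP := isProb_piW hP2
  set K : ℝ := (Fintype.card J : ℝ) with hK
  have hK1 : 1 ≤ K := by
    rw [hK]; exact_mod_cast (Fintype.card_pos : 0 < Fintype.card J)
  have hK0 : 0 < K := by linarith
  set Δs : Matrix α α ℝ := (1 / 2 : ℝ) • (Δ + Δ.transpose) with hΔs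
  have hΔs1 : ∀ u v, |Δs u v| ≤ 1 := by
    intro u v
    have h1 := abs_le.1 (hΔ u v)
    have h2 := abs_le.1 (hΔ v u)
    simp only [hΔs, Matrix.smul_apply, Matrix.add_apply, Matrix.transpose_apply, smul_eq_mul]
    rw [abs_le]; constructor <;> linarith
  let η : J → α × α → α → ℝ := fun j x => centered (p j) x.1 + centered (p j) x.2
  let ζ : J → α × α → α → ℝ := fun j x => centered (p j) x.1 - centered (p j) x.2
  let b : J → (J → α × α) → ℝ := fun j w => (∑ i, η i (w i)) ⬝ᵥ Δs.mulVec (ζ j (w j))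
  -- the members of a pair are exchanged by a sign
  have hbswap : ∀ (σ : J → Bool) w j,
      t / K * b j (swapPairs σ w) = (if σ j then -1 else 1) * (t / K * b j w) := by
    intro σ w j
    have e1 : ∀ i, η i (swapPairs σ w i) = η i (w i) := by
      intro i
      simp only [η, swapPairs]
      split_ifs
      · simp [add_comm]
      · rfl
    have e2 : ζ j (swapPairs σ w j) = (if σ j then (-1 : ℝ) else 1) • ζ j (w j) := by
      simp only [ζ, swapPairs]
      split_ifs
      · simp
      · simp
    simp only [b, e1, e2, Matrix.mulVec_smul, dotProduct_smul, smul_eq_mul]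
    ring
  have hdiff : ∀ w : J → α × α, t * (quadForm p Δ (fun j => (w j).1) -
      quadForm p Δ (fun j => (w j).2)) = ∑ j, t / K * b j w := by
    intro w
    have e3 : drawSum p (fun j => (w j).1) + drawSum p (fun j => (w j).2) = ∑ i, η i (w i) := by
      simp only [drawSum, η, Finset.sum_add_distrib]
    have e4 : drawSum p (fun j => (w j).1) - drawSum p (fun j => (w j).2) = ∑ i, ζ i (w i) := by
      simp only [drawSum, ζ, Finset.sum_sub_distrib]
    rw [quadForm, quadForm, ← mul_sub, bilin_sub_bilin, e3, e4, ← hΔs, ← Finset.mul_sum]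
    simp only [b]
    rw [← dotProduct_sum, ← Matrix.mulVec_sum]
    ring
  have hζ1 : ∀ j x, ∑ u, |ζ j x u| ≤ 2 := by
    intro j x
    have : ∀ u, ζ j x u = (if u = x.1 then 1 else 0) - (if u = x.2 then 1 else 0) := by
      intro u; simp only [ζ, Pi.sub_apply, centered_apply]; ring
    calc ∑ u, |ζ j x u| ≤ ∑ u, ((if u = x.1 then (1 : ℝ) else 0) + (if u = x.2 then 1 else 0)) := by
          refine Finset.sum_le_sum fun u _ => ?_
          rw [this]; split_ifs <;> norm_num
      _ = 2 := by rw [Finset.sum_add_distrib]; simp; norm_num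
  have hη1 : ∀ j x, ∑ u, |η j x u| ≤ 4 := by
    intro j x
    calc ∑ u, |η j x u| ≤ ∑ u, (|centered (p j) x.1 u| + |centered (p j) x.2 u|) :=
          Finset.sum_le_sum fun u _ => abs_add_le _ _
      _ ≤ 4 := by
          rw [Finset.sum_add_distrib]
          linarith [sum_abs_centered_le (hp j) x.1, sum_abs_centered_le (hp j) x.2]
  have hbd : ∀ i x j z, |η i x ⬝ᵥ Δs.mulVec (ζ j z)| ≤ 8 := by
    intro i x j z
    refine (abs_bilin_le hΔs1 _ _).trans ?_
    calc _ ≤ (4 : ℝ) * 2 := mul_le_mul (hη1 i x) (hζ1 j z)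
          (Finset.sum_nonneg fun _ _ => abs_nonneg _) (by norm_num)
      _ = 8 := by norm_num
  have hmean : ∀ i φ, expect (pairW p i) (fun x => η i x ⬝ᵥ φ) = 0 := by
    intro i φ
    simp only [η, add_dotProduct]
    rw [expect_add]
    have e5 : expect (pairW p i) (fun x => centered (p i) x.1 ⬝ᵥ φ) = 0 := by
      rw [← expect_centered_dotProduct (hp i) φ]
      simp only [expect, pairW, Fintype.sum_prod_type]
      refine Finset.sum_congr rfl fun x _ => ?_
      rw [← Finset.sum_mul, ← Finset.mul_sum, (hp i).sum_one, mul_one]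
    have e6 : expect (pairW p i) (fun x => centered (p i) x.2 ⬝ᵥ φ) = 0 := by
      rw [← expect_centered_dotProduct (hp i) φ]
      simp only [expect, pairW, Fintype.sum_prod_type]
      rw [Finset.sum_comm]
      refine Finset.sum_congr rfl fun x _ => ?_
      rw [← Finset.sum_mul, ← Finset.sum_mul, (hp i).sum_one, one_mul]
    rw [e5, e6, add_zero]
  -- one summand of the conditional variance
  have hone : ∀ j, expect (piW (pairW p)) (fun w => Real.exp (t ^ 2 / (2 * K) * b j w ^ 2))
      ≤ Real.exp (192 * t ^ 2) := by
    intro j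
    let X : (J → α × α) → ℝ := fun w =>
      ∑ i ∈ Finset.univ.erase j, η i (w i) ⬝ᵥ Δs.mulVec (ζ j (w j))
    have hX : ∀ w, b j w = η j (w j) ⬝ᵥ Δs.mulVec (ζ j (w j)) + X w := by
      intro w
      simp only [b, X, sum_dotProduct]
      rw [Finset.add_sum_erase _ (fun i => η i (w i) ⬝ᵥ Δs.mulVec (ζ j (w j))) (Finset.mem_univ j)]
    have hsub : ∀ a : ℝ, expect (piW (pairW p)) (fun w => Real.exp (a * X w))
        ≤ Real.exp (a ^ 2 * (64 * K) / 2) := by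
      intro a
      simp only [X, Finset.mul_sum]
      refine (expect_piW_exp_sum_erase_le hP2 j
        (fun z i x => a * (η i x ⬝ᵥ Δs.mulVec (ζ j z))) (c := (|a| * 8) ^ 2 / 2) (by positivity)
        fun z i => ?_).trans_eq ?_
      · refine (hP2 i).hoeffding (fun x => ?_) ?_
        · rw [abs_mul]
          exact mul_le_mul_of_nonneg_left (hbd i x j z) (abs_nonneg _)
        · rw [expect_const_mul, hmean, mul_zero]
      · congr 1
        rw [mul_pow, sq_abs]; ring
    have ht2 : t ^ 2 ≤ 1 / 256 := by
      rw [← sq_abs]; nlinarith [abs_nonneg t]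
    have hsq := expect_exp_sq_le (w := piW (pairW p)) (X := X) (v := 64 * K) (t := t ^ 2 / K)
      (by positivity) (by positivity) (by
        rw [show t ^ 2 / K * (64 * K) = 64 * t ^ 2 by field_simp]; linarith) hsub
    calc expect (piW (pairW p)) (fun w => Real.exp (t ^ 2 / (2 * K) * b j w ^ 2))
        ≤ expect (piW (pairW p)) (fun w => Real.exp (64 * t ^ 2) *
            Real.exp (t ^ 2 / K * X w ^ 2)) := by
          refine hPP.expect_mono fun w => ?_
          rw [← Real.exp_add]
          refine Real.exp_le_exp.2 ?_
          rw [hX w]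
          set β := η j (w j) ⬝ᵥ Δs.mulVec (ζ j (w j))
          have hβ : β ^ 2 ≤ 64 := by
            have := hbd j (w j) j (w j)
            rw [← sq_abs]; nlinarith [abs_nonneg β]
          have h1 : (β + X w) ^ 2 ≤ 2 * (64 + X w ^ 2) := by nlinarith [sq_nonneg (β - X w)]
          have h2 : t ^ 2 / (2 * K) * (β + X w) ^ 2 ≤ t ^ 2 / (2 * K) * (2 * (64 + X w ^ 2)) :=
            mul_le_mul_of_nonneg_left h1 (by positivity)
          have h3 : t ^ 2 / (2 * K) * (2 * (64 + X w ^ 2)) = 64 * (t ^ 2 / K) + t ^ 2 / K * X w ^ 2 := by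
            field_simp
          have h4 : t ^ 2 / K ≤ t ^ 2 := div_le_self (by positivity) hK1
          linarith
      _ ≤ Real.exp (64 * t ^ 2) * Real.exp (2 * (t ^ 2 / K * (64 * K))) := by
          rw [expect_const_mul]
          exact mul_le_mul_of_nonneg_left hsq (Real.exp_pos _).le
      _ = Real.exp (192 * t ^ 2) := by
          rw [← Real.exp_add]; congr 1; field_simp; ring
  have hU := isProb_uniform J
  calc expect (piW p) (fun y => Real.exp (t * (quadForm p Δ y - expect (piW p) (quadForm p Δ))))
      ≤ expect (piW p) (fun y => expect (piW p) (fun y' =>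
          Real.exp (t * (quadForm p Δ y - quadForm p Δ y')))) := by
        refine hP.expect_mono fun y => ?_
        refine le_of_eq_of_le ?_ (hP.exp_expect_le _)
        rw [expect_const_mul, expect_sub, hP.expect_const]
    _ = expect (piW (pairW p)) (fun w => Real.exp (∑ j, t / K * b j w)) := by
        rw [expect_expect_piW]
        simp only [hdiff]
    _ ≤ expect (piW (pairW p)) (fun w => Real.exp (∑ j, (t / K * b j w) ^ 2 / 2)) :=
        expect_exp_sum_swap_le hp (fun j w => t / K * b j w) hbswap
    _ ≤ expect (piW (pairW p)) (fun w => expect (fun _ : J => 1 / K) (fun j =>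
          Real.exp (t ^ 2 / (2 * K) * b j w ^ 2))) := by
        refine hPP.expect_mono fun w => ?_
        refine le_of_eq_of_le ?_ (hU.exp_expect_le _)
        simp only [expect]
        congr 1
        refine Finset.sum_congr rfl fun j _ => ?_
        rw [← hK]
        field_simp
    _ = expect (fun _ : J => 1 / K) (fun j => expect (piW (pairW p)) (fun w =>
          Real.exp (t ^ 2 / (2 * K) * b j w ^ 2))) := by
        simp only [expect, Finset.mul_sum]
        rw [Finset.sum_comm]
        exact Finset.sum_congr rfl fun _ _ => Finset.sum_congr rfl fun _ _ => by ring
    _ ≤ Real.exp (192 * t ^ 2) := hU.expect_le hone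

/-- Distinct draws are uncorrelated, so that only the diagonal terms contribute to the mean. -/
lemma expect_drawSum_mul (hp : ∀ j, IsProb (p j)) (u v : α) :
    expect (piW p) (fun y => drawSum p y u * drawSum p y v)
      = ∑ j, expect (p j) (fun x => centered (p j) x u * centered (p j) x v) := by
  simp only [drawSum, Finset.sum_apply, Finset.sum_mul_sum]
  rw [expect_sum]
  refine Finset.sum_congr rfl fun j _ => ?_
  rw [expect_sum, Finset.sum_eq_single j]
  · exact expect_piW_apply hp j fun x => centered (p j) x u * centered (p j) x v
  · intro i _ hi
    have := expect_piW_apply_mul hp hi.symm (fun x => centered (p j) x u)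
      (fun x => centered (p i) x v)
    rw [this, expect_centered (hp j), zero_mul]
  · simp

lemma expect_quadForm (hp : ∀ j, IsProb (p j)) (Δ : Matrix α α ℝ) :
    expect (piW p) (quadForm p Δ) = 1 / (Fintype.card J : ℝ) *
      ∑ j, expect (p j) (fun x => centered (p j) x ⬝ᵥ Δ.mulVec (centered (p j) x)) := by
  unfold quadForm
  rw [expect_const_mul]
  congr 1
  simp only [bilin_eq_sum, expect_sum]
  conv_rhs =>
    rw [Finset.sum_comm]
    enter [2, u]
    rw [Finset.sum_comm]
  refine Finset.sum_congr rfl fun u _ => Finset.sum_congr rfl fun v _ => ?_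
  rw [expect_mul_const, expect_drawSum_mul hp, Finset.sum_mul]
  exact Finset.sum_congr rfl fun j _ => by rw [expect_mul_const]

lemma abs_expect_quadForm_le [Nonempty J] (hp : ∀ j, IsProb (p j)) {Δ : Matrix α α ℝ}
    (hΔ : ∀ u v, |Δ u v| ≤ 1) : |expect (piW p) (quadForm p Δ)| ≤ 4 := by
  have hK : (0 : ℝ) < Fintype.card J := by exact_mod_cast (Fintype.card_pos : 0 < Fintype.card J)
  rw [expect_quadForm hp, abs_mul, abs_of_nonneg (by positivity), one_div, inv_mul_le_iff₀ hK]
  refine (Finset.abs_sum_le_sum_abs _ _).trans ?_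
  have : ∀ j ∈ Finset.univ, |expect (p j) (fun x =>
      centered (p j) x ⬝ᵥ Δ.mulVec (centered (p j) x))| ≤ 4 := by
    intro j _
    refine ((hp j).abs_expect_le _).trans ((hp j).expect_le fun x => ?_)
    refine (abs_bilin_le hΔ _ _).trans ?_
    have h1 := sum_abs_centered_le (hp j) x
    have h0 : 0 ≤ ∑ u, |centered (p j) x u| := Finset.sum_nonneg fun _ _ => abs_nonneg _
    nlinarith
  simpa using Finset.sum_le_card_nsmul _ _ _ this

end

/-! ### Haar wavelets -/

section haar

variable {m : ℕ}

/-- A Haar wavelet is constant on the dyadic blocks of half its support. -/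
lemma haarSign_some (i : Fin m) (j : Fin (2 ^ (i : ℕ))) (x : Fin (2 ^ m)) :
    haarSign m (some ⟨i, j⟩) x = if (x : ℕ) / 2 ^ (m - i - 1) = 2 * j then 1
      else if (x : ℕ) / 2 ^ (m - i - 1) = 2 * j + 1 then -1 else 0 := by
  have hi := i.2
  have h2 : 2 ^ (m - (i : ℕ)) = 2 * 2 ^ (m - (i : ℕ) - 1) := by
    rw [← pow_succ']; congr 1; omega
  have hr : 0 < 2 ^ (m - (i : ℕ) - 1) := by positivity
  have e1 : (2 * j) * 2 ^ (m - (i : ℕ) - 1) = 2 ^ (m - (i : ℕ)) * (j : ℕ) := by rw [h2]; ring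
  have e2 : (2 * (j : ℕ) + 1) * 2 ^ (m - (i : ℕ) - 1)
      = 2 ^ (m - (i : ℕ)) * (j : ℕ) + 2 ^ (m - (i : ℕ) - 1) := by rw [h2]; ring
  have c1 : (x : ℕ) / 2 ^ (m - i - 1) = 2 * j ↔ 2 ^ (m - (i : ℕ)) * (j : ℕ) ≤ (x : ℕ) ∧
      (x : ℕ) < 2 ^ (m - (i : ℕ)) * (j : ℕ) + 2 ^ (m - (i : ℕ) - 1) := by
    rw [Nat.div_eq_iff hr, e1]
    omega
  have c2 : (x : ℕ) / 2 ^ (m - i - 1) = 2 * j + 1 ↔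
      2 ^ (m - (i : ℕ)) * (j : ℕ) + 2 ^ (m - (i : ℕ) - 1) ≤ (x : ℕ) ∧
      (x : ℕ) < 2 ^ (m - (i : ℕ)) * (j : ℕ) + 2 ^ (m - (i : ℕ)) := by
    rw [Nat.div_eq_iff hr, e2]
    omega
  simp only [haarSign, c1, c2]

lemma pow_half (i : Fin m) : 2 ^ (m - (i : ℕ)) = 2 ^ (m - (i : ℕ) - 1) * 2 := by
  rw [← pow_succ]; congr 1; have := i.2; omega

lemma div_block (i : Fin m) (x : ℕ) : x / 2 ^ (m - (i : ℕ)) = x / 2 ^ (m - (i : ℕ) - 1) / 2 := by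
  rw [pow_half, Nat.div_div_eq_div_mul]

lemma div_block_lt (i : Fin m) (x : Fin (2 ^ m)) : (x : ℕ) / 2 ^ (m - (i : ℕ)) < 2 ^ (i : ℕ) := by
  rw [Nat.div_lt_iff_lt_mul (by positivity), ← pow_add]
  have : (i : ℕ) + (m - i) = m := by have := i.2; omega
  rw [this]; exact x.2

/-- The sign that the wavelet at scale `i` whose support contains `x` takes at `x`. -/
noncomputable def scaleSign (m : ℕ) (i : Fin m) (x : Fin (2 ^ m)) : ℝ :=
  if (x : ℕ) / 2 ^ (m - (i : ℕ) - 1) % 2 = 0 then 1 else -1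

lemma haarSign_some' (i : Fin m) (j : Fin (2 ^ (i : ℕ))) (x : Fin (2 ^ m)) :
    haarSign m (some ⟨i, j⟩) x
      = if (j : ℕ) = (x : ℕ) / 2 ^ (m - (i : ℕ)) then scaleSign m i x else 0 := by
  rw [haarSign_some, div_block, scaleSign]
  generalize (x : ℕ) / 2 ^ (m - (i : ℕ) - 1) = y
  split_ifs <;> first | rfl | omega

lemma sum_scale {M : Type*} [AddCommMonoid M] (i : Fin m) (x : Fin (2 ^ m)) (c : M) :
    ∑ j : Fin (2 ^ (i : ℕ)), (if (j : ℕ) = (x : ℕ) / 2 ^ (m - (i : ℕ)) then c else 0) = c := by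
  rw [Finset.sum_eq_single ⟨_, div_block_lt i x⟩]
  · simp
  · intro j _ hj
    rw [if_neg]
    intro h
    exact hj (Fin.ext h)
  · simp

lemma abs_scaleSign (i : Fin m) (x : Fin (2 ^ m)) : |scaleSign m i x| = 1 := by
  unfold scaleSign; split_ifs <;> simp

/-- Every coordinate lies in the support of exactly one wavelet at each scale. -/
lemma sum_abs_haarSign (x : Fin (2 ^ m)) : ∑ a, |haarSign m a x| = m + 1 := by
  rw [Fintype.sum_option, Fintype.sum_sigma]
  simp only [haarSign_some', apply_ite abs, abs_zero, abs_scaleSign, sum_scale]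
  simp [haarSign]
  ring

lemma abs_haarSign_le (a : HaarIdx m) (x : Fin (2 ^ m)) : |haarSign m a x| ≤ 1 := by
  rcases a with _ | ⟨i, j⟩
  · simp [haarSign]
  · rw [haarSign_some']
    split_ifs
    · exact (abs_scaleSign i x).le
    · simp

lemma card_haarIdx : Fintype.card (HaarIdx m) = 2 ^ m := by
  simp only [Fintype.card_option, Fintype.card_sigma, Fintype.card_fin]
  rw [Fin.sum_univ_eq_sum_range (fun i => 2 ^ i), Nat.geomSum_eq le_rfl]
  have : 1 ≤ 2 ^ m := Nat.one_le_two_pow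
  simp; omega

lemma haarWeight_none_mul_self : haarWeight m none * haarWeight m none = 1 / 2 ^ m := by
  simp only [haarWeight]
  rw [div_mul_div_comm, Real.mul_self_sqrt (by positivity), one_mul]

lemma haarWeight_some_mul_self (i : Fin m) (j : Fin (2 ^ (i : ℕ))) :
    haarWeight m (some ⟨i, j⟩) * haarWeight m (some ⟨i, j⟩) = 1 / 2 ^ (m - (i : ℕ)) := by
  simp only [haarWeight]
  rw [div_mul_div_comm, Real.mul_self_sqrt (by positivity), one_mul]

/-- The Haar wavelets form an orthonormal basis. The contribution of each scale is the difference
of the normalized indicators that `x` and `y` share a block, which telescopes over the scales. -/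
lemma sum_haarWeight_sq_mul (x y : Fin (2 ^ m)) :
    ∑ a, haarWeight m a * haarWeight m a * (haarSign m a x * haarSign m a y)
      = if x = y then 1 else 0 := by
  set e : ℕ → ℝ := fun i =>
    if (x : ℕ) / 2 ^ (m - i) = (y : ℕ) / 2 ^ (m - i) then 1 / 2 ^ (m - i) else 0 with he
  have hsome : ∀ i : Fin m, ∑ j : Fin (2 ^ (i : ℕ)), haarWeight m (some ⟨i, j⟩) *
      haarWeight m (some ⟨i, j⟩) * (haarSign m (some ⟨i, j⟩) x * haarSign m (some ⟨i, j⟩) y)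
      = e (i + 1) - e i := by
    intro i
    have h1 : ∀ j : Fin (2 ^ (i : ℕ)), haarWeight m (some ⟨i, j⟩) *
        haarWeight m (some ⟨i, j⟩) * (haarSign m (some ⟨i, j⟩) x * haarSign m (some ⟨i, j⟩) y)
        = if (j : ℕ) = (x : ℕ) / 2 ^ (m - (i : ℕ)) then
          (if (x : ℕ) / 2 ^ (m - (i : ℕ)) = (y : ℕ) / 2 ^ (m - (i : ℕ)) then
            1 / 2 ^ (m - (i : ℕ)) * (scaleSign m i x * scaleSign m i y) else 0) else 0 := by
      intro j
      rw [haarWeight_some_mul_self, haarSign_some', haarSign_some']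
      split_ifs with h1 h2 h3 h4 <;> simp_all
    simp only [h1, sum_scale, he]
    have h3 : (2 : ℝ) ^ (m - (i : ℕ)) = 2 ^ (m - (i : ℕ) - 1) * 2 := by exact_mod_cast pow_half i
    rw [show m - ((i : ℕ) + 1) = m - i - 1 by omega, h3, div_block, div_block, scaleSign, scaleSign]
    have hp : (0 : ℝ) < 2 ^ (m - (i : ℕ) - 1) := by positivity
    generalize (2 : ℝ) ^ (m - (i : ℕ) - 1) = z at hp
    generalize (x : ℕ) / 2 ^ (m - (i : ℕ) - 1) = u
    generalize (y : ℕ) / 2 ^ (m - (i : ℕ) - 1) = v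
    by_cases h1 : u / 2 = v / 2 <;> by_cases h2 : u = v
    · subst h2
      by_cases hu : u % 2 = 0 <;> simp only [hu, if_true, if_false] <;> field_simp <;> norm_num
    · by_cases hu : u % 2 = 0
      · have hv : ¬ v % 2 = 0 := by omega
        simp only [h1, h2, hu, hv, if_true, if_false]; field_simp; norm_num
      · have hv : v % 2 = 0 := by omega
        simp only [h1, h2, hu, hv, if_true, if_false]; field_simp; norm_num
    · omega
    · simp [h1, h2]
  rw [Fintype.sum_option, Fintype.sum_sigma]
  simp only [hsome]
  rw [Fin.sum_univ_eq_sum_range (fun i => e (i + 1) - e i), Finset.sum_range_sub,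
    haarWeight_none_mul_self]
  have h0 : e 0 = 1 / 2 ^ m := by
    simp only [he, Nat.sub_zero, Nat.div_eq_of_lt x.2, Nat.div_eq_of_lt y.2, if_true]
  have hm : e m = if x = y then 1 else 0 := by
    simp only [he, Nat.sub_self, pow_zero, Nat.div_one, Fin.ext_iff, div_one]
  rw [h0, hm]
  simp [haarSign]

lemma weightedHaar_eq (S : Matrix (Fin (2 ^ m)) (Fin (2 ^ m)) ℝ) (a b : HaarIdx m) :
    weightedHaar m S a b = ∑ u, ∑ v, (haarWeight m a * haarWeight m a * haarSign m a u) *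
      (haarWeight m b * haarWeight m b * haarSign m b v) * S u v := by
  simp only [weightedHaar, Matrix.mul_apply, Matrix.transpose_apply, haarMatrix, Finset.sum_mul,
    Finset.mul_sum]
  rw [Finset.sum_comm]
  exact Finset.sum_congr rfl fun u _ => Finset.sum_congr rfl fun v _ => by ring

/-- Haar reconstruction: the entries of the weighted Haar transform are the coefficients of `S`
with respect to the unnormalized products of wavelets. -/
lemma sum_weightedHaar_mul (S : Matrix (Fin (2 ^ m)) (Fin (2 ^ m)) ℝ) (x y : Fin (2 ^ m)) :
    ∑ a, ∑ b, weightedHaar m S a b * (haarSign m a x * haarSign m b y) = S x y := by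
  have h : ∀ a b, weightedHaar m S a b * (haarSign m a x * haarSign m b y)
      = ∑ u, ∑ v, (haarWeight m a * haarWeight m a * (haarSign m a u * haarSign m a x)) *
        (haarWeight m b * haarWeight m b * (haarSign m b v * haarSign m b y)) * S u v := by
    intro a b
    rw [weightedHaar_eq, Finset.sum_mul]
    refine Finset.sum_congr rfl fun u _ => ?_
    rw [Finset.sum_mul]
    exact Finset.sum_congr rfl fun v _ => by ring
  simp only [h]
  calc _ = ∑ u, ∑ v, (∑ a, haarWeight m a * haarWeight m a * (haarSign m a u * haarSign m a x)) *
        (∑ b, haarWeight m b * haarWeight m b * (haarSign m b v * haarSign m b y)) * S u v := by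
        conv_lhs =>
          enter [2, a]
          rw [Finset.sum_comm]
        rw [Finset.sum_comm]
        refine Finset.sum_congr rfl fun u _ => ?_
        conv_lhs =>
          enter [2, a]
          rw [Finset.sum_comm]
        rw [Finset.sum_comm]
        refine Finset.sum_congr rfl fun v _ => ?_
        rw [Finset.sum_mul_sum, Finset.sum_mul]
        exact Finset.sum_congr rfl fun a _ => by rw [Finset.sum_mul]
    _ = S x y := by
        simp only [sum_haarWeight_sq_mul]
        simp

/-! ### Truncation to heavy wavelets -/

/-- The mass that `q` gives to the support of a wavelet. -/
noncomputable def waveMass (m : ℕ) (q : Fin (2 ^ m) → ℝ) (a : HaarIdx m) : ℝ :=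
  ∑ x, q x * |haarSign m a x|

open Classical in
/-- The wavelets whose supports have mass at least `θ`. -/
noncomputable def heavy (m : ℕ) (q : Fin (2 ^ m) → ℝ) (θ : ℝ) : Finset (HaarIdx m) :=
  Finset.univ.filter fun a => θ ≤ waveMass m q a

lemma mem_heavy {q : Fin (2 ^ m) → ℝ} {θ : ℝ} {a : HaarIdx m} :
    a ∈ heavy m q θ ↔ θ ≤ waveMass m q a := by
  classical
  simp [heavy]

/-- The mass of the dyadic block of scale `i` around `x`. -/
noncomputable def blockMass (m : ℕ) (q : Fin (2 ^ m) → ℝ) (i : ℕ) (x : Fin (2 ^ m)) : ℝ :=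
  ∑ y : Fin (2 ^ m), if (y : ℕ) / 2 ^ (m - i) = (x : ℕ) / 2 ^ (m - i) then q y else 0

lemma card_heavy_mul_le {q : Fin (2 ^ m) → ℝ} (hq : ∀ x, 0 ≤ q x) (θ : ℝ) :
    (heavy m q θ).card * θ ≤ (m + 1) * ∑ x, q x := by
  calc (heavy m q θ).card * θ = ∑ a ∈ heavy m q θ, θ := by simp
    _ ≤ ∑ a ∈ heavy m q θ, waveMass m q a := Finset.sum_le_sum fun a ha => mem_heavy.1 ha
    _ ≤ ∑ a, waveMass m q a := Finset.sum_le_sum_of_subset_of_nonneg (Finset.subset_univ _)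
        fun a _ _ => Finset.sum_nonneg fun x _ => mul_nonneg (hq x) (abs_nonneg _)
    _ = (m + 1) * ∑ x, q x := by
        simp only [waveMass]
        rw [Finset.sum_comm]
        simp only [← Finset.mul_sum, sum_abs_haarSign]
        rw [← Finset.sum_mul, mul_comm]

lemma div_pow_eq_of_le {x y r t : ℕ} (hrt : r ≤ t) (h : x / 2 ^ r = y / 2 ^ r) :
    x / 2 ^ t = y / 2 ^ t := by
  obtain ⟨d, rfl⟩ := Nat.exists_eq_add_of_le hrt
  rw [pow_add, ← Nat.div_div_eq_div_mul, ← Nat.div_div_eq_div_mul, h]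

lemma blockMass_anti {q : Fin (2 ^ m) → ℝ} (hq : ∀ x, 0 ≤ q x) {i i' : ℕ} (h : i ≤ i')
    (x : Fin (2 ^ m)) : blockMass m q i' x ≤ blockMass m q i x := by
  refine Finset.sum_le_sum fun y _ => ?_
  split_ifs with h1 h2 h2
  · exact le_rfl
  · exact absurd (div_pow_eq_of_le (by omega) h1) h2
  · exact hq y
  · exact le_rfl

lemma waveMass_of_mem {q : Fin (2 ^ m) → ℝ} {i : Fin m} {j : Fin (2 ^ (i : ℕ))} {x : Fin (2 ^ m)}
    (h : (j : ℕ) = (x : ℕ) / 2 ^ (m - (i : ℕ))) :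
    waveMass m q (some ⟨i, j⟩) = blockMass m q i x := by
  refine Finset.sum_congr rfl fun y _ => ?_
  rw [haarSign_some', h]
  by_cases h1 : (y : ℕ) / 2 ^ (m - (i : ℕ)) = (x : ℕ) / 2 ^ (m - (i : ℕ))
  · simp [h1, abs_scaleSign]
  · simp [h1, Ne.symm h1]

lemma exists_cut (q : Fin (2 ^ m) → ℝ) (θ : ℝ) (x : Fin (2 ^ m)) :
    ∃ i, m ≤ i ∨ blockMass m q i x < θ := ⟨m, Or.inl le_rfl⟩

open Classical in
/-- The first scale at which the block around `x` is light. -/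
noncomputable def cut (m : ℕ) (q : Fin (2 ^ m) → ℝ) (θ : ℝ) (x : Fin (2 ^ m)) : ℕ :=
  Nat.find (exists_cut q θ x)

lemma cut_le (q : Fin (2 ^ m) → ℝ) (θ : ℝ) (x : Fin (2 ^ m)) : cut m q θ x ≤ m := by
  classical
  exact Nat.find_min' _ (Or.inl le_rfl)

lemma le_blockMass {q : Fin (2 ^ m) → ℝ} {θ : ℝ} {x : Fin (2 ^ m)} {i : ℕ}
    (h : i < cut m q θ x) : θ ≤ blockMass m q i x := by
  classical
  have := Nat.find_min (exists_cut q θ x) h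
  push Not at this
  exact this.2

lemma blockMass_cut_lt {q : Fin (2 ^ m) → ℝ} {θ : ℝ} {x : Fin (2 ^ m)}
    (h : cut m q θ x < m) : blockMass m q (cut m q θ x) x < θ := by
  classical
  exact (Nat.find_spec (exists_cut q θ x)).resolve_left (not_le.2 h)

/-- A wavelet at a scale from the cut on is not heavy if its support contains `x`. -/
lemma haarSign_eq_zero_of_cut_le {q : Fin (2 ^ m) → ℝ} (hq : ∀ x, 0 ≤ q x) {θ : ℝ}
    {x : Fin (2 ^ m)} {i : Fin m} {j : Fin (2 ^ (i : ℕ))} (hi : cut m q θ x ≤ i)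
    (ha : some ⟨i, j⟩ ∈ heavy m q θ) : haarSign m (some ⟨i, j⟩) x = 0 := by
  rw [haarSign_some', if_neg]
  intro hj
  have h1 := mem_heavy.1 ha
  rw [waveMass_of_mem hj] at h1
  have h2 := blockMass_cut_lt (lt_of_le_of_lt hi i.2 : cut m q θ x < m)
  linarith [blockMass_anti hq hi x]

/-- A wavelet at a scale before the cut is constant on the block of `x`. -/
lemma haarSign_congr {i : Fin m} {j : Fin (2 ^ (i : ℕ))} {x y : Fin (2 ^ m)} {c : ℕ}
    (hi : (i : ℕ) < c) (hxy : (y : ℕ) / 2 ^ (m - c) = (x : ℕ) / 2 ^ (m - c)) :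
    haarSign m (some ⟨i, j⟩) y = haarSign m (some ⟨i, j⟩) x := by
  rw [haarSign_some, haarSign_some, div_pow_eq_of_le (by omega) hxy]

/-- A wavelet has mean zero on each dyadic block which is at least as large as its support. -/
lemma sum_block_haarSign {i : Fin m} {j : Fin (2 ^ (i : ℕ))} {c : ℕ} (hc : c ≤ i) (z : ℕ) :
    ∑ y ∈ Finset.univ.filter (fun y : Fin (2 ^ m) => (y : ℕ) / 2 ^ (m - c) = z),
      haarSign m (some ⟨i, j⟩) y = 0 := by
  have hi := i.2
  set r := m - (i : ℕ) - 1 with hr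
  have hr0 : 0 < 2 ^ r := by positivity
  -- exchange the two halves of the blocks of size `2 ^ (r + 1)`
  let g : ℕ → ℕ := fun y => if y / 2 ^ r % 2 = 0 then y + 2 ^ r else y - 2 ^ r
  have hge : ∀ y, y / 2 ^ r % 2 = 0 → g y / 2 ^ r = y / 2 ^ r + 1 := by
    intro y h
    simp only [g, if_pos h]
    rw [Nat.add_div_right _ hr0]
  have hle : ∀ y, ¬ y / 2 ^ r % 2 = 0 → 2 ^ r ≤ y := by
    intro y h
    by_contra hlt
    exact h (by rw [Nat.div_eq_of_lt (not_le.1 hlt)])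
  have hgo : ∀ y, ¬ y / 2 ^ r % 2 = 0 → g y / 2 ^ r = y / 2 ^ r - 1 := by
    intro y h
    simp only [g, if_neg h]
    have := Nat.add_div_right (y - 2 ^ r) hr0
    rw [Nat.sub_add_cancel (hle y h)] at this
    rw [this, Nat.succ_sub_one]
  have hgg : ∀ y, g (g y) = y := by
    intro y
    by_cases h : y / 2 ^ r % 2 = 0
    · have h2 : ¬ g y / 2 ^ r % 2 = 0 := by
        rw [hge y h]; generalize y / 2 ^ r = u at h; omega
      have e1 : g (g y) = g y - 2 ^ r := if_neg h2
      have e2 : g y = y + 2 ^ r := if_pos h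
      rw [e1, e2, Nat.add_sub_cancel]
    · have h2 : g y / 2 ^ r % 2 = 0 := by
        rw [hgo y h]; generalize y / 2 ^ r = u at h; omega
      have e1 : g (g y) = g y + 2 ^ r := if_pos h2
      have e2 : g y = y - 2 ^ r := if_neg h
      rw [e1, e2, Nat.sub_add_cancel (hle y h)]
  have hg2 : ∀ y, g y / 2 ^ (r + 1) = y / 2 ^ (r + 1) := by
    intro y
    rw [pow_succ, ← Nat.div_div_eq_div_mul, ← Nat.div_div_eq_div_mul]
    by_cases h : y / 2 ^ r % 2 = 0
    · rw [hge y h]; generalize y / 2 ^ r = u at h; omega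
    · rw [hgo y h]; generalize y / 2 ^ r = u at h; omega
  have hgb : ∀ t, r + 1 ≤ t → ∀ y, g y / 2 ^ t = y / 2 ^ t := fun t ht y =>
    div_pow_eq_of_le ht (hg2 y)
  have hglt : ∀ y : Fin (2 ^ m), g y < 2 ^ m := by
    intro y
    have := hgb m (by omega) y
    rw [Nat.div_eq_of_lt y.2] at this
    exact (Nat.div_eq_zero_iff_lt (by positivity)).1 this
  refine Finset.sum_involution (fun y _ => ⟨g y, hglt y⟩) ?_ ?_ ?_ ?_
  · intro y _
    rw [haarSign_some, haarSign_some]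
    simp only [← hr]
    by_cases h : (y : ℕ) / 2 ^ r % 2 = 0
    · rw [hge y h]
      generalize (y : ℕ) / 2 ^ r = u at h
      split_ifs <;> first | omega | norm_num
    · rw [hgo y h]
      generalize (y : ℕ) / 2 ^ r = u at h
      split_ifs <;> first | omega | norm_num
  · intro y _ _ h
    have h1 := congrArg Fin.val h
    simp only at h1
    have h2 : g y / 2 ^ r = (y : ℕ) / 2 ^ r := by rw [h1]
    by_cases h : (y : ℕ) / 2 ^ r % 2 = 0
    · rw [hge y h] at h2; omega
    · rw [hgo y h] at h2; generalize (y : ℕ) / 2 ^ r = u at h h2; omega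
  · intro y hy
    simp only [Finset.mem_filter, Finset.mem_univ, true_and] at hy ⊢
    rw [hgb _ (by omega), hy]
  · intro y _
    exact Fin.ext (hgg y)

/-- The block of `x` at the cut. -/
noncomputable def cutBlock (m : ℕ) (q : Fin (2 ^ m) → ℝ) (θ : ℝ) (x : Fin (2 ^ m)) :
    Finset (Fin (2 ^ m)) :=
  Finset.univ.filter fun y =>
    (y : ℕ) / 2 ^ (m - cut m q θ x) = (x : ℕ) / 2 ^ (m - cut m q θ x)

/-- Averaging over the block at the cut keeps the heavy wavelets and kills all others. -/
lemma sum_cutBlock {q : Fin (2 ^ m) → ℝ} (hq : ∀ x, 0 ≤ q x) {θ : ℝ} (hθ : θ ≤ ∑ x, q x)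
    (x : Fin (2 ^ m)) (a : HaarIdx m) [Decidable (a ∈ heavy m q θ)] :
    ∑ y ∈ cutBlock m q θ x, haarSign m a y
      = (cutBlock m q θ x).card * (if a ∈ heavy m q θ then haarSign m a x else 0) := by
  rcases a with _ | ⟨i, j⟩
  · rw [if_pos]
    · simp [haarSign]
    · rw [mem_heavy]; simpa [waveMass, haarSign] using hθ
  · rcases lt_or_ge (i : ℕ) (cut m q θ x) with hi | hi
    · have h1 : ∀ y ∈ cutBlock m q θ x, haarSign m (some ⟨i, j⟩) y = haarSign m (some ⟨i, j⟩) x :=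
        fun y hy => haarSign_congr hi (by simpa [cutBlock] using hy)
      rw [Finset.sum_congr rfl h1, Finset.sum_const, nsmul_eq_mul]
      split_ifs with ha
      · rfl
      · rw [haarSign_some', if_neg]
        intro hj
        refine ha (mem_heavy.2 ?_)
        rw [waveMass_of_mem hj]
        exact le_blockMass hi
    · rw [cutBlock, sum_block_haarSign hi]
      split_ifs with ha
      · rw [haarSign_eq_zero_of_cut_le hq hi ha, mul_zero]
      · simp

/-- The truncation of `S` to the products of heavy wavelets is an average of entries of `S`. -/
lemma abs_sum_heavy_le {q : Fin (2 ^ m) → ℝ} (hq : ∀ x, 0 ≤ q x) {θ : ℝ} (hθ : θ ≤ ∑ x, q x)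
    {S : Matrix (Fin (2 ^ m)) (Fin (2 ^ m)) ℝ} (hS : ∀ x y, |S x y| ≤ 1) (x y : Fin (2 ^ m)) :
    |∑ a ∈ heavy m q θ, ∑ b ∈ heavy m q θ,
      weightedHaar m S a b * (haarSign m a x * haarSign m b y)| ≤ 1 := by
  classical
  set P := cutBlock m q θ x
  set Q := cutBlock m q θ y
  have hP : (0 : ℝ) < P.card := by
    exact_mod_cast Finset.card_pos.2 ⟨x, by simp [P, cutBlock]⟩
  have hQ : (0 : ℝ) < Q.card := by
    exact_mod_cast Finset.card_pos.2 ⟨y, by simp [Q, cutBlock]⟩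
  have key : ∑ u ∈ P, ∑ v ∈ Q, S u v = P.card * Q.card * ∑ a ∈ heavy m q θ, ∑ b ∈ heavy m q θ,
      weightedHaar m S a b * (haarSign m a x * haarSign m b y) := by
    calc ∑ u ∈ P, ∑ v ∈ Q, S u v
        = ∑ u ∈ P, ∑ v ∈ Q, ∑ a, ∑ b, weightedHaar m S a b * (haarSign m a u * haarSign m b v) := by
          simp only [sum_weightedHaar_mul]
      _ = ∑ a, ∑ b, ∑ u ∈ P, ∑ v ∈ Q, weightedHaar m S a b * (haarSign m a u * haarSign m b v) := by
          conv_lhs =>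
            enter [2, u]
            rw [Finset.sum_comm]
          rw [Finset.sum_comm]
          refine Finset.sum_congr rfl fun a _ => ?_
          conv_lhs =>
            enter [2, u]
            rw [Finset.sum_comm]
          rw [Finset.sum_comm]
      _ = ∑ a, ∑ b, weightedHaar m S a b *
            ((P.card * (if a ∈ heavy m q θ then haarSign m a x else 0)) *
            (Q.card * (if b ∈ heavy m q θ then haarSign m b y else 0))) := by
          refine Finset.sum_congr rfl fun a _ => Finset.sum_congr rfl fun b _ => ?_
          rw [← sum_cutBlock hq hθ x a, ← sum_cutBlock hq hθ y b, Finset.sum_mul_sum,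
            Finset.mul_sum]
          exact Finset.sum_congr rfl fun u _ => by rw [Finset.mul_sum]
      _ = _ := by
          rw [← Finset.sum_subset (Finset.subset_univ (heavy m q θ)), Finset.mul_sum]
          · refine Finset.sum_congr rfl fun a ha => ?_
            rw [← Finset.sum_subset (Finset.subset_univ (heavy m q θ)), Finset.mul_sum]
            · refine Finset.sum_congr rfl fun b hb => ?_
              rw [if_pos ha, if_pos hb]; ring
            · intro b _ hb
              rw [if_neg hb]; ring
          · intro a _ ha
            refine Finset.sum_eq_zero fun b _ => ?_
            rw [if_neg ha]; ring
  have hb : |∑ u ∈ P, ∑ v ∈ Q, S u v| ≤ P.card * Q.card := by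
    refine (Finset.abs_sum_le_sum_abs _ _).trans ?_
    have : ∀ u ∈ P, |∑ v ∈ Q, S u v| ≤ Q.card := by
      intro u _
      refine (Finset.abs_sum_le_sum_abs _ _).trans ?_
      simpa using Finset.sum_le_card_nsmul Q _ 1 fun v _ => hS u v
    simpa using Finset.sum_le_card_nsmul P _ _ this
  rw [key, abs_mul, abs_of_pos (by positivity)] at hb
  exact le_of_mul_le_mul_left (by linarith) (mul_pos hP hQ)

/-- The heavy wavelets take at most `2 |T|` different sign patterns, where `T` is the set of heavy
wavelets: a pattern is determined by the finest heavy wavelet that contains the point and by its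
sign. -/
lemma exists_representatives {q : Fin (2 ^ m) → ℝ} (hq : ∀ x, 0 ≤ q x) {θ : ℝ}
    (hθ : θ ≤ ∑ x, q x) (hm : 1 ≤ m) :
    ∃ R : Finset (Fin (2 ^ m)), R.card ≤ 2 * (heavy m q θ).card ∧
      ∀ x, ∃ x' ∈ R, ∀ a ∈ heavy m q θ, haarSign m a x = haarSign m a x' := by
  classical
  have hcut : ∀ x, 1 ≤ cut m q θ x := by
    intro x
    by_contra h0
    have h0 : cut m q θ x = 0 := by omega
    have h1 := blockMass_cut_lt (q := q) (θ := θ) (x := x) (by omega)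
    rw [h0] at h1
    simp only [blockMass, Nat.sub_zero, Nat.div_eq_of_lt (Fin.isLt _), if_true] at h1
    linarith
  -- the finest heavy wavelet that contains `x`
  have hex : ∀ x, ∃ a ∈ heavy m q θ, ∃ (i : Fin m) (j : Fin (2 ^ (i : ℕ))), a = some ⟨i, j⟩ ∧
      (i : ℕ) + 1 = cut m q θ x ∧ (j : ℕ) = (x : ℕ) / 2 ^ (m - (i : ℕ)) := by
    intro x
    have h1 := hcut x
    have h2 := cut_le q θ x
    let i : Fin m := ⟨cut m q θ x - 1, by omega⟩
    refine ⟨some ⟨i, ⟨_, div_block_lt i x⟩⟩, ?_, i, _, rfl, by simp only [i]; omega, rfl⟩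
    rw [mem_heavy, waveMass_of_mem (x := x) rfl]
    exact le_blockMass (by simp only [i]; omega)
  choose f hf i j hij hi hj using hex
  let φ : Fin (2 ^ m) → heavy m q θ × Bool := fun x =>
    (⟨f x, hf x⟩, decide ((x : ℕ) / 2 ^ (m - (i x : ℕ) - 1) % 2 = 0))
  have hφ : ∀ x y, φ x = φ y → ∀ a ∈ heavy m q θ, haarSign m a x = haarSign m a y := by
    intro x y hxy a ha
    simp only [φ, Prod.mk.injEq, Subtype.mk.injEq, decide_eq_decide] at hxy
    obtain ⟨h1, h2⟩ := hxy
    have h3 : (⟨i x, j x⟩ : Σ i : Fin m, Fin (2 ^ (i : ℕ))) = ⟨i y, j y⟩ := by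
      rw [hij x, hij y] at h1; exact Option.some.inj h1
    have h4 : (i x : ℕ) = i y := by rw [(Sigma.mk.inj h3).1]
    have h5 : (j x : ℕ) = j y := by
      have := congrArg (fun s : Σ i : Fin m, Fin (2 ^ (i : ℕ)) => (s.2 : ℕ)) h3
      exact this
    have hc : cut m q θ x = cut m q θ y := by rw [← hi x, ← hi y, h4]
    have hb : (x : ℕ) / 2 ^ (m - cut m q θ y) = (y : ℕ) / 2 ^ (m - cut m q θ y) := by
      have e : m - cut m q θ y = m - (i y : ℕ) - 1 := by rw [← hi y]; omega
      have h6 : (j x : ℕ) = (x : ℕ) / 2 ^ (m - (i y : ℕ) - 1) / 2 := by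
        rw [← h4, ← div_block]; exact hj x
      have h7 := hj y
      rw [div_block] at h7
      rw [h4] at h2
      rw [e]
      generalize (x : ℕ) / 2 ^ (m - (i y : ℕ) - 1) = u at h2 h6 ⊢
      generalize (y : ℕ) / 2 ^ (m - (i y : ℕ) - 1) = v at h2 h7 ⊢
      omega
    rcases a with _ | ⟨i', j'⟩
    · rfl
    · rcases lt_or_ge (i' : ℕ) (cut m q θ y) with h | h
      · exact haarSign_congr h hb
      · rw [haarSign_eq_zero_of_cut_le hq h ha, haarSign_eq_zero_of_cut_le hq (hc ▸ h) ha]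
  let x₀ : Fin (2 ^ m) := ⟨0, by positivity⟩
  refine ⟨Finset.univ.image fun v : heavy m q θ × Bool =>
    if h : ∃ x, φ x = v then h.choose else x₀, ?_, ?_⟩
  · refine Finset.card_image_le.trans ?_
    simp [Finset.card_univ, mul_comm]
  · intro x
    have h : ∃ x', φ x' = φ x := ⟨x, rfl⟩
    exact ⟨h.choose, Finset.mem_image.2 ⟨φ x, Finset.mem_univ _, by rw [dif_pos h]⟩,
      fun a ha => (hφ _ _ h.choose_spec a ha).symm⟩

end haar

/-! ### Randomized rounding -/

/-- The distribution that rounds `x` up with probability `fract x`. -/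
noncomputable def roundW (x : ℝ) : Bool → ℝ := fun b => if b then Int.fract x else 1 - Int.fract x

/-- The rounded value. -/
noncomputable def roundTo (x : ℝ) (b : Bool) : ℤ := ⌊x⌋ + if b then 1 else 0

lemma isProb_roundW (x : ℝ) : IsProb (roundW x) where
  nonneg b := by
    cases b
    · simpa [roundW] using (Int.fract_lt_one x).le
    · simp [roundW]
  sum_one := by simp [roundW]

lemma expect_roundW (x : ℝ) (f : Bool → ℝ) :
    expect (roundW x) f = Int.fract x * f true + (1 - Int.fract x) * f false := by
  simp [expect, roundW]

lemma expect_roundTo (x : ℝ) : expect (roundW x) (fun b => (roundTo x b : ℝ)) = x := by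
  rw [expect_roundW]
  simp only [roundTo, if_true, Bool.false_eq_true, if_false]
  push_cast
  linarith [Int.floor_add_fract x]

lemma abs_roundTo_sub_le (x : ℝ) (b : Bool) : |(roundTo x b : ℝ) - x| ≤ 1 := by
  have h1 := Int.floor_le x
  have h2 := Int.lt_floor_add_one x
  rw [abs_le]
  cases b <;> simp only [roundTo, if_true, Bool.false_eq_true, if_false] <;> push_cast <;>
    constructor <;> linarith

lemma expect_exp_abs_roundTo_le (x : ℝ) :
    expect (roundW x) (fun b => Real.exp |(roundTo x b : ℝ)|) ≤ Real.exp (2 * |x|) := by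
  have hf0 := Int.fract_nonneg x
  have hf1 := (Int.fract_lt_one x).le
  have hx := Int.floor_add_fract x
  have he : Real.exp 1 ≤ 3 := Real.exp_one_lt_three.le
  rw [expect_roundW]
  simp only [roundTo, if_true, Bool.false_eq_true, if_false]
  push_cast
  rw [add_zero]
  set f := Int.fract x
  rcases le_or_gt 0 ⌊x⌋ with hn | hn
  · have hn' : (0 : ℝ) ≤ ⌊x⌋ := by exact_mod_cast hn
    set n : ℝ := (⌊x⌋ : ℝ)
    rw [abs_of_nonneg (by linarith : 0 ≤ n + 1), abs_of_nonneg hn',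
      abs_of_nonneg (by linarith : 0 ≤ x), Real.exp_add]
    have h1 : f * Real.exp 1 + (1 - f) ≤ Real.exp (2 * f) := by
      have := Real.add_one_le_exp (2 * f)
      nlinarith
    calc f * (Real.exp n * Real.exp 1) + (1 - f) * Real.exp n
        = Real.exp n * (f * Real.exp 1 + (1 - f)) := by ring
      _ ≤ Real.exp n * Real.exp (2 * f) := mul_le_mul_of_nonneg_left h1 (Real.exp_pos _).le
      _ ≤ Real.exp (2 * x) := by
        rw [← Real.exp_add]; exact Real.exp_le_exp.2 (by linarith)
  · have hn' : (⌊x⌋ : ℝ) ≤ -1 := by exact_mod_cast (by omega : ⌊x⌋ ≤ -1)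
    set n : ℝ := (⌊x⌋ : ℝ)
    rw [abs_of_nonpos (by linarith : n + 1 ≤ 0), abs_of_nonpos (by linarith : n ≤ 0),
      abs_of_nonpos (by linarith : x ≤ 0)]
    have h1 : f + (1 - f) * Real.exp 1 ≤ Real.exp (2 * (1 - f)) := by
      have := Real.add_one_le_exp (2 * (1 - f))
      nlinarith
    calc f * Real.exp (-(n + 1)) + (1 - f) * Real.exp (-n)
        = Real.exp (-(n + 1)) * (f + (1 - f) * Real.exp 1) := by
          rw [show -n = -(n + 1) + 1 by ring, Real.exp_add]; ring
      _ ≤ Real.exp (-(n + 1)) * Real.exp (2 * (1 - f)) :=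
          mul_le_mul_of_nonneg_left h1 (Real.exp_pos _).le
      _ ≤ Real.exp (2 * -x) := by
        rw [← Real.exp_add]; exact Real.exp_le_exp.2 (by linarith)

/-- **Randomized rounding.** A coefficient vector `L` whose evaluations `∑ α, L α * s α r` are
bounded by one is, up to a tiny error, a mixture of multiples of `1 / M` that have small `ℓ¹` norm
and whose evaluations are bounded by two. At each point the rounding error is a sum of at most `V`
independent variables of size `1 / M`, so it suffices that `M ^ 2` is large compared with `V`. -/
theorem exists_rounding {J E : Type*} [Fintype J] [DecidableEq J] [Fintype E]
    (L : J → ℝ) (s : J → E → ℝ) {S B V : ℝ} {M : ℕ} (hM : 1 ≤ M) (hV : 0 < V) (hB : 0 ≤ B)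
    (hL : ∀ α, |L α| ≤ 1) (hLS : ∑ α, |L α| ≤ S) (hs : ∀ α r, |s α r| ≤ 1)
    (hsV : ∀ r, ∑ α, |s α r| ≤ V) (hLs : ∀ r, |∑ α, L α * s α r| ≤ 1) :
    ∃ (p : (J → Bool) → ℝ) (z : (J → Bool) → J → ℤ), IsProb p ∧
      (∀ ω, ∑ α, |(z ω α : ℝ)| ≤ B) ∧ (∀ ω r, |∑ α, (z ω α : ℝ) * s α r| ≤ 2 * M) ∧
      ∀ α, |L α - expect p (fun ω => (z ω α : ℝ) / M)|
        ≤ 2 * (Fintype.card E * (2 * Real.exp (-(M : ℝ) ^ 2 / (2 * V)))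
          + Real.exp (2 * M * S - B)) := by
  classical
  have hM0 : (0 : ℝ) < M := by exact_mod_cast hM
  have hM1 : (1 : ℝ) ≤ M := by exact_mod_cast hM
  set x : J → ℝ := fun α => M * L α with hx
  set p := piW fun α => roundW (x α) with hp
  have hpα : ∀ α, IsProb (roundW (x α)) := fun α => isProb_roundW _
  have hP : IsProb p := isProb_piW hpα
  set z₀ : (J → Bool) → J → ℤ := fun ω α => roundTo (x α) (ω α) with hz₀
  set good : (J → Bool) → Prop := fun ω => ∑ α, |(z₀ ω α : ℝ)| ≤ B ∧
    ∀ r, |∑ α, (z₀ ω α : ℝ) * s α r| ≤ 2 * M with hgood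
  -- failure probabilities
  have hbad1 : prob p (fun ω => ¬ ∑ α, |(z₀ ω α : ℝ)| ≤ B) ≤ Real.exp (2 * M * S - B) := by
    calc _ ≤ expect p (fun ω => Real.exp (-B) * Real.exp (∑ α, |(z₀ ω α : ℝ)|)) := by
          refine hP.prob_le_expect (fun ω => by positivity) fun ω h => ?_
          rw [← Real.exp_add]
          exact Real.one_le_exp (by linarith [not_le.1 h])
      _ ≤ Real.exp (-B) * Real.exp (∑ α, 2 * |x α|) := by
          rw [expect_const_mul]
          refine mul_le_mul_of_nonneg_left ?_ (Real.exp_pos _).le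
          exact expect_piW_exp_sum_le hpα (fun α b => |(roundTo (x α) b : ℝ)|)
            fun α => expect_exp_abs_roundTo_le _
      _ ≤ _ := by
          rw [← Real.exp_add]
          refine Real.exp_le_exp.2 ?_
          have : ∑ α, 2 * |x α| = 2 * M * ∑ α, |L α| := by
            rw [Finset.mul_sum]
            refine Finset.sum_congr rfl fun α _ => ?_
            rw [hx, abs_mul, abs_of_pos hM0]; ring
          rw [this]
          nlinarith
  have hmgf : ∀ (c : ℝ) r, expect p (fun ω => Real.exp (∑ α, c * (((z₀ ω α : ℝ) - x α) * s α r)))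
      ≤ Real.exp (c ^ 2 * V / 2) := by
    intro c r
    refine (expect_piW_exp_sum_le hpα (fun α b => c * (((roundTo (x α) b : ℝ) - x α) * s α r))
      (c := fun α => (|c| * |s α r|) ^ 2 / 2) fun α => ?_).trans ?_
    · refine (hpα α).hoeffding (fun b => ?_) ?_
      · rw [abs_mul, abs_mul]
        refine mul_le_mul_of_nonneg_left ?_ (abs_nonneg _)
        exact mul_le_of_le_one_left (abs_nonneg _) (abs_roundTo_sub_le _ _)
      · rw [expect_const_mul, expect_mul_const, expect_sub, expect_roundTo,
          (hpα α).expect_const]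
        ring
    · refine Real.exp_le_exp.2 ?_
      calc ∑ α, (|c| * |s α r|) ^ 2 / 2 ≤ ∑ α, c ^ 2 / 2 * |s α r| := by
            refine Finset.sum_le_sum fun α _ => ?_
            rw [mul_pow, sq_abs c]
            have h0 := abs_nonneg (s α r)
            have h1 := hs α r
            have : |s α r| ^ 2 ≤ |s α r| := by nlinarith
            have := mul_le_mul_of_nonneg_left this (by positivity : 0 ≤ c ^ 2 / 2)
            linarith
        _ ≤ c ^ 2 * V / 2 := by
            rw [← Finset.mul_sum]
            have := mul_le_mul_of_nonneg_left (hsV r) (by positivity : 0 ≤ c ^ 2 / 2)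
            linarith
  have hbad2 : ∀ r, prob p (fun ω => ¬ |∑ α, (z₀ ω α : ℝ) * s α r| ≤ 2 * M)
      ≤ 2 * Real.exp (-(M : ℝ) ^ 2 / (2 * V)) := by
    intro r
    set c : ℝ := M / V with hc
    have hc0 : 0 < c := by positivity
    have e : ∀ ω, ∑ α, (z₀ ω α : ℝ) * s α r
        = ∑ α, ((z₀ ω α : ℝ) - x α) * s α r + M * ∑ α, L α * s α r := by
      intro ω
      rw [Finset.mul_sum, ← Finset.sum_add_distrib]
      refine Finset.sum_congr rfl fun α _ => ?_
      simp only [hx]; ring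
    calc _ ≤ expect p (fun ω =>
          Real.exp (-(c * M)) * Real.exp (∑ α, c * (((z₀ ω α : ℝ) - x α) * s α r))
          + Real.exp (-(c * M)) * Real.exp (∑ α, (-c) * (((z₀ ω α : ℝ) - x α) * s α r))) := by
          refine hP.prob_le_expect (fun ω => by positivity) fun ω h => ?_
          rw [← Real.exp_add, ← Real.exp_add, ← Finset.mul_sum, ← Finset.mul_sum]
          rw [e] at h
          set W := ∑ α, ((z₀ ω α : ℝ) - x α) * s α r
          have h2 := abs_le.1 (hLs r)
          have h3 : M ≤ |W| := by
            by_contra hlt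
            refine h ?_
            have h4 := abs_lt.1 (not_le.1 hlt)
            rw [abs_le]
            constructor <;> nlinarith
          rcases le_abs.1 h3 with h4 | h4
          · have := Real.one_le_exp (show 0 ≤ -(c * M) + c * W by nlinarith)
            linarith [Real.exp_pos (-(c * M) + -c * W)]
          · have := Real.one_le_exp (show 0 ≤ -(c * M) + -c * W by nlinarith)
            linarith [Real.exp_pos (-(c * M) + c * W)]
      _ ≤ Real.exp (-(c * M)) * Real.exp (c ^ 2 * V / 2)
          + Real.exp (-(c * M)) * Real.exp ((-c) ^ 2 * V / 2) := by
          rw [expect_add, expect_const_mul, expect_const_mul]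
          exact add_le_add (mul_le_mul_of_nonneg_left (hmgf c r) (Real.exp_pos _).le)
            (mul_le_mul_of_nonneg_left (hmgf (-c) r) (Real.exp_pos _).le)
      _ = _ := by
          rw [neg_sq, ← Real.exp_add, ← two_mul]
          congr 2
          rw [hc]; field_simp; ring
  have hbad : prob p (fun ω => ¬ good ω)
      ≤ Fintype.card E * (2 * Real.exp (-(M : ℝ) ^ 2 / (2 * V))) + Real.exp (2 * M * S - B) := by
    calc _ ≤ prob p (fun ω => (∃ r ∈ (Finset.univ : Finset E),
            ¬ |∑ α, (z₀ ω α : ℝ) * s α r| ≤ 2 * M) ∨ ¬ ∑ α, |(z₀ ω α : ℝ)| ≤ B) := by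
          refine hP.prob_mono fun ω h => ?_
          by_contra hcon
          push Not at hcon
          exact h ⟨hcon.2, fun r => hcon.1 r (Finset.mem_univ _)⟩
      _ ≤ _ := (hP.prob_or_le _ _).trans
          (add_le_add (hP.prob_exists_le _ _ fun r _ => hbad2 r) hbad1)
  refine ⟨p, fun ω => if good ω then z₀ ω else 0, hP, fun ω => ?_, fun ω r => ?_, fun α => ?_⟩
  · by_cases h : good ω
    · simpa [h] using h.1
    · simpa [h] using hB
  · by_cases h : good ω
    · simpa [h] using h.2 r
    · simp [h]
  · have e1 : L α = expect p (fun ω => (z₀ ω α : ℝ) / M) := by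
      simp only [div_eq_mul_inv]
      rw [expect_mul_const, hp, expect_piW_apply hpα α (fun b => (roundTo (x α) b : ℝ)),
        expect_roundTo, hx]
      field_simp
    rw [e1, ← expect_sub]
    refine (hP.abs_expect_le _).trans ?_
    calc _ ≤ expect p (fun ω => 2 * if ¬ good ω then 1 else 0) := by
          refine hP.expect_mono fun ω => ?_
          by_cases h : good ω
          · simp [h]
          · have h1 : |(z₀ ω α : ℝ)| ≤ 2 * M := by
              have h2 := abs_roundTo_sub_le (x α) (ω α)
              have h3 : |x α| ≤ M := by
                rw [hx, abs_mul, abs_of_pos hM0]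
                exact mul_le_of_le_one_right hM0.le (hL α)
              have h4 : |(z₀ ω α : ℝ)| ≤ |(roundTo (x α) (ω α) : ℝ) - x α| + |x α| := by
                simpa using abs_add_le ((roundTo (x α) (ω α) : ℝ) - x α) (x α)
              linarith
            simp only [h, if_false, not_false_eq_true, if_true, Pi.zero_apply, Int.cast_zero,
              zero_div, sub_zero, mul_one]
            rw [abs_div, abs_of_pos hM0, div_le_iff₀ hM0]
            exact h1
      _ = 2 * prob p (fun ω => ¬ good ω) := by
          rw [expect_const_mul]
          unfold prob
          exact congrArg _ (congrArg _ (funext fun ω => by by_cases h : good ω <;> simp [h]))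
      _ ≤ _ := by linarith

/-- The number of integer vectors of `ℓ¹` norm at most `B`. -/
lemma card_filter_sum_abs_le {J : Type*} [Fintype J] [DecidableEq J] (B : ℕ) (hB : 1 ≤ B)
    [Nonempty J] :
    ∃ Z : Finset (J → ℤ), (∀ z : J → ℤ, ∑ α, |(z α : ℝ)| ≤ B → z ∈ Z) ∧
      (Z.card : ℝ) ≤ Real.exp (1 + B * Real.log (2 * B * Fintype.card J)) := by
  classical
  have hJ : (0 : ℝ) < Fintype.card J := by
    exact_mod_cast (Fintype.card_pos : 0 < Fintype.card J)
  have hJ1 : (1 : ℝ) ≤ Fintype.card J := by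
    exact_mod_cast (Fintype.card_pos : 0 < Fintype.card J)
  have hB0 : (0 : ℝ) < B := by exact_mod_cast hB
  have hB1 : (1 : ℝ) ≤ B := by exact_mod_cast hB
  set Λ := Real.log (2 * B * Fintype.card J) with hΛ
  have hΛ0 : 0 ≤ Λ := Real.log_nonneg (by nlinarith)
  have heΛ : Real.exp (-Λ) = 1 / (2 * B * Fintype.card J) := by
    rw [Real.exp_neg, hΛ, Real.exp_log (by positivity), one_div]
  set box := Fintype.piFinset fun _ : J => Finset.Icc (-(B : ℤ)) B with hbox
  refine ⟨box.filter fun z => ∑ α, |(z α : ℝ)| ≤ B, fun z hz => ?_, ?_⟩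
  · rw [Finset.mem_filter]
    refine ⟨Fintype.mem_piFinset.2 fun α => Finset.mem_Icc.2 ?_, hz⟩
    have h1 : |(z α : ℝ)| ≤ B :=
      (Finset.single_le_sum (f := fun α => |(z α : ℝ)|) (fun _ _ => abs_nonneg _)
        (Finset.mem_univ α)).trans hz
    obtain ⟨h2, h3⟩ := abs_le.1 h1
    exact ⟨by exact_mod_cast h2, by exact_mod_cast h3⟩
  · -- weigh each vector by `exp (-Λ ‖z‖₁)`; the total weight factorizes
    have h1 : ∑ z ∈ box, ∏ α, Real.exp (-(Λ * |(z α : ℝ)|)) ≤ Real.exp 1 := by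
      rw [hbox, ← Finset.prod_univ_sum (fun _ : J => Finset.Icc (-(B : ℤ)) B)
        (fun _ v => Real.exp (-(Λ * |(v : ℝ)|)))]
      have h2 : ∑ v ∈ Finset.Icc (-(B : ℤ)) B, Real.exp (-(Λ * |(v : ℝ)|))
          ≤ Real.exp (1 / Fintype.card J) := by
        have h0 : (0 : ℤ) ∈ Finset.Icc (-(B : ℤ)) B := by simp
        rw [← Finset.add_sum_erase _ _ h0]
        have h3 : ∀ v ∈ (Finset.Icc (-(B : ℤ)) B).erase 0,
            Real.exp (-(Λ * |(v : ℝ)|)) ≤ Real.exp (-Λ) := by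
          intro v hv
          have hv0 : v ≠ 0 := Finset.ne_of_mem_erase hv
          have hv1 : (1 : ℝ) ≤ |(v : ℝ)| := by exact_mod_cast Int.one_le_abs hv0
          exact Real.exp_le_exp.2 (by nlinarith)
        have h4 := Finset.sum_le_card_nsmul _ _ _ h3
        have h5 : (((Finset.Icc (-(B : ℤ)) B).erase 0).card : ℝ) = 2 * B := by
          rw [Finset.card_erase_of_mem h0, Int.card_Icc]
          have : ((B : ℤ) + 1 - -B).toNat - 1 = 2 * B := by omega
          rw [this]; push_cast; ring
        rw [nsmul_eq_mul, h5, heΛ] at h4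
        have h6 : 2 * (B : ℝ) * (1 / (2 * B * Fintype.card J)) = 1 / Fintype.card J := by
          field_simp
        have h7 := Real.add_one_le_exp (1 / (Fintype.card J : ℝ))
        simp only [Int.cast_zero, abs_zero, mul_zero, neg_zero, Real.exp_zero]
        linarith
      calc _ ≤ ∏ _α : J, Real.exp (1 / Fintype.card J) :=
            Finset.prod_le_prod (fun _ _ => Finset.sum_nonneg fun _ _ => (Real.exp_pos _).le)
              fun _ _ => h2
        _ = Real.exp 1 := by
            rw [Finset.prod_const, ← Real.exp_nat_mul, Finset.card_univ]
            congr 1; field_simp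
    have h8 : ∀ z ∈ box.filter (fun z => ∑ α, |(z α : ℝ)| ≤ B),
        Real.exp (-(Λ * B)) ≤ ∏ α, Real.exp (-(Λ * |(z α : ℝ)|)) := by
      intro z hz
      rw [← Real.exp_sum, Finset.sum_neg_distrib, ← Finset.mul_sum]
      exact Real.exp_le_exp.2 (neg_le_neg (mul_le_mul_of_nonneg_left
        (Finset.mem_filter.1 hz).2 hΛ0))
    have h9 := Finset.card_nsmul_le_sum _ _ _ h8
    have h10 := (h9.trans (Finset.sum_le_sum_of_subset_of_nonneg (Finset.filter_subset _ _)
      fun _ _ _ => Finset.prod_nonneg fun _ _ => (Real.exp_pos _).le)).trans h1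
    rw [nsmul_eq_mul, Real.exp_neg, ← div_eq_mul_inv, div_le_iff₀ (Real.exp_pos _),
      ← Real.exp_add] at h10
    rwa [mul_comm (B : ℝ) Λ]

/-! ### Deviation bounds for sums over the sample -/

section tails

variable {I Y : Type*} [Fintype I] [DecidableEq I] [Fintype Y] {w : I → Y → ℝ}

/-- Chernoff's bound with the exponential moment taken at one. -/
lemma prob_lt_sum_le (hw : ∀ i, IsProb (w i)) (u : I → Y → ℝ) {c : I → ℝ} (x : ℝ)
    (h : ∀ i, expect (w i) (fun y => Real.exp (u i y)) ≤ Real.exp (c i)) :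
    prob (piW w) (fun y => x < ∑ i, u i (y i)) ≤ Real.exp (∑ i, c i - x) := by
  calc _ ≤ expect (piW w) (fun y => Real.exp (-x) * Real.exp (∑ i, u i (y i))) := by
        refine (isProb_piW hw).prob_le_expect (fun y => by positivity) fun y hy => ?_
        rw [← Real.exp_add]
        exact Real.one_le_exp (by linarith)
    _ ≤ Real.exp (-x) * Real.exp (∑ i, c i) := by
        rw [expect_const_mul]
        exact mul_le_mul_of_nonneg_left (expect_piW_exp_sum_le hw u h) (Real.exp_pos _).le
    _ = _ := by rw [← Real.exp_add]; congr 1; ring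

lemma exp_quarter_le {u η : ℝ} (hu : 0 ≤ u) (hη : 0 < η) :
    Real.exp (u / 4) ≤ 1 + u / (2 * η) + η / 2 * Real.exp u := by
  have h1 : Real.exp (u / 4) - 1 ≤ u / 4 * Real.exp (u / 4) := by
    have h2 := Real.add_one_le_exp (-(u / 4))
    have h3 : Real.exp (-(u / 4)) * Real.exp (u / 4) = 1 := by
      rw [← Real.exp_add]; simp
    nlinarith [Real.exp_pos (u / 4)]
  have h4 : u / 4 * Real.exp (u / 4) ≤ u / (2 * η) + η / 2 * Real.exp u := by
    have hpos : 0 ≤ u / (2 * η) + η / 2 * Real.exp u := by positivity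
    refine le_of_sq_le_sq ?_ hpos
    have h5 : Real.exp u = Real.exp (u / 4) ^ 4 := by
      rw [← Real.exp_nat_mul]; congr 1; push_cast; ring
    set E := Real.exp (u / 4)
    have hE : 1 + u / 4 ≤ E := by linarith [Real.add_one_le_exp (u / 4)]
    have h6 : u / (2 * η) * (η / 2 * Real.exp u) = u * E ^ 4 / 4 := by
      rw [h5]; field_simp; ring
    have h7 : (u / 4 * E) ^ 2 ≤ u * E ^ 4 := by
      have h8 : u / 16 ≤ E ^ 2 := by nlinarith
      have : (u / 4 * E) ^ 2 = u * E ^ 2 * (u / 16) := by ring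
      rw [this, show u * E ^ 4 = u * E ^ 2 * E ^ 2 by ring]
      exact mul_le_mul_of_nonneg_left h8 (by positivity)
    nlinarith [sq_nonneg (u / (2 * η) - η / 2 * Real.exp u)]
  linarith

/-- Nonnegative variables with bounded exponential moments and small means have a small sum. -/
lemma prob_sum_gt_of_small_mean (hw : ∀ i, IsProb (w i)) (u : I → Y → ℝ) {η : ℝ} (hη : 0 < η)
    (hu : ∀ i y, 0 ≤ u i y) (h6 : ∀ i, expect (w i) (fun y => Real.exp (u i y)) ≤ 6)
    (hmean : ∑ i, expect (w i) (u i) ≤ Fintype.card I * η ^ 2) :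
    prob (piW w) (fun y => 32 * η * Fintype.card I < ∑ i, u i (y i))
      ≤ Real.exp (-(4 * η * Fintype.card I)) := by
  have h1 : ∀ i, expect (w i) (fun y => Real.exp (u i y / 4))
      ≤ Real.exp (expect (w i) (u i) * (1 / (2 * η)) + 3 * η) := by
    intro i
    calc _ ≤ expect (w i) (fun y => 1 + u i y * (1 / (2 * η)) + η / 2 * Real.exp (u i y)) :=
          (hw i).expect_mono fun y => by
            have := exp_quarter_le (hu i y) hη
            rwa [mul_one_div]
      _ ≤ 1 + expect (w i) (u i) * (1 / (2 * η)) + 3 * η := by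
          rw [expect_add, expect_add, (hw i).expect_const, expect_mul_const, expect_const_mul]
          have := mul_le_mul_of_nonneg_left (h6 i) (by positivity : 0 ≤ η / 2)
          linarith
      _ ≤ _ := by
          have := Real.add_one_le_exp (expect (w i) (u i) * (1 / (2 * η)) + 3 * η)
          linarith
  have h2 := prob_lt_sum_le hw (fun i y => u i y / 4) (8 * η * Fintype.card I) h1
  refine le_trans ((isProb_piW hw).prob_mono fun y hy => ?_) (h2.trans (Real.exp_le_exp.2 ?_))
  · rw [← Finset.sum_div]; linarith
  · rw [Finset.sum_add_distrib, ← Finset.sum_mul]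
    have h3 := mul_le_mul_of_nonneg_right hmean (by positivity : 0 ≤ 1 / (2 * η))
    have h4 : (Fintype.card I : ℝ) * η ^ 2 * (1 / (2 * η)) = Fintype.card I * η / 2 := by
      field_simp
    simp only [Finset.sum_const, Finset.card_univ, nsmul_eq_mul]
    have h5 : 0 ≤ (Fintype.card I : ℝ) * η := by positivity
    nlinarith

/-- Variables with bounded exponential moments have a bounded empirical mean. -/
lemma prob_sum_gt_card (hw : ∀ i, IsProb (w i)) (u : I → Y → ℝ)
    (h6 : ∀ i, expect (w i) (fun y => Real.exp (u i y)) ≤ 6) :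
    prob (piW w) (fun y => 3 * Fintype.card I < ∑ i, u i (y i))
      ≤ Real.exp (-(Fintype.card I)) := by
  have h62 : (6 : ℝ) ≤ Real.exp 2 := by
    have h := Real.exp_one_gt_d9
    have : Real.exp 2 = Real.exp 1 * Real.exp 1 := by rw [← Real.exp_add]; norm_num
    rw [this]; nlinarith
  have h1 := prob_lt_sum_le hw u (c := fun _ => 2) (3 * Fintype.card I)
    fun i => (h6 i).trans h62
  refine h1.trans (Real.exp_le_exp.2 ?_)
  simp only [Finset.sum_const, Finset.card_univ, nsmul_eq_mul]
  linarith

/-- Centered sub-exponential variables: the deviation of the sum. -/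
lemma prob_abs_sum_gt (hw : ∀ i, IsProb (w i)) (u : I → Y → ℝ) {ε : ℝ} (hε : 0 < ε) (hε1 : ε < 1)
    (h : ∀ i (t : ℝ), |t| ≤ 1 → expect (w i) (fun y => Real.exp (t * u i y)) ≤ Real.exp (t ^ 2)) :
    prob (piW w) (fun y => ε * Fintype.card I < |∑ i, u i (y i)|)
      ≤ 2 * Real.exp (-(ε ^ 2 / 4 * Fintype.card I)) := by
  have key : ∀ t : ℝ, |t| = ε / 2 → prob (piW w) (fun y =>
      ε / 2 * (ε * Fintype.card I) < ∑ i, t * u i (y i))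
      ≤ Real.exp (-(ε ^ 2 / 4 * Fintype.card I)) := by
    intro t ht
    refine (prob_lt_sum_le hw (fun i y => t * u i y) (c := fun _ => t ^ 2) _
      fun i => h i t (by linarith)).trans (Real.exp_le_exp.2 ?_)
    simp only [Finset.sum_const, Finset.card_univ, nsmul_eq_mul]
    rw [← sq_abs, ht]
    exact le_of_eq (by ring)
  have h1 := key (ε / 2) (abs_of_pos (by linarith))
  have h2 := key (-(ε / 2)) (by rw [abs_neg]; exact abs_of_pos (by linarith))
  refine le_trans ((isProb_piW hw).prob_mono fun y hy => ?_)
    (((isProb_piW hw).prob_or_le _ _).trans ((add_le_add h1 h2).trans_eq (two_mul _).symm))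
  simp only [← Finset.mul_sum]
  rcases lt_abs.1 hy with h3 | h3
  · left; exact mul_lt_mul_of_pos_left h3 (by linarith)
  · right
    rw [neg_mul, ← mul_neg]
    exact mul_lt_mul_of_pos_left h3 (by linarith)

/-- The excesses over `log (1 / ε)` of variables with bounded exponential moments. -/
lemma prob_sum_excess_gt (hw : ∀ i, IsProb (w i)) (u : I → Y → ℝ) {ε : ℝ} (hε : 0 < ε)
    (h6 : ∀ i, expect (w i) (fun y => Real.exp (u i y)) ≤ 6) :
    prob (piW w) (fun y => 7 * ε * Fintype.card I < ∑ i, max (u i (y i) - Real.log (1 / ε)) 0)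
      ≤ Real.exp (-(ε * Fintype.card I)) := by
  refine (prob_lt_sum_le hw (fun i y => max (u i y - Real.log (1 / ε)) 0) (c := fun _ => 6 * ε)
    (7 * ε * Fintype.card I) fun i => ?_).trans (Real.exp_le_exp.2 ?_)
  · calc _ ≤ expect (w i) (fun y => 1 + ε * Real.exp (u i y)) := by
          refine (hw i).expect_mono fun y => ?_
          have h1 : Real.exp (u i y - Real.log (1 / ε)) = ε * Real.exp (u i y) := by
            rw [Real.exp_sub, Real.exp_log (by positivity)]; field_simp
          rcases max_cases (u i y - Real.log (1 / ε)) 0 with ⟨h, _⟩ | ⟨h, _⟩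
          · rw [h, h1]; linarith
          · rw [h, Real.exp_zero]
            have := Real.exp_pos (u i y)
            have : 0 < ε * Real.exp (u i y) := by positivity
            linarith
      _ ≤ 1 + 6 * ε := by
          rw [expect_add, (hw i).expect_const, expect_const_mul]
          have := mul_le_mul_of_nonneg_left (h6 i) hε.le
          linarith
      _ ≤ _ := by linarith [Real.add_one_le_exp (6 * ε)]
  · simp only [Finset.sum_const, Finset.card_univ, nsmul_eq_mul]
    exact le_of_eq (by ring)

/-- Two-sided exponential moments at one. -/
lemma IsProb.expect_exp_abs_le {Y : Type*} [Fintype Y] {w : Y → ℝ} (hw : IsProb w) {f : Y → ℝ}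
    (h : ∀ t : ℝ, |t| ≤ 1 → expect w (fun y => Real.exp (t * f y)) ≤ Real.exp (t ^ 2)) :
    expect w (fun y => Real.exp |f y|) ≤ 6 := by
  have h1 := h 1 (by simp)
  have h2 := h (-1) (by simp)
  have he := Real.exp_one_lt_three
  calc _ ≤ expect w (fun y => Real.exp (1 * f y) + Real.exp (-1 * f y)) := by
        refine hw.expect_mono fun y => ?_
        rcases abs_cases (f y) with ⟨h, _⟩ | ⟨h, _⟩ <;> rw [h]
        · rw [one_mul]; linarith [Real.exp_pos (-1 * f y)]
        · rw [neg_one_mul]; linarith [Real.exp_pos (1 * f y)]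
    _ ≤ 6 := by
        rw [expect_add]
        norm_num at h1 h2 ⊢
        linarith

end tails

/-! ### A finite net for the test matrices -/

section net

variable {m : ℕ}

/-- The tensor product of the sign patterns of two Haar wavelets. -/
noncomputable def wavePair (m : ℕ) (a b : HaarIdx m) : Matrix (Fin (2 ^ m)) (Fin (2 ^ m)) ℝ :=
  fun x y => haarSign m a x * haarSign m b y

lemma abs_wavePair_le (a b : HaarIdx m) (x y : Fin (2 ^ m)) : |wavePair m a b x y| ≤ 1 := by
  rw [wavePair, abs_mul]
  exact mul_le_one₀ (abs_haarSign_le a x) (abs_nonneg _) (abs_haarSign_le b y)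

lemma matInner_sum {n : ℕ} {J : Type*} (s : Finset J) (c : J → ℝ) (A : Matrix (Fin n) (Fin n) ℝ)
    (Δ : J → Matrix (Fin n) (Fin n) ℝ) :
    matInner A (fun x y => ∑ j ∈ s, c j * Δ j x y) = ∑ j ∈ s, c j * matInner A (Δ j) := by
  simp only [matInner, Finset.mul_sum]
  rw [Finset.sum_comm (s := s)]
  refine Finset.sum_congr rfl fun x _ => ?_
  rw [Finset.sum_comm (s := s)]
  exact Finset.sum_congr rfl fun y _ => Finset.sum_congr rfl fun j _ => by ring

lemma matInner_eq_sum_wavePair (A S : Matrix (Fin (2 ^ m)) (Fin (2 ^ m)) ℝ) :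
    matInner A S = ∑ a, ∑ b, weightedHaar m S a b * matInner A (wavePair m a b) := by
  have h : S = fun x y => ∑ α : HaarIdx m × HaarIdx m,
      weightedHaar m S α.1 α.2 * wavePair m α.1 α.2 x y := by
    funext x y
    rw [Fintype.sum_prod_type]
    exact (sum_weightedHaar_mul S x y).symm
  conv_lhs => rw [h]
  rw [matInner_sum, Fintype.sum_prod_type]

/-- The matrix whose weighted Haar coefficients are `z / (2 M)` on the pairs from `T` and vanish
elsewhere. -/
noncomputable def gridMat (T : Finset (HaarIdx m)) (M : ℕ) (z : T × T → ℤ) :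
    Matrix (Fin (2 ^ m)) (Fin (2 ^ m)) ℝ :=
  fun x y => ∑ α, ((z α : ℝ) / (2 * M)) * wavePair m α.1 α.2 x y

lemma matInner_gridMat (T : Finset (HaarIdx m)) (M : ℕ) (z : T × T → ℤ)
    (A : Matrix (Fin (2 ^ m)) (Fin (2 ^ m)) ℝ) :
    matInner A (gridMat T M z) = ∑ α, ((z α : ℝ) / (2 * M)) * matInner A (wavePair m α.1 α.2) :=
  matInner_sum _ _ _ _

/-- The error per coefficient of rounding the heavy part of a test matrix to the grid. -/
noncomputable def roundErr (m κ s : ℕ) (T : Finset (HaarIdx m)) : ℝ :=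
  2 * ((2 * (T.card : ℝ)) ^ 2 * (2 * Real.exp (-(κ : ℝ) ^ 2 / 2))
    + Real.exp (-(2 * ((m + 1) * κ) * s)))

/-- A test matrix is twice a mixture of grid matrices with entries bounded by one, up to its
coefficients at pairs that are not both heavy and the rounding errors at the heavy pairs. -/
theorem exists_mixture {ℓ κ : ℕ} {q : Fin (2 ^ m) → ℝ} (hq : ∀ x, 0 ≤ q x) {θ : ℝ}
    (hθ : θ ≤ ∑ x, q x) (hm : 1 ≤ m) (hκ : 1 ≤ κ) {S : Matrix (Fin (2 ^ m)) (Fin (2 ^ m)) ℝ}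
    (hS : IsTest m ℓ S) :
    ∃ (J : Type) (_ : Fintype J) (p : J → ℝ)
      (z : J → heavy m q θ × heavy m q θ → ℤ), IsProb p ∧
      (∀ ω, ∑ α, |(z ω α : ℝ)| ≤ 4 * ((m + 1) * κ) * ((ℓ : ℝ) * m + 1) ^ 2) ∧
      (∀ ω x y, |gridMat (heavy m q θ) ((m + 1) * κ) (z ω) x y| ≤ 1) ∧
      ∀ A, |matInner A S
          - 2 * expect p (fun ω => matInner A (gridMat (heavy m q θ) ((m + 1) * κ) (z ω)))|
        ≤ ∑ a, ∑ b, (if a ∈ heavy m q θ ∧ b ∈ heavy m q θ then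
            roundErr m κ ((ℓ * m + 1) ^ 2) (heavy m q θ) else |weightedHaar m S a b|)
          * |matInner A (wavePair m a b)| := by
  classical
  set T := heavy m q θ with hT
  obtain ⟨R, hR, hRT⟩ := exists_representatives hq hθ hm
  set s : ℝ := ((ℓ : ℝ) * m + 1) ^ 2 with hs
  set M : ℕ := (m + 1) * κ with hM
  have hM1 : 1 ≤ M := Nat.one_le_iff_ne_zero.2 (by positivity)
  have hM0 : (0 : ℝ) < M := by exact_mod_cast hM1
  have hMr : (M : ℝ) = (m + 1) * κ := by rw [hM]; push_cast; ring
  set L := weightedHaar m S with hL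
  -- sums over pairs from `T`
  have hsumT : ∀ f : HaarIdx m → HaarIdx m → ℝ,
      ∑ α : T × T, f α.1 α.2 = ∑ a ∈ T, ∑ b ∈ T, f a b := by
    intro f
    rw [Fintype.sum_prod_type, ← Finset.sum_coe_sort T]
    refine Finset.sum_congr rfl fun a _ => ?_
    rw [← Finset.sum_coe_sort T]
  obtain ⟨p, z, hp, hz1, hz2, hz3⟩ := exists_rounding (J := T × T) (E := R × R)
    (fun α => L α.1 α.2) (fun α r => wavePair m α.1 α.2 r.1 r.2) (S := s)
    (B := 4 * M * s) (V := ((m : ℝ) + 1) ^ 2) (M := M) hM1 (by positivity) (by positivity)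
    (fun α => hS.haar_max_le _ _)
    (by
      rw [hsumT fun a b => |L a b|]
      refine le_trans ?_ hS.haar_sum_le
      refine (Finset.sum_le_sum fun a _ => Finset.sum_le_sum_of_subset_of_nonneg
        (Finset.subset_univ T) fun _ _ _ => abs_nonneg _).trans ?_
      exact Finset.sum_le_sum_of_subset_of_nonneg (Finset.subset_univ T) fun _ _ _ =>
        Finset.sum_nonneg fun _ _ => abs_nonneg _)
    (fun α r => abs_wavePair_le _ _ _ _)
    (by
      intro r
      rw [hsumT fun a b => |wavePair m a b r.1 r.2|]
      simp only [wavePair, abs_mul, ← Finset.mul_sum, ← Finset.sum_mul]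
      rw [sq]
      have h : ∀ x, ∑ a ∈ T, |haarSign m a x| ≤ m + 1 := fun x =>
        (Finset.sum_le_sum_of_subset_of_nonneg (Finset.subset_univ T)
          fun _ _ _ => abs_nonneg _).trans (sum_abs_haarSign x).le
      exact mul_le_mul (h _) (h _) (Finset.sum_nonneg fun _ _ => abs_nonneg _) (by positivity))
    (by
      intro r
      rw [hsumT fun a b => L a b * wavePair m a b r.1 r.2]
      exact abs_sum_heavy_le hq hθ hS.max_le _ _)
  refine ⟨_, inferInstance, p, z, hp, fun ω => ?_, fun ω x y => ?_, fun A => ?_⟩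
  · rw [← hMr]; exact hz1 ω
  · obtain ⟨x', hx', hxx⟩ := hRT x
    obtain ⟨y', hy', hyy⟩ := hRT y
    have h : gridMat T M (z ω) x y
        = (∑ α, (z ω α : ℝ) * wavePair m α.1 α.2 x' y') / (2 * M) := by
      rw [gridMat, Finset.sum_div]
      refine Finset.sum_congr rfl fun α _ => ?_
      rw [wavePair, wavePair, hxx _ α.1.2, hyy _ α.2.2]
      ring
    rw [h, abs_div, abs_of_pos (by positivity : (0 : ℝ) < 2 * M), div_le_one (by positivity)]
    exact hz2 ω (⟨x', hx'⟩, ⟨y', hy'⟩)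
  · -- compare the coefficients
    set P : HaarIdx m → HaarIdx m → Prop := fun a b => a ∈ T ∧ b ∈ T
    set e : T × T → ℝ := fun α => expect p (fun ω => (z ω α : ℝ) / M) with he
    set Y : HaarIdx m → HaarIdx m → ℝ := fun a b => matInner A (wavePair m a b) with hY
    have hexp : 2 * expect p (fun ω => matInner A (gridMat T M (z ω)))
        = ∑ α, e α * Y α.1 α.2 := by
      simp only [matInner_gridMat]
      rw [expect_sum, Finset.mul_sum]
      refine Finset.sum_congr rfl fun α _ => ?_
      rw [expect_mul_const, he, ← mul_assoc, ← expect_const_mul]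
      congr 2
      funext ω
      field_simp
    have hE : ∑ α, e α * Y α.1 α.2 = ∑ a, ∑ b,
        (if h : a ∈ T ∧ b ∈ T then e (⟨a, h.1⟩, ⟨b, h.2⟩) else 0) * Y a b := by
      have h1 := hsumT fun a b =>
        (if h : a ∈ T ∧ b ∈ T then e (⟨a, h.1⟩, ⟨b, h.2⟩) else 0) * Y a b
      have h2 : ∑ α, e α * Y α.1 α.2 = ∑ α : T × T,
          (if h : (α.1 : HaarIdx m) ∈ T ∧ (α.2 : HaarIdx m) ∈ T then
            e (⟨α.1, h.1⟩, ⟨α.2, h.2⟩) else 0) * Y α.1 α.2 := by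
        refine Finset.sum_congr rfl fun α _ => ?_
        rw [dif_pos ⟨α.1.2, α.2.2⟩]
      rw [h2, h1]
      rw [← Finset.sum_subset (Finset.subset_univ T)]
      · refine Finset.sum_congr rfl fun a _ => Finset.sum_subset (Finset.subset_univ T) ?_
        intro b _ hb
        rw [dif_neg (fun h => hb h.2), zero_mul]
      · intro a _ ha
        refine Finset.sum_eq_zero fun b _ => ?_
        rw [dif_neg (fun h => ha h.1), zero_mul]
    rw [hexp, hE, matInner_eq_sum_wavePair, ← Finset.sum_sub_distrib]
    refine (Finset.abs_sum_le_sum_abs _ _).trans (Finset.sum_le_sum fun a _ => ?_)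
    rw [← Finset.sum_sub_distrib]
    refine (Finset.abs_sum_le_sum_abs _ _).trans (Finset.sum_le_sum fun b _ => ?_)
    rw [← sub_mul, abs_mul]
    refine mul_le_mul_of_nonneg_right ?_ (abs_nonneg _)
    by_cases h : a ∈ T ∧ b ∈ T
    · simp only [dif_pos h, if_pos h]
      refine (hz3 (⟨a, h.1⟩, ⟨b, h.2⟩)).trans ?_
      unfold roundErr
      have hcard : ((Fintype.card (R × R) : ℕ) : ℝ) ≤ (2 * (T.card : ℝ)) ^ 2 := by
        rw [Fintype.card_prod, Fintype.card_coe]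
        have : (R.card : ℝ) ≤ 2 * T.card := by exact_mod_cast hR
        push_cast
        nlinarith [(Nat.cast_nonneg R.card : (0 : ℝ) ≤ R.card)]
      have e1 : -(M : ℝ) ^ 2 / (2 * ((m : ℝ) + 1) ^ 2) = -(κ : ℝ) ^ 2 / 2 := by
        rw [hMr]; field_simp
      have e2 : 2 * (M : ℝ) * s - 4 * M * s = -(2 * ((m + 1) * κ) * ((((ℓ * m + 1) ^ 2 : ℕ)) : ℝ)) := by
        rw [hMr, hs]; push_cast; ring
      rw [e1, e2]
      gcongr
    · simp only [dif_neg h, if_neg h, sub_zero]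
      exact le_rfl

end net

/-! ### Uniform laws over the test matrices -/

section uniform

variable {m : ℕ} {I : Type*} [Fintype I]

/-- Bounds at the grid matrices and at the pairs of wavelets imply bounds at all test matrices. The
excess over `2 λ` of twice a mixture is at most the mixture of twice the excesses over `λ`. -/
lemma uniform_of_grid {ℓ κ : ℕ} {T : Finset (HaarIdx m)} {ε lam ρ : ℝ} (hε : 0 < ε) (hρ0 : 0 ≤ ρ)
    (hρ : 3 * (T.card : ℝ) ^ 2 * ρ ≤ ε) (A : I → Matrix (Fin (2 ^ m)) (Fin (2 ^ m)) ℝ)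
    (hlight : ∀ a b, ¬ (a ∈ T ∧ b ∈ T) → ∑ i, |matInner (A i) (wavePair m a b)|
      ≤ ε * Fintype.card I / ((ℓ : ℝ) * m + 1) ^ 2)
    (hall : ∀ a b, ∑ i, |matInner (A i) (wavePair m a b)| ≤ 3 * Fintype.card I)
    (hnet : ∀ z : T × T → ℤ,
      ∑ α, |(z α : ℝ)| ≤ 4 * ((m + 1) * κ) * ((ℓ : ℝ) * m + 1) ^ 2 →
      (∀ x y, |gridMat T ((m + 1) * κ) z x y| ≤ 1) →
      |∑ i, matInner (A i) (gridMat T ((m + 1) * κ) z)| ≤ ε * Fintype.card I ∧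
      ∑ i, max (|matInner (A i) (gridMat T ((m + 1) * κ) z)| - lam) 0
        ≤ 7 * ε * Fintype.card I)
    {S : Matrix (Fin (2 ^ m)) (Fin (2 ^ m)) ℝ} (hS : IsTest m ℓ S)
    {J : Type} [Fintype J] {p : J → ℝ} {z : J → T × T → ℤ} (hp : IsProb p)
    (hz1 : ∀ ω, ∑ α, |(z ω α : ℝ)| ≤ 4 * ((m + 1) * κ) * ((ℓ : ℝ) * m + 1) ^ 2)
    (hz2 : ∀ ω x y, |gridMat T ((m + 1) * κ) (z ω) x y| ≤ 1)
    (hz3 : ∀ A, |matInner A S - 2 * expect p (fun ω => matInner A (gridMat T ((m + 1) * κ) (z ω)))|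
        ≤ ∑ a, ∑ b, (if a ∈ T ∧ b ∈ T then ρ else |weightedHaar m S a b|)
          * |matInner A (wavePair m a b)|) :
    |∑ i, matInner (A i) S| ≤ 4 * ε * Fintype.card I ∧
      ∑ i, max (|matInner (A i) S| - 2 * lam) 0 ≤ 16 * ε * Fintype.card I := by
  classical
  set N : ℝ := ((Fintype.card I : ℕ) : ℝ) with hN
  have hN0 : 0 ≤ N := Nat.cast_nonneg _
  set s : ℝ := ((ℓ : ℝ) * m + 1) ^ 2 with hs
  have hs0 : 0 < s := by positivity
  set c : HaarIdx m → HaarIdx m → ℝ := fun a b =>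
    if a ∈ T ∧ b ∈ T then ρ else |weightedHaar m S a b| with hc
  have hc0 : ∀ a b, 0 ≤ c a b := fun a b => by
    simp only [hc]; split_ifs
    · exact hρ0
    · exact abs_nonneg _
  set g : J → I → ℝ := fun ω i => matInner (A i) (gridMat T ((m + 1) * κ) (z ω)) with hg
  set r : I → ℝ := fun i => ∑ a, ∑ b, c a b * |matInner (A i) (wavePair m a b)| with hr
  have hr0 : ∀ i, 0 ≤ r i := fun i => Finset.sum_nonneg fun a _ => Finset.sum_nonneg fun b _ =>
    mul_nonneg (hc0 a b) (abs_nonneg _)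
  have hdiff : ∀ i, |matInner (A i) S - 2 * expect p (fun ω => g ω i)| ≤ r i := fun i => hz3 (A i)
  -- the total error
  have hrsum : ∑ i, r i ≤ 2 * ε * N := by
    have h1 : ∑ i, r i = ∑ a, ∑ b, c a b * ∑ i, |matInner (A i) (wavePair m a b)| := by
      simp only [hr, Finset.mul_sum]
      rw [Finset.sum_comm]
      refine Finset.sum_congr rfl fun a _ => ?_
      rw [Finset.sum_comm]
    have h2 : ∀ a b, c a b * ∑ i, |matInner (A i) (wavePair m a b)|
        ≤ (if a ∈ T then (if b ∈ T then ρ * (3 * N) else 0) else 0)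
          + |weightedHaar m S a b| * (ε * N / s) := by
      intro a b
      have hpos : 0 ≤ |weightedHaar m S a b| * (ε * N / s) := by positivity
      by_cases h : a ∈ T ∧ b ∈ T
      · simp only [hc, if_pos h, if_pos h.1, if_pos h.2]
        have := mul_le_mul_of_nonneg_left (hall a b) hρ0
        linarith
      · have h0 : (if a ∈ T then (if b ∈ T then ρ * (3 * N) else 0) else 0) = 0 := by
          by_cases ha : a ∈ T
          · rw [if_pos ha, if_neg fun hb => h ⟨ha, hb⟩]
          · rw [if_neg ha]
        rw [h0, zero_add]
        simp only [hc, if_neg h]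
        exact mul_le_mul_of_nonneg_left (hlight a b h) (abs_nonneg _)
    rw [h1]
    calc _ ≤ ∑ a, ∑ b, ((if a ∈ T then (if b ∈ T then ρ * (3 * N) else 0) else 0)
          + |weightedHaar m S a b| * (ε * N / s)) :=
          Finset.sum_le_sum fun a _ => Finset.sum_le_sum fun b _ => h2 a b
      _ = (T.card : ℝ) ^ 2 * (ρ * (3 * N))
          + (∑ a, ∑ b, |weightedHaar m S a b|) * (ε * N / s) := by
          simp only [Finset.sum_add_distrib, ← Finset.sum_mul]
          congr 1
          have : ∀ a, (∑ b, if a ∈ T then (if b ∈ T then ρ * (3 * N) else 0) else 0)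
              = if a ∈ T then (T.card : ℝ) * (ρ * (3 * N)) else 0 := by
            intro a
            split_ifs <;> simp
          simp only [this]
          simp
          ring
      _ ≤ ε * N + s * (ε * N / s) := by
          have h3 := mul_le_mul_of_nonneg_right hρ hN0
          have h4 := mul_le_mul_of_nonneg_right hS.haar_sum_le
            (show 0 ≤ ε * N / s by positivity)
          refine add_le_add ?_ h4
          linarith
      _ = 2 * ε * N := by field_simp; ring
  constructor
  · have h1 : |∑ i, 2 * expect p (fun ω => g ω i)| ≤ 2 * (ε * N) := by
      rw [← Finset.mul_sum, ← expect_sum (w := p) Finset.univ (fun i ω => g ω i), abs_mul, abs_two]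
      refine mul_le_mul_of_nonneg_left ?_ (by norm_num)
      exact (hp.abs_expect_le _).trans (hp.expect_le fun ω => (hnet (z ω) (hz1 ω) (hz2 ω)).1)
    have h2 : |∑ i, (matInner (A i) S - 2 * expect p (fun ω => g ω i))| ≤ 2 * ε * N :=
      (Finset.abs_sum_le_sum_abs _ _).trans ((Finset.sum_le_sum fun i _ => hdiff i).trans hrsum)
    rw [Finset.sum_sub_distrib] at h2
    have h1' := abs_le.1 h1
    have h2' := abs_le.1 h2
    exact abs_le.2 ⟨by linarith [h1'.1, h2'.1], by linarith [h1'.2, h2'.2]⟩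
  · have h1 : ∀ i, max (|matInner (A i) S| - 2 * lam) 0
        ≤ 2 * expect p (fun ω => max (|g ω i| - lam) 0) + r i := by
      intro i
      have ha : |expect p (fun ω => g ω i)| ≤ lam + expect p (fun ω => max (|g ω i| - lam) 0) := by
        refine (hp.abs_expect_le _).trans ?_
        rw [← hp.expect_const lam, ← expect_add]
        refine hp.expect_mono fun ω => ?_
        rw [hp.expect_const lam]
        linarith [le_max_left (|g ω i| - lam) 0]
      have hb : 0 ≤ expect p (fun ω => max (|g ω i| - lam) 0) :=
        hp.expect_nonneg fun ω => le_max_right _ _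
      have hd := hdiff i
      have habs : |matInner (A i) S| ≤ 2 * |expect p (fun ω => g ω i)| + r i := by
        have := abs_sub_abs_le_abs_sub (matInner (A i) S) (2 * expect p (fun ω => g ω i))
        rw [abs_mul, abs_two] at this
        linarith
      exact max_le (by linarith) (by linarith [hr0 i])
    calc _ ≤ ∑ i, (2 * expect p (fun ω => max (|g ω i| - lam) 0) + r i) :=
          Finset.sum_le_sum fun i _ => h1 i
      _ = 2 * expect p (fun ω => ∑ i, max (|g ω i| - lam) 0) + ∑ i, r i := by
          rw [Finset.sum_add_distrib, ← Finset.mul_sum,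
            expect_sum (w := p) Finset.univ (fun i ω => max (|g ω i| - lam) 0)]
      _ ≤ 2 * (7 * ε * N) + 2 * ε * N := by
          refine add_le_add (mul_le_mul_of_nonneg_left ?_ (by norm_num)) hrsum
          exact hp.expect_le fun ω => (hnet (z ω) (hz1 ω) (hz2 ω)).2
      _ = _ := by ring

end uniform

/-! ### Choice of parameters -/

section uniformLaw

variable {m ℓ : ℕ} {ε : ℝ}

/-- The ratio of the bound on the Haar coefficients of the test matrices to the accuracy. -/
noncomputable def netRatio (m ℓ : ℕ) (ε : ℝ) : ℝ := ((ℓ : ℝ) * m + 1) ^ 2 / ε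

/-- The inverse grid width, up to a factor `m + 1`. -/
noncomputable def gridFineness (m ℓ : ℕ) (ε : ℝ) : ℕ := ⌈28 * Real.log (netRatio m ℓ ε)⌉₊

/-- The square root of the square root of the mass above which the support of a wavelet is heavy. -/
noncomputable def lightRoot (m ℓ : ℕ) (ε : ℝ) : ℝ := ε / (32 * ((ℓ : ℝ) * m + 1) ^ 2)

lemma four_le_haarBound (hm : 1 ≤ m) (hℓ : 1 ≤ ℓ) : (4 : ℝ) ≤ ((ℓ : ℝ) * m + 1) ^ 2 := by
  have h1 : (1 : ℝ) ≤ m := by exact_mod_cast hm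
  have h2 : (1 : ℝ) ≤ ℓ := by exact_mod_cast hℓ
  nlinarith [mul_le_mul h2 h1 zero_le_one (by linarith)]

lemma succ_le_haarBound (hℓ : 1 ≤ ℓ) : (m : ℝ) + 1 ≤ ((ℓ : ℝ) * m + 1) ^ 2 := by
  have h1 : (0 : ℝ) ≤ m := Nat.cast_nonneg _
  have h2 : (1 : ℝ) ≤ ℓ := by exact_mod_cast hℓ
  nlinarith [mul_le_mul_of_nonneg_right h2 h1]

lemma haarBound_le_netRatio (hε : 0 < ε) (hε2 : ε < 1 / 2) :
    ((ℓ : ℝ) * m + 1) ^ 2 ≤ netRatio m ℓ ε := by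
  rw [netRatio, le_div_iff₀ hε]
  nlinarith [sq_nonneg ((ℓ : ℝ) * m + 1)]

lemma eight_le_netRatio (hm : 1 ≤ m) (hℓ : 1 ≤ ℓ) (hε : 0 < ε) (hε2 : ε < 1 / 2) :
    8 ≤ netRatio m ℓ ε := by
  rw [netRatio, le_div_iff₀ hε]
  linarith [four_le_haarBound hm hℓ]

lemma two_le_log {g : ℝ} (hg : 8 ≤ g) : 2 ≤ Real.log g := by
  have h1 : Real.log 8 ≤ Real.log g := Real.log_le_log (by norm_num) hg
  have h2 : Real.log 8 = 3 * Real.log 2 := by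
    rw [show (8 : ℝ) = 2 ^ 3 by norm_num, Real.log_pow]; norm_num
  linarith [Real.log_two_gt_d9]

lemma card_heavy_le {q : Fin (2 ^ m) → ℝ} (hq : ∀ x, 0 ≤ q x) (hq5 : ∑ x, q x ≤ 5)
    (hm : 1 ≤ m) (hℓ : 1 ≤ ℓ) (hε : 0 < ε) (hε2 : ε < 1 / 2) :
    ((heavy m q (lightRoot m ℓ ε ^ 4)).card : ℝ) ≤ netRatio m ℓ ε ^ 13 := by
  have h := card_heavy_mul_le hq (lightRoot m ℓ ε ^ 4)
  have hs := four_le_haarBound hm hℓ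
  have hg8 := eight_le_netRatio hm hℓ hε hε2
  have hg : (m : ℝ) + 1 ≤ netRatio m ℓ ε :=
    (succ_le_haarBound hℓ).trans (haarBound_le_netRatio hε hε2)
  set g := netRatio m ℓ ε with hgdef
  have hr : lightRoot m ℓ ε = 1 / (32 * g) := by
    rw [lightRoot, hgdef, netRatio]; field_simp
  have hg0 : 0 < g := by linarith
  rw [hr] at h ⊢
  set c := ((heavy m q ((1 / (32 * g)) ^ 4)).card : ℝ)
  have h2 : c * (1 / (32 * g)) ^ 4 ≤ g * 5 := by
    refine h.trans (mul_le_mul hg hq5 (Finset.sum_nonneg fun x _ => hq x) hg0.le)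
  rw [div_pow, one_pow, mul_one_div, div_le_iff₀ (by positivity)] at h2
  refine h2.trans ?_
  have h3 : (8 : ℝ) ^ 8 ≤ g ^ 8 := by gcongr
  have h5 : 0 ≤ g ^ 5 := by positivity
  nlinarith [mul_le_mul_of_nonneg_right h3 h5]

lemma gridFineness_bounds (hm : 1 ≤ m) (hℓ : 1 ≤ ℓ) (hε : 0 < ε) (hε2 : ε < 1 / 2) :
    28 * Real.log (netRatio m ℓ ε) ≤ gridFineness m ℓ ε ∧
      (gridFineness m ℓ ε : ℝ) ≤ 29 * Real.log (netRatio m ℓ ε) := by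
  have h := two_le_log (eight_le_netRatio hm hℓ hε hε2)
  refine ⟨Nat.le_ceil _, ?_⟩
  have := Nat.ceil_lt_add_one (show 0 ≤ 28 * Real.log (netRatio m ℓ ε) by linarith)
  unfold gridFineness
  linarith

lemma card_sq_mul_roundErr_le {q : Fin (2 ^ m) → ℝ} (hq : ∀ x, 0 ≤ q x) (hq5 : ∑ x, q x ≤ 5)
    (hm : 1 ≤ m) (hℓ : 1 ≤ ℓ) (hε : 0 < ε) (hε2 : ε < 1 / 2) :
    3 * ((heavy m q (lightRoot m ℓ ε ^ 4)).card : ℝ) ^ 2 *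
      roundErr m (gridFineness m ℓ ε) ((ℓ * m + 1) ^ 2) (heavy m q (lightRoot m ℓ ε ^ 4)) ≤ ε := by
  have hT := card_heavy_le hq hq5 hm hℓ hε hε2
  obtain ⟨hκ, -⟩ := gridFineness_bounds hm hℓ hε hε2
  have hs := four_le_haarBound hm hℓ
  have hg8 := eight_le_netRatio hm hℓ hε hε2
  have hgε : netRatio m ℓ ε * ε = ((ℓ : ℝ) * m + 1) ^ 2 := by rw [netRatio]; field_simp
  have hlog := two_le_log hg8
  unfold roundErr
  push_cast
  set g := netRatio m ℓ ε
  set T := ((heavy m q (lightRoot m ℓ ε ^ 4)).card : ℝ)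
  set κ := (gridFineness m ℓ ε : ℝ)
  set s := ((ℓ : ℝ) * m + 1) ^ 2
  have hT0 : 0 ≤ T := Nat.cast_nonneg _
  have hm0 : (0 : ℝ) ≤ m := Nat.cast_nonneg _
  have hg0 : 0 < g := by linarith
  have hκ4 : 4 ≤ κ := by linarith
  have hexp : Real.exp (-(2 * κ)) ≤ 1 / g ^ 56 := by
    have : g ^ 56 = Real.exp (56 * Real.log g) := by
      rw [mul_comm, Real.exp_mul, Real.exp_log hg0]; norm_cast
    rw [this, one_div, ← Real.exp_neg]
    exact Real.exp_le_exp.2 (by linarith)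
  have e1 : Real.exp (-κ ^ 2 / 2) ≤ 1 / g ^ 56 := by
    refine (Real.exp_le_exp.2 ?_).trans hexp
    nlinarith
  have e2 : Real.exp (-(2 * ((m + 1) * κ) * s)) ≤ 1 / g ^ 56 := by
    refine (Real.exp_le_exp.2 ?_).trans hexp
    have h1 : κ * 1 ≤ κ * ((m + 1) * s) := by
      refine mul_le_mul_of_nonneg_left ?_ (by linarith)
      nlinarith
    linarith
  have h13 : 1 ≤ g ^ 13 := one_le_pow₀ (by linarith)
  calc 3 * T ^ 2 * (2 * ((2 * T) ^ 2 * (2 * Real.exp (-κ ^ 2 / 2))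
        + Real.exp (-(2 * ((m + 1) * κ) * s))))
      ≤ 3 * (g ^ 13) ^ 2 * (2 * ((2 * g ^ 13) ^ 2 * (2 * (1 / g ^ 56))
        + (g ^ 13) ^ 2 * (1 / g ^ 56))) := by
        gcongr
        refine e2.trans ?_
        have : 0 ≤ 1 / g ^ 56 := by positivity
        have h26 : 1 ≤ (g ^ 13) ^ 2 := one_le_pow₀ h13
        nlinarith
    _ = 54 / g ^ 4 := by field_simp; ring
    _ ≤ ε := by
        rw [div_le_iff₀ (by positivity)]
        have h3 : g ^ 3 ≥ 8 ^ 3 := by gcongr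
        have : ε * g ^ 4 = s * g ^ 3 := by rw [← hgε]; ring
        nlinarith

lemma log_card_grid_le {q : Fin (2 ^ m) → ℝ} (hq : ∀ x, 0 ≤ q x) (hq5 : ∑ x, q x ≤ 5)
    (hT1 : 1 ≤ (heavy m q (lightRoot m ℓ ε ^ 4)).card)
    (hm : 1 ≤ m) (hℓ : 1 ≤ ℓ) (hε : 0 < ε) (hε2 : ε < 1 / 2) {B : ℝ}
    (hB : B = 4 * ((m + 1) * gridFineness m ℓ ε) * ((ℓ : ℝ) * m + 1) ^ 2) :
    1 + B * Real.log (2 * B * ((heavy m q (lightRoot m ℓ ε ^ 4)).card : ℝ) ^ 2)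
      ≤ 3829 * ((m + 1) * ((ℓ : ℝ) * m + 1) ^ 2 * Real.log (netRatio m ℓ ε) ^ 2) := by
  have hT := card_heavy_le hq hq5 hm hℓ hε hε2
  obtain ⟨hκ1, hκ⟩ := gridFineness_bounds hm hℓ hε hε2
  have hs := four_le_haarBound hm hℓ
  have hg8 := eight_le_netRatio hm hℓ hε hε2
  have hsg := haarBound_le_netRatio (m := m) (ℓ := ℓ) hε hε2
  have hmg := (succ_le_haarBound (m := m) hℓ).trans hsg
  have hlog := two_le_log hg8
  have hT1' : (1 : ℝ) ≤ (heavy m q (lightRoot m ℓ ε ^ 4)).card := by exact_mod_cast hT1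
  set g := netRatio m ℓ ε
  set T := ((heavy m q (lightRoot m ℓ ε ^ 4)).card : ℝ)
  set κ := (gridFineness m ℓ ε : ℝ)
  set s := ((ℓ : ℝ) * m + 1) ^ 2
  have hm0 : (0 : ℝ) ≤ m := Nat.cast_nonneg _
  have hg0 : 0 < g := by linarith
  have hlogg : Real.log g ≤ g := (Real.log_le_sub_one_of_pos hg0).trans (by linarith)
  have hκg : κ ≤ 29 * g := by linarith
  have hκ0 : 0 < κ := by linarith
  have hB0 : 0 < B := by rw [hB]; positivity
  have hBg : B ≤ g ^ 6 := by
    have h3 : (8 : ℝ) ^ 3 ≤ g ^ 3 := by gcongr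
    calc B ≤ 4 * (g * (29 * g)) * g := by rw [hB]; gcongr
      _ = 116 * g ^ 3 := by ring
      _ ≤ g ^ 3 * g ^ 3 := by gcongr; linarith
      _ = g ^ 6 := by ring
  have hlogB : Real.log (2 * B * T ^ 2) ≤ 33 * Real.log g := by
    have : 33 * Real.log g = Real.log (g ^ 33) := by rw [Real.log_pow]; norm_num
    rw [this]
    refine Real.log_le_log (by positivity) ?_
    calc 2 * B * T ^ 2 ≤ g * g ^ 6 * (g ^ 13) ^ 2 := by gcongr; linarith
      _ = g ^ 33 := by ring
  have h1 : B * Real.log (2 * B * T ^ 2)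
      ≤ (4 * ((m + 1) * (29 * Real.log g)) * s) * (33 * Real.log g) := by
    refine (mul_le_mul_of_nonneg_left hlogB hB0.le).trans
      (mul_le_mul_of_nonneg_right ?_ (by linarith))
    rw [hB]; gcongr
  have h2 : 1 ≤ (m + 1) * s * Real.log g ^ 2 := by
    have : 1 ≤ (m + 1) * s := by nlinarith
    exact one_le_mul_of_one_le_of_one_le this (one_le_pow₀ (by linarith))
  calc _ ≤ (m + 1) * s * Real.log g ^ 2
        + (4 * ((m + 1) * (29 * Real.log g)) * s) * (33 * Real.log g) := add_le_add h2 h1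
    _ = _ := by ring

/-- The failure probabilities add up to a quarter of `δ`. -/
lemma failure_sum_le (hm : 1 ≤ m) (hℓ : 1 ≤ ℓ) (hε : 0 < ε) (hε2 : ε < 1 / 2) {δ N : ℝ}
    (hδ : 0 < δ) (hδ1 : δ < 1)
    (hN : 30000 * ((m + 1) * ((ℓ : ℝ) * m + 1) ^ 2 * Real.log (netRatio m ℓ ε) ^ 2)
      * Real.log (2 / δ) ≤ ε ^ 2 * N) :
    (2 ^ m : ℝ) ^ 2 * Real.exp (-(4 * lightRoot m ℓ ε * N)) + (2 ^ m : ℝ) ^ 2 * Real.exp (-N)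
      + Real.exp (3829 * ((m + 1) * ((ℓ : ℝ) * m + 1) ^ 2 * Real.log (netRatio m ℓ ε) ^ 2))
        * (2 * Real.exp (-(ε ^ 2 / 4 * N)))
      + Real.exp (3829 * ((m + 1) * ((ℓ : ℝ) * m + 1) ^ 2 * Real.log (netRatio m ℓ ε) ^ 2))
        * Real.exp (-(ε * N)) ≤ δ / 4 := by
  have hs := four_le_haarBound hm hℓ
  have hg8 := eight_le_netRatio hm hℓ hε hε2
  have hlog := two_le_log hg8
  have hm1 : (1 : ℝ) ≤ m := by exact_mod_cast hm
  have hl2 := Real.log_two_gt_d9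
  have hl2' := Real.log_two_lt_d9
  have hroot : lightRoot m ℓ ε = ε / (32 * ((ℓ : ℝ) * m + 1) ^ 2) := rfl
  set r := lightRoot m ℓ ε
  set s := ((ℓ : ℝ) * m + 1) ^ 2
  set lg := Real.log (netRatio m ℓ ε)
  set lam := Real.log (2 / δ) with hlam
  have hlam1 : Real.log 2 ≤ lam := by
    refine Real.log_le_log (by norm_num) ?_
    rw [le_div_iff₀ hδ]; linarith
  have hlam0 : 0 < lam := by linarith
  have hexpδ : ∀ c : ℝ, 0 < c → Real.exp (-(lam + Real.log c)) = δ / (2 * c) := by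
    intro c hc
    rw [hlam, ← Real.log_mul (by positivity) hc.ne', Real.exp_neg, Real.exp_log (by positivity)]
    field_simp
  have hl12 : Real.log 12 ≤ 4 * Real.log 2 := by
    rw [← Real.log_rpow (by norm_num)]
    exact Real.log_le_log (by norm_num) (by norm_num)
  have hl8 : Real.log 8 = 3 * Real.log 2 := by
    rw [show (8 : ℝ) = 2 ^ 3 by norm_num, Real.log_pow]; norm_num
  have hN0 : 0 ≤ N := by
    by_contra h
    push Not at h
    have h1 : ε ^ 2 * N < 0 := mul_neg_of_pos_of_neg (by positivity) h
    have h2 : 0 ≤ 30000 * ((m + 1) * s * lg ^ 2) * lam := by positivity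
    linarith
  set Γ := (m + 1) * s * lg ^ 2 with hΓ
  have hΓ1 : 1 ≤ Γ := by
    have : 1 ≤ (m + 1) * s := by nlinarith
    exact one_le_mul_of_one_le_of_one_le this (one_le_pow₀ (by linarith))
  have hpow : (2 ^ m : ℝ) ^ 2 = Real.exp (2 * m * Real.log 2) := by
    rw [← pow_mul, ← Real.rpow_natCast, Real.rpow_def_of_pos (by norm_num)]
    congr 1; push_cast; ring
  -- the light pairs
  have hA : (2 ^ m : ℝ) ^ 2 * Real.exp (-(4 * r * N)) ≤ δ / 16 := by
    rw [hpow, ← Real.exp_add, show δ / 16 = δ / (2 * 8) by norm_num, ← hexpδ 8 (by norm_num)]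
    refine Real.exp_le_exp.2 ?_
    have h1 : 4 * r * N * (8 * s * ε) = ε ^ 2 * N := by
      rw [hroot]; field_simp; ring
    have h9 : 20 * ((m + 1) * lam) ≤ 4 * r * N := by
      by_contra hcon
      push Not at hcon
      have h4 : 4 * r * N * (8 * s * ε) ≤ 20 * ((m + 1) * lam) * (8 * s * ε) :=
        mul_le_mul_of_nonneg_right hcon.le (by positivity)
      have h5 : (m + 1) * lam * (8 * s * ε) ≤ (m + 1) * lam * (8 * s * 1) := by
        gcongr; linarith
      have h6 : (m + 1) * s * 1 ≤ Γ := by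
        rw [hΓ]; gcongr; exact one_le_pow₀ (by linarith)
      have h7 : (m + 1) * s * lam ≤ Γ * lam := by
        have := mul_le_mul_of_nonneg_right h6 hlam0.le
        linarith
      have h8 : 0 < Γ * lam := by positivity
      linarith
    have h10 : (m : ℝ) * Real.log 2 ≤ m * lam := by gcongr
    rw [hl8]
    nlinarith
  have hr : 4 * r ≤ 1 := by
    rw [hroot, ← mul_div_assoc, div_le_one (by positivity)]; linarith
  have hB : (2 ^ m : ℝ) ^ 2 * Real.exp (-N) ≤ δ / 16 := by
    refine le_trans (mul_le_mul_of_nonneg_left (Real.exp_le_exp.2 ?_) (by positivity)) hA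
    nlinarith
  have hC : Real.exp (3829 * Γ) * Real.exp (-(ε ^ 2 / 4 * N)) ≤ δ / 24 := by
    rw [← Real.exp_add, show δ / 24 = δ / (2 * 12) by norm_num, ← hexpδ 12 (by norm_num)]
    refine Real.exp_le_exp.2 ?_
    have h1 : Γ * Real.log 2 ≤ Γ * lam := by gcongr
    have h2 : lam ≤ Γ * lam := by nlinarith
    have h3 : Γ * 0.69 ≤ Γ * Real.log 2 := by gcongr; linarith
    linarith
  have hD : Real.exp (3829 * Γ) * Real.exp (-(ε * N)) ≤ δ / 24 := by
    refine le_trans (mul_le_mul_of_nonneg_left (Real.exp_le_exp.2 ?_) (by positivity)) hC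
    have : ε ^ 2 / 4 ≤ ε := by nlinarith
    nlinarith
  linarith

end uniformLaw

/-! ### The uniform law for independent random matrices -/

section uniformLaw

variable {m ℓ : ℕ} {I Y : Type*} [Fintype I] [DecidableEq I] [Fintype Y]

/-- The matrices `A i` nearly average to zero, and the excesses of their pairings over
`2 log (1 / ε)` have a small sum, uniformly over the test matrices. -/
def UniformBound (m ℓ : ℕ) (ε : ℝ) (A : I → Matrix (Fin (2 ^ m)) (Fin (2 ^ m)) ℝ) : Prop :=
  ∀ S, IsTest m ℓ S → |∑ i, matInner (A i) S| ≤ 4 * ε * Fintype.card I ∧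
    ∑ i, max (|matInner (A i) S| - 2 * Real.log (1 / ε)) 0 ≤ 16 * ε * Fintype.card I

/-- Uniform law of large numbers over the test matrices for independent matrices `M i` with
subexponential linear functionals, under the assumption that the pairs of wavelets which are not
both heavy contribute little. The heavy part of a test matrix is handled by a union bound over grid
matrices, of which there are `exp (O(m s log² (s / ε)))`, and the rest by a union bound over the
pairs of wavelets, using that the sum of all coefficients is at most `s`. -/
theorem prob_not_uniformBound_le {w : I → Y → ℝ} (hw : ∀ i, IsProb (w i))
    (M : I → Y → Matrix (Fin (2 ^ m)) (Fin (2 ^ m)) ℝ) (hm : 1 ≤ m) (hℓ : 1 ≤ ℓ) {ε δ : ℝ}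
    (hε : 0 < ε) (hε2 : ε < 1 / 2) (hδ : 0 < δ) (hδ1 : δ < 1)
    {q : Fin (2 ^ m) → ℝ} (hq : ∀ x, 0 ≤ q x) (hq1 : 1 ≤ ∑ x, q x) (hq5 : ∑ x, q x ≤ 5)
    (hmgf : ∀ i Δ, (∀ x y, |Δ x y| ≤ 1) → ∀ t : ℝ, |t| ≤ 1 →
      expect (w i) (fun y => Real.exp (t * matInner (M i y) Δ)) ≤ Real.exp (t ^ 2))
    (hlight : ∀ a b, ¬ (a ∈ heavy m q (lightRoot m ℓ ε ^ 4) ∧ b ∈ heavy m q (lightRoot m ℓ ε ^ 4)) →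
      ∑ i, expect (w i) (fun y => |matInner (M i y) (wavePair m a b)|)
        ≤ Fintype.card I * lightRoot m ℓ ε ^ 2)
    (hN : 30000 * ((m + 1) * ((ℓ : ℝ) * m + 1) ^ 2 * Real.log (netRatio m ℓ ε) ^ 2)
      * Real.log (2 / δ) ≤ ε ^ 2 * Fintype.card I) :
    prob (piW w) (fun y => ¬ UniformBound m ℓ ε fun i => M i (y i)) ≤ δ / 4 := by
  classical
  have hs := four_le_haarBound hm hℓ
  have hP := isProb_piW hw
  have hη : 0 < lightRoot m ℓ ε := by unfold lightRoot; positivity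
  have hη1 : lightRoot m ℓ ε ≤ 1 := by
    unfold lightRoot; rw [div_le_one (by positivity)]; linarith
  have hθ : lightRoot m ℓ ε ^ 4 ≤ ∑ x, q x := (pow_le_one₀ hη.le hη1).trans hq1
  set T := heavy m q (lightRoot m ℓ ε ^ 4) with hT
  set κ := gridFineness m ℓ ε with hκ
  have hκ1 : 1 ≤ κ := by
    have h := (gridFineness_bounds hm hℓ hε hε2).1
    have h2 := two_le_log (eight_le_netRatio hm hℓ hε hε2)
    have : (1 : ℝ) ≤ κ := by linarith
    exact_mod_cast this
  have hfather : none ∈ T := by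
    rw [hT, mem_heavy]; simpa [waveMass, haarSign] using hθ
  have : Nonempty (T × T) := ⟨(⟨none, hfather⟩, ⟨none, hfather⟩)⟩
  set B : ℕ := 4 * ((m + 1) * κ) * (ℓ * m + 1) ^ 2 with hB
  have hBr : (B : ℝ) = 4 * ((m + 1) * κ) * ((ℓ : ℝ) * m + 1) ^ 2 := by rw [hB]; push_cast; ring
  obtain ⟨Z, hZ, hZcard⟩ := card_filter_sum_abs_le (J := T × T) B
    (Nat.one_le_iff_ne_zero.2 (by positivity))
  set Λ := 3829 * ((m + 1) * ((ℓ : ℝ) * m + 1) ^ 2 * Real.log (netRatio m ℓ ε) ^ 2) with hΛ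
  have hZΛ : (Z.card : ℝ) ≤ Real.exp Λ := by
    refine hZcard.trans (Real.exp_le_exp.2 ?_)
    have := log_card_grid_le (ℓ := ℓ) hq hq5 (Finset.card_pos.2 ⟨_, hfather⟩) hm hℓ hε hε2 hBr
    rw [Fintype.card_prod, Fintype.card_coe]
    push_cast
    rw [← sq]
    exact this
  set Z' := Z.filter fun z => ∀ x y, |gridMat T ((m + 1) * κ) z x y| ≤ 1 with hZ'
  have hZ'Λ : (Z'.card : ℝ) ≤ Real.exp Λ :=
    le_trans (by exact_mod_cast Finset.card_filter_le _ _) hZΛ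
  have h6 : ∀ i Δ, (∀ x y, |Δ x y| ≤ 1) →
      expect (w i) (fun y => Real.exp |matInner (M i y) Δ|) ≤ 6 := fun i Δ hΔ =>
    (hw i).expect_exp_abs_le (hmgf i Δ hΔ)
  set N : ℝ := ((Fintype.card I : ℕ) : ℝ) with hNdef
  -- the exceptional events
  set F : HaarIdx m × HaarIdx m → I → Y → ℝ := fun α i y =>
    |matInner (M i y) (wavePair m α.1 α.2)| with hF
  set G : (T × T → ℤ) → I → Y → ℝ := fun z i y =>
    matInner (M i y) (gridMat T ((m + 1) * κ) z) with hG
  set light : Finset (HaarIdx m × HaarIdx m) :=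
    Finset.univ.filter fun α => ¬ (α.1 ∈ T ∧ α.2 ∈ T) with hlightdef
  have hcard : ((Finset.univ : Finset (HaarIdx m × HaarIdx m)).card : ℝ) = (2 ^ m : ℝ) ^ 2 := by
    rw [Finset.card_univ, Fintype.card_prod, card_haarIdx]; push_cast; ring
  have hlcard : (light.card : ℝ) ≤ (2 ^ m : ℝ) ^ 2 := by
    rw [← hcard]; exact_mod_cast Finset.card_filter_le _ _
  have p1 : prob (piW w) (fun y => ∃ α ∈ light, 32 * lightRoot m ℓ ε * N < ∑ i, F α i (y i))
      ≤ light.card * Real.exp (-(4 * lightRoot m ℓ ε * N)) := by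
    refine hP.prob_exists_le light _ fun α hα => ?_
    refine prob_sum_gt_of_small_mean hw (F α) hη (fun i y => abs_nonneg _)
      (fun i => h6 i _ (abs_wavePair_le _ _)) ?_
    exact hlight α.1 α.2 (Finset.mem_filter.1 hα).2
  have p2 : prob (piW w) (fun y => ∃ α ∈ (Finset.univ : Finset (HaarIdx m × HaarIdx m)),
      3 * N < ∑ i, F α i (y i)) ≤ (Finset.univ : Finset (HaarIdx m × HaarIdx m)).card
        * Real.exp (-N) := by
    refine hP.prob_exists_le Finset.univ _ fun α _ => ?_
    exact prob_sum_gt_card hw (F α) (fun i => h6 i _ (abs_wavePair_le _ _))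
  have p3 : prob (piW w) (fun y => ∃ z ∈ Z', ε * N < |∑ i, G z i (y i)|)
      ≤ Z'.card * (2 * Real.exp (-(ε ^ 2 / 4 * N))) := by
    refine hP.prob_exists_le Z' _ fun z hz => ?_
    exact prob_abs_sum_gt hw (G z) hε (by linarith) fun i t ht =>
      hmgf i _ (Finset.mem_filter.1 hz).2 t ht
  have p4 : prob (piW w) (fun y => ∃ z ∈ Z', 7 * ε * N
      < ∑ i, max (|G z i (y i)| - Real.log (1 / ε)) 0) ≤ Z'.card * Real.exp (-(ε * N)) := by
    refine hP.prob_exists_le Z' _ fun z hz => ?_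
    exact prob_sum_excess_gt hw (fun i y => |G z i y|) hε fun i =>
      h6 i _ (Finset.mem_filter.1 hz).2
  have hsum := failure_sum_le (N := N) hm hℓ hε hε2 hδ hδ1 hN
  refine le_trans ?_ hsum
  refine le_trans ?_ (add_le_add (add_le_add (add_le_add
    (p1.trans (mul_le_mul_of_nonneg_right hlcard (Real.exp_pos _).le))
    (p2.trans_eq (by rw [hcard])))
    (p3.trans (mul_le_mul_of_nonneg_right hZ'Λ (by positivity))))
    (p4.trans (mul_le_mul_of_nonneg_right hZ'Λ (by positivity))))
  refine le_trans ?_ (add_le_add_left ((hP.prob_or_le _ _).trans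
    (add_le_add_left (hP.prob_or_le _ _) _)) _)
  refine le_trans (hP.prob_mono fun y hy => ?_) (hP.prob_or_le _ _)
  by_contra hno
  push Not at hno
  obtain ⟨⟨⟨n1, n2⟩, n3⟩, n4⟩ := hno
  refine hy fun S hS => ?_
  obtain ⟨J, _, p, z, hp, hz1, hz2, hz3⟩ := exists_mixture hq hθ hm hκ1 hS
  refine uniform_of_grid hε (by unfold roundErr; positivity)
    (card_sq_mul_roundErr_le hq hq5 hm hℓ hε hε2) (fun i => M i (y i)) (fun a b hab => ?_)
    (fun a b => n2 (a, b) (Finset.mem_univ _)) (fun z' hz1' hz2' => ?_) hS hp hz1 hz2 hz3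
  · refine (n1 (a, b) (Finset.mem_filter.2 ⟨Finset.mem_univ _, hab⟩)).trans_eq ?_
    rw [lightRoot]; field_simp; rw [hNdef]
  · have hmem : z' ∈ Z' := Finset.mem_filter.2 ⟨hZ z' (by rw [hBr]; exact hz1'), hz2'⟩
    exact ⟨n3 z' hmem, n4 z' hmem⟩

end uniformLaw

/-! ### Moments of a batch -/

section matInner

variable {n : ℕ}

lemma matInner_smul (c : ℝ) (A Δ : Matrix (Fin n) (Fin n) ℝ) :
    matInner (c • A) Δ = c * matInner A Δ := by
  simp only [matInner, Matrix.smul_apply, smul_eq_mul, Finset.mul_sum, mul_assoc]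

lemma matInner_sub (A B Δ : Matrix (Fin n) (Fin n) ℝ) :
    matInner (A - B) Δ = matInner A Δ - matInner B Δ := by
  simp only [matInner, Matrix.sub_apply, sub_mul, Finset.sum_sub_distrib]

lemma matInner_sum_left {J : Type*} (s : Finset J) (A : J → Matrix (Fin n) (Fin n) ℝ)
    (Δ : Matrix (Fin n) (Fin n) ℝ) : matInner (∑ j ∈ s, A j) Δ = ∑ j ∈ s, matInner (A j) Δ := by
  simp only [matInner, Matrix.sum_apply, Finset.sum_mul]
  rw [Finset.sum_comm (s := s)]
  exact Finset.sum_congr rfl fun x _ => Finset.sum_comm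

lemma matInner_vecMulVec (f g : Fin n → ℝ) (Δ : Matrix (Fin n) (Fin n) ℝ) :
    matInner (Matrix.vecMulVec f g) Δ = f ⬝ᵥ Δ.mulVec g := by
  rw [bilin_eq_sum]; rfl

lemma matInner_diagonal (d : Fin n → ℝ) (Δ : Matrix (Fin n) (Fin n) ℝ) :
    matInner (Matrix.diagonal d) Δ = d ⬝ᵥ fun x => Δ x x := by
  simp only [matInner, dotProduct]
  refine Finset.sum_congr rfl fun x _ => ?_
  rw [Finset.sum_eq_single x]
  · rw [Matrix.diagonal_apply_eq]
  · intro y _ hy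
    rw [Matrix.diagonal_apply_ne _ (Ne.symm hy), zero_mul]
  · simp

end matInner

section batch

variable {n k : ℕ} {p : Fin n → ℝ}

lemma drawSum_eq_freq (hk : 1 ≤ k) (p : Fin n → ℝ) (y : Fin k → Fin n) :
    drawSum (fun _ => p) y = (k : ℝ) • (freq y - p) := by
  have hk0 : (k : ℝ) ≠ 0 := by positivity
  funext u
  simp only [drawSum, Finset.sum_apply, centered_apply, Pi.smul_apply, Pi.sub_apply, freq,
    smul_eq_mul, Finset.sum_sub_distrib, Finset.sum_const, Finset.card_univ, Fintype.card_fin,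
    nsmul_eq_mul]
  rw [Finset.sum_boole, mul_sub, mul_div_cancel₀ _ hk0]
  simp only [eq_comm]

lemma quadForm_eq_freq (hk : 1 ≤ k) (p : Fin n → ℝ) (Δ : Matrix (Fin n) (Fin n) ℝ)
    (y : Fin k → Fin n) :
    quadForm (fun _ => p) Δ y = k * ((freq y - p) ⬝ᵥ Δ.mulVec (freq y - p)) := by
  have hk0 : (k : ℝ) ≠ 0 := by positivity
  rw [quadForm, drawSum_eq_freq hk, Fintype.card_fin, Matrix.mulVec_smul, smul_dotProduct,
    dotProduct_smul]
  simp only [smul_eq_mul]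
  field_simp

lemma freq_sub_dotProduct (hk : 1 ≤ k) (p φ : Fin n → ℝ) (y : Fin k → Fin n) :
    (freq y - p) ⬝ᵥ φ = ∑ j, (1 / (k : ℝ)) * (centered p (y j) ⬝ᵥ φ) := by
  have hk0 : (k : ℝ) ≠ 0 := by positivity
  have h : freq y - p = (1 / (k : ℝ)) • drawSum (fun _ => p) y := by
    rw [drawSum_eq_freq hk, smul_smul, one_div, inv_mul_cancel₀ hk0, one_smul]
  rw [h, smul_dotProduct, drawSum, sum_dotProduct, smul_eq_mul, Finset.mul_sum]

/-- The variance of a linear functional of a batch. -/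
lemma expect_sq_freq_le (hk : 1 ≤ k) (hp : IsProb p) (φ : Fin n → ℝ) :
    expect (piW fun _ : Fin k => p) (fun y => k * ((freq y - p) ⬝ᵥ φ) ^ 2)
      ≤ ∑ x, p x * φ x ^ 2 := by
  have hk0 : (k : ℝ) ≠ 0 := by positivity
  have hq : ∀ f : Fin n → ℝ, f ⬝ᵥ (Matrix.vecMulVec φ φ).mulVec f = (f ⬝ᵥ φ) ^ 2 := by
    intro f
    rw [Matrix.vecMulVec_mulVec, dotProduct_smul, dotProduct_comm φ f]
    simp [sq]
  have h1 : (fun y : Fin k → Fin n => (k : ℝ) * ((freq y - p) ⬝ᵥ φ) ^ 2)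
      = quadForm (fun _ => p) (Matrix.vecMulVec φ φ) := by
    funext y
    rw [quadForm_eq_freq hk, hq]
  rw [h1, expect_quadForm fun _ => hp]
  simp only [hq, Finset.sum_const, Finset.card_univ, Fintype.card_fin, nsmul_eq_mul]
  rw [← mul_assoc, one_div, inv_mul_cancel₀ hk0, one_mul]
  simp only [dotProduct_centered]
  have h2 : ∀ x, (φ x - p ⬝ᵥ φ) ^ 2 = φ x ^ 2 - 2 * (p ⬝ᵥ φ) * φ x + (p ⬝ᵥ φ) ^ 2 := by
    intro x; ring
  simp only [h2]
  rw [expect_add, expect_sub, expect_const_mul, hp.expect_const]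
  have h3 : expect p φ = p ⬝ᵥ φ := rfl
  have h4 : expect p (fun x => φ x ^ 2) = ∑ x, p x * φ x ^ 2 := rfl
  rw [h3, h4]
  nlinarith [sq_nonneg (p ⬝ᵥ φ)]

/-- A bounded linear functional of a batch is subgaussian. -/
lemma expect_exp_freq_le (hk : 1 ≤ k) (hp : IsProb p) {φ : Fin n → ℝ} {c : ℝ}
    (hφ : ∀ x, |φ x| ≤ c) (t : ℝ) :
    expect (piW fun _ : Fin k => p) (fun y => Real.exp (t * ((freq y - p) ⬝ᵥ φ)))
      ≤ Real.exp (2 * t ^ 2 * c ^ 2 / k) := by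
  have hk0 : (0 : ℝ) < k := by positivity
  have h1 : ∀ y : Fin k → Fin n, t * ((freq y - p) ⬝ᵥ φ)
      = ∑ j, t / k * (centered p (y j) ⬝ᵥ φ) := by
    intro y
    rw [freq_sub_dotProduct hk, Finset.mul_sum]
    exact Finset.sum_congr rfl fun j _ => by ring
  simp only [h1]
  refine (expect_piW_exp_sum_le (fun _ => hp) (fun _ x => t / k * (centered p x ⬝ᵥ φ))
    (c := fun _ => (|t| / k * (2 * c)) ^ 2 / 2) fun j => ?_).trans_eq ?_
  · refine hp.hoeffding (fun x => ?_) ?_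
    · rw [abs_mul, abs_div, abs_of_pos hk0]
      refine mul_le_mul_of_nonneg_left ?_ (by positivity)
      calc |centered p x ⬝ᵥ φ| ≤ ∑ u, |centered p x u| * c := by
            refine (Finset.abs_sum_le_sum_abs _ _).trans (Finset.sum_le_sum fun u _ => ?_)
            rw [abs_mul]
            exact mul_le_mul_of_nonneg_left (hφ u) (abs_nonneg _)
        _ = (∑ u, |centered p x u|) * c := by rw [Finset.sum_mul]
        _ ≤ 2 * c := mul_le_mul_of_nonneg_right (sum_abs_centered_le hp x)
            ((abs_nonneg _).trans (hφ x))
    · rw [expect_const_mul, expect_centered_dotProduct hp, mul_zero]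
  · congr 1
    rw [Finset.sum_const, Finset.card_univ, Fintype.card_fin, nsmul_eq_mul]
    rw [mul_pow, div_pow, sq_abs]
    field_simp

end batch

/-! ### The law of a batch as a finite sum -/

section law

variable {n k : ℕ} {p : Fin n → ℝ}

lemma isProb_of_mem_stdSimplex (hp : p ∈ stdSimplex ℝ (Fin n)) : IsProb p := ⟨hp.1, hp.2⟩

lemma categorical_singleton (p : Fin n → ℝ) (a : Fin n) :
    categorical p {a} = ENNReal.ofReal (p a) := by
  rw [categorical, Measure.finsetSum_apply]
  rw [Finset.sum_eq_single a]
  · simp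
  · intro b _ hb
    simp [hb]
  · simp

lemma isProbabilityMeasure_categorical (hp : IsProb p) : IsProbabilityMeasure (categorical p) := by
  constructor
  rw [categorical, Measure.finsetSum_apply]
  simp only [Measure.smul_apply, measure_univ, smul_eq_mul, mul_one]
  rw [← ENNReal.ofReal_sum_of_nonneg fun i _ => hp.nonneg i, hp.sum_one, ENNReal.ofReal_one]

lemma pi_categorical_singleton (hp : IsProb p) (y : Fin k → Fin n) :
    (Measure.pi fun _ : Fin k => categorical p) {y}
      = ENNReal.ofReal (piW (fun _ : Fin k => p) y) := by
  have := isProbabilityMeasure_categorical hp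
  rw [Measure.pi_singleton, piW, ENNReal.ofReal_prod_of_nonneg fun j _ => hp.nonneg _]
  simp only [categorical_singleton]

lemma measurable_freq : Measurable (freq : (Fin k → Fin n) → Fin n → ℝ) := measurable_of_finite _

lemma integral_mulDist (hp : IsProb p) {f : (Fin n → ℝ) → ℝ} (hf : Measurable f) :
    ∫ x, f x ∂(mulDist k p) = expect (piW fun _ : Fin k => p) (fun y => f (freq y)) := by
  have := isProbabilityMeasure_categorical hp
  rw [mulDist, integral_map measurable_freq.aemeasurable hf.aestronglyMeasurable,
    integral_fintype Integrable.of_finite]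
  refine Finset.sum_congr rfl fun y _ => ?_
  rw [Measure.real, pi_categorical_singleton hp,
    ENNReal.toReal_ofReal ((isProb_piW fun _ => hp).nonneg y), smul_eq_mul]

lemma matB_eq_expect (hp : IsProb p) (a b : Fin n) :
    matB k p a b = expect (piW fun _ : Fin k => p)
      (fun y => (freq y a - p a) * (freq y b - p b)) :=
  integral_mulDist hp (by fun_prop)

/-- The covariance of a batch. -/
lemma matB_eq (hk : 1 ≤ k) (hp : IsProb p) :
    matB k p = (1 / (k : ℝ)) • (Matrix.diagonal p - Matrix.vecMulVec p p) := by
  have hk0 : (k : ℝ) ≠ 0 := by positivity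
  ext a b
  have h1 : ∀ y : Fin k → Fin n, (freq y a - p a) * (freq y b - p b)
      = 1 / (k : ℝ) ^ 2 * (drawSum (fun _ => p) y a * drawSum (fun _ => p) y b) := by
    intro y
    rw [drawSum_eq_freq hk]
    simp only [Pi.smul_apply, Pi.sub_apply, smul_eq_mul]
    field_simp
  rw [matB_eq_expect hp]
  simp only [h1]
  rw [expect_const_mul, expect_drawSum_mul fun _ => hp]
  have h2 : expect p (fun x => centered p x a * centered p x b)
      = (if a = b then p a else 0) - p a * p b := by
    have h3 : ∀ x, centered p x a * centered p x b
        = (if a = x then (if b = x then 1 else 0) else 0) - (if a = x then 1 else 0) * p b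
          - (if b = x then 1 else 0) * p a + p a * p b := by
      intro x
      simp only [centered_apply]
      split_ifs <;> ring
    simp only [h3]
    rw [expect_add, expect_sub, expect_sub, expect_mul_const, expect_mul_const, hp.expect_const]
    simp only [expect, mul_ite, mul_one, mul_zero, Finset.sum_ite_eq, Finset.mem_univ, if_true]
    simp only [eq_comm]
    ring_nf
  rw [h2]
  simp only [Finset.sum_const, Finset.card_univ, Fintype.card_fin, nsmul_eq_mul,
    Matrix.smul_apply, Matrix.sub_apply, Matrix.diagonal_apply, Matrix.vecMulVec_apply, smul_eq_mul]
  field_simp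

lemma matInner_matB (hp : IsProb p) (Δ : Matrix (Fin n) (Fin n) ℝ) :
    matInner (matB k p) Δ = expect (piW fun _ : Fin k => p)
      (fun y => (freq y - p) ⬝ᵥ Δ.mulVec (freq y - p)) := by
  simp only [bilin_eq_sum, expect_sum, matInner, expect_mul_const, Pi.sub_apply]
  simp only [matB_eq_expect hp]

end law

/-! ### The three random matrices of a batch -/

section deviations

variable {n : ℕ}

/-- The deviation of `(x - p)(x - p)ᵀ` from its mean, in the scale of its standard deviation. -/
noncomputable def covDev (k : ℕ) (p x : Fin n → ℝ) : Matrix (Fin n) (Fin n) ℝ :=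
  ((k : ℝ) / 16) • (Matrix.vecMulVec (x - p) (x - p) - matB k p)

/-- The diagonal matrix of the deviation of a batch from its mean. -/
noncomputable def diagDev (p x : Fin n → ℝ) : Matrix (Fin n) (Fin n) ℝ :=
  (1 / 2 : ℝ) • Matrix.diagonal (x - p)

/-- The product of a fixed vector with the deviation of a batch from its mean. -/
noncomputable def crossDev (k : ℕ) (v p x : Fin n → ℝ) : Matrix (Fin n) (Fin n) ℝ :=
  (Real.sqrt k / 8) • Matrix.vecMulVec v (x - p)

variable {k : ℕ} {p : Fin n → ℝ} {Δ : Matrix (Fin n) (Fin n) ℝ}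

lemma matInner_covDev (hk : 1 ≤ k) (hp : IsProb p) (y : Fin k → Fin n) :
    matInner (covDev k p (freq y)) Δ = 1 / 16 * (quadForm (fun _ => p) Δ y
      - expect (piW fun _ : Fin k => p) (quadForm (fun _ => p) Δ)) := by
  have h : quadForm (fun _ : Fin k => p) Δ
      = fun y => (k : ℝ) * ((freq y - p) ⬝ᵥ Δ.mulVec (freq y - p)) := by
    funext y; exact quadForm_eq_freq hk p Δ y
  rw [covDev, matInner_smul, matInner_sub, matInner_vecMulVec, matInner_matB hp, h,
    expect_const_mul]
  ring

lemma matInner_diagDev (x : Fin n → ℝ) :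
    matInner (diagDev p x) Δ = 1 / 2 * ((x - p) ⬝ᵥ fun u => Δ u u) := by
  rw [diagDev, matInner_smul, matInner_diagonal]

lemma matInner_crossDev (v x : Fin n → ℝ) :
    matInner (crossDev k v p x) Δ = Real.sqrt k / 8 * (v ⬝ᵥ Δ.mulVec (x - p)) := by
  rw [crossDev, matInner_smul, matInner_vecMulVec]

lemma expect_exp_covDev_le (hk : 1 ≤ k) (hp : IsProb p) (hΔ : ∀ x y, |Δ x y| ≤ 1) {t : ℝ}
    (ht : |t| ≤ 1) :
    expect (piW fun _ : Fin k => p) (fun y => Real.exp (t * matInner (covDev k p (freq y)) Δ))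
      ≤ Real.exp (t ^ 2) := by
  have : Nonempty (Fin k) := ⟨⟨0, hk⟩⟩
  have h := expect_exp_quadForm_le (J := Fin k) (p := fun _ => p) (fun _ => hp) hΔ
    (t := t / 16) (by rw [abs_div]; norm_num; linarith)
  simp only [matInner_covDev hk hp]
  refine le_trans (le_of_eq ?_) (h.trans (Real.exp_le_exp.2 ?_))
  · congr 1; funext y; congr 1; ring
  · nlinarith [sq_nonneg t]

lemma expect_exp_diagDev_le (hk : 1 ≤ k) (hp : IsProb p) (hΔ : ∀ x y, |Δ x y| ≤ 1) (t : ℝ) :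
    expect (piW fun _ : Fin k => p) (fun y => Real.exp (t * matInner (diagDev p (freq y)) Δ))
      ≤ Real.exp (t ^ 2) := by
  have hk1 : (1 : ℝ) ≤ k := by exact_mod_cast hk
  have h := expect_exp_freq_le hk hp (φ := fun u => Δ u u) (c := 1) (fun u => hΔ u u) (t / 2)
  simp only [matInner_diagDev]
  refine le_trans (le_of_eq ?_) (h.trans (Real.exp_le_exp.2 ?_))
  · congr 1; funext y; congr 1; ring
  · rw [div_le_iff₀ (by linarith)]
    nlinarith [sq_nonneg t]

lemma abs_mulVec_transpose_le (hΔ : ∀ x y, |Δ x y| ≤ 1) {v : Fin n → ℝ} {c : ℝ}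
    (hv : ∑ x, |v x| ≤ c) (x : Fin n) : |Δ.transpose.mulVec v x| ≤ c := by
  refine (Finset.abs_sum_le_sum_abs _ _).trans (le_trans (Finset.sum_le_sum fun y _ => ?_) hv)
  rw [abs_mul]
  exact mul_le_of_le_one_left (abs_nonneg _) (hΔ y x)

lemma bilin_comm_transpose (v f : Fin n → ℝ) :
    v ⬝ᵥ Δ.mulVec f = f ⬝ᵥ Δ.transpose.mulVec v := (bilin_transpose Δ f v).symm

lemma expect_exp_crossDev_le (hk : 1 ≤ k) (hp : IsProb p) (hΔ : ∀ x y, |Δ x y| ≤ 1)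
    {v : Fin n → ℝ} (hv : ∑ x, |v x| ≤ 4) (t : ℝ) :
    expect (piW fun _ : Fin k => p) (fun y => Real.exp (t * matInner (crossDev k v p (freq y)) Δ))
      ≤ Real.exp (t ^ 2) := by
  have hk1 : (1 : ℝ) ≤ k := by exact_mod_cast hk
  have h := expect_exp_freq_le hk hp (abs_mulVec_transpose_le hΔ hv) (t * (Real.sqrt k / 8))
  simp only [matInner_crossDev, bilin_comm_transpose v]
  refine le_trans (le_of_eq ?_) (h.trans (Real.exp_le_exp.2 ?_))
  · congr 1; funext y; congr 1; ring
  · rw [div_le_iff₀ (by linarith)]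
    have h1 : (Real.sqrt k) ^ 2 = k := Real.sq_sqrt (by linarith)
    have : 2 * (t * (Real.sqrt k / 8)) ^ 2 * 4 ^ 2 = t ^ 2 * (Real.sqrt k) ^ 2 / 2 := by ring
    rw [this, h1]
    nlinarith [mul_nonneg (sq_nonneg t) (by linarith : (0 : ℝ) ≤ k)]

end deviations

section light

variable {m k : ℕ} {p : Fin (2 ^ m) → ℝ}

lemma IsProb.expect_abs_mul_le {Y : Type*} [Fintype Y] {w : Y → ℝ} (hw : IsProb w) (f g : Y → ℝ)
    {r : ℝ} (hr : 0 < r) : expect w (fun y => |f y * g y|)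
      ≤ (expect w (fun y => f y ^ 2) / r + r * expect w (fun y => g y ^ 2)) / 2 := by
  have h : (expect w (fun y => f y ^ 2) / r + r * expect w (fun y => g y ^ 2)) / 2
      = expect w (fun y => 1 / (2 * r) * f y ^ 2 + r / 2 * g y ^ 2) := by
    rw [expect_add, expect_const_mul, expect_const_mul]
    field_simp
  rw [h]
  refine hw.expect_mono fun y => ?_
  have h1 : 1 / (2 * r) * f y ^ 2 + r / 2 * g y ^ 2 - |f y * g y|
      = (|f y| - r * |g y|) ^ 2 / (2 * r) := by
    rw [abs_mul, ← sq_abs (f y), ← sq_abs (g y)]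
    field_simp
    ring
  have h2 : 0 ≤ (|f y| - r * |g y|) ^ 2 / (2 * r) := by positivity
  linarith

lemma waveMass_le_sum {q : Fin (2 ^ m) → ℝ} (hq : ∀ x, 0 ≤ q x) (a : HaarIdx m) :
    waveMass m q a ≤ ∑ x, q x :=
  Finset.sum_le_sum fun x _ => mul_le_of_le_one_right (hq x) (abs_haarSign_le a x)

lemma waveMass_nonneg {q : Fin (2 ^ m) → ℝ} (hq : ∀ x, 0 ≤ q x) (a : HaarIdx m) :
    0 ≤ waveMass m q a :=
  Finset.sum_nonneg fun x _ => mul_nonneg (hq x) (abs_nonneg _)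

/-- The variance of a linear functional dominated by a wavelet is at most the mass of the support of
the wavelet. -/
lemma expect_sq_le_waveMass (hk : 1 ≤ k) (hp : IsProb p) {φ : Fin (2 ^ m) → ℝ} {a : HaarIdx m}
    (hφ : ∀ x, |φ x| ≤ |haarSign m a x|) :
    expect (piW fun _ : Fin k => p) (fun y => (Real.sqrt k * ((freq y - p) ⬝ᵥ φ)) ^ 2)
      ≤ waveMass m p a := by
  have hk1 : (0 : ℝ) ≤ k := Nat.cast_nonneg _
  simp only [mul_pow, Real.sq_sqrt hk1]
  refine (expect_sq_freq_le hk hp φ).trans (Finset.sum_le_sum fun x _ => ?_)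
  refine mul_le_mul_of_nonneg_left ?_ (hp.nonneg x)
  rw [← sq_abs]
  nlinarith [hφ x, abs_haarSign_le a x, abs_nonneg (φ x)]

lemma bilin_wavePair (a b : HaarIdx m) (f g : Fin (2 ^ m) → ℝ) :
    f ⬝ᵥ (wavePair m a b).mulVec g = (f ⬝ᵥ haarSign m a) * (g ⬝ᵥ haarSign m b) := by
  have : wavePair m a b = Matrix.vecMulVec (haarSign m a) (haarSign m b) := rfl
  rw [this, Matrix.vecMulVec_mulVec, dotProduct_smul, dotProduct_comm (haarSign m b)]
  simp

lemma expect_abs_covDev_le (hk : 1 ≤ k) (hp : IsProb p) (a b : HaarIdx m) {r : ℝ} (hr : 0 < r) :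
    expect (piW fun _ : Fin k => p)
        (fun y => |matInner (covDev k p (freq y)) (wavePair m a b)|)
      ≤ (waveMass m p a / r + r * waveMass m p b) / 2 := by
  have hP : IsProb (piW fun _ : Fin k => p) := isProb_piW fun _ => hp
  have hk1 : (0 : ℝ) ≤ k := Nat.cast_nonneg _
  set f : HaarIdx m → (Fin k → Fin (2 ^ m)) → ℝ := fun a y =>
    Real.sqrt k * ((freq y - p) ⬝ᵥ haarSign m a) with hf
  have hq : ∀ y, quadForm (fun _ => p) (wavePair m a b) y = f a y * f b y := by
    intro y
    have : Real.sqrt k * Real.sqrt k = k := Real.mul_self_sqrt hk1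
    rw [quadForm_eq_freq hk, bilin_wavePair, ← this]
    simp only [hf]; ring
  have hq' : quadForm (fun _ => p) (wavePair m a b) = fun y => f a y * f b y := funext hq
  set c := expect (piW fun _ : Fin k => p) (fun y => |f a y * f b y|) with hc
  have h0 : 0 ≤ c := hP.expect_nonneg fun y => abs_nonneg _
  have h1 : c ≤ (waveMass m p a / r + r * waveMass m p b) / 2 := by
    refine (hP.expect_abs_mul_le (f a) (f b) hr).trans ?_
    have ha := expect_sq_le_waveMass (k := k) (a := a) hk hp (fun x => le_rfl)
    have hb := expect_sq_le_waveMass (k := k) (a := b) hk hp (fun x => le_rfl)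
    have := div_le_div_of_nonneg_right ha hr.le
    have := mul_le_mul_of_nonneg_left hb hr.le
    simp only [hf]
    linarith
  refine le_trans ?_ h1
  calc _ ≤ expect (piW fun _ : Fin k => p) (fun y => 1 / 16 * |f a y * f b y| + 1 / 16 * c) := by
        refine hP.expect_mono fun y => ?_
        rw [matInner_covDev hk hp, hq', abs_mul, abs_of_pos (by norm_num : (0 : ℝ) < 1 / 16)]
        have h2 := abs_sub (f a y * f b y)
          (expect (piW fun _ : Fin k => p) (fun y => f a y * f b y))
        have h3 := hP.abs_expect_le (fun y => f a y * f b y)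
        nlinarith
    _ = 1 / 8 * c := by rw [expect_add, expect_const_mul, hP.expect_const]; ring
    _ ≤ c := by linarith

lemma expect_abs_diagDev_le (hk : 1 ≤ k) (hp : IsProb p) (a b : HaarIdx m) {c : HaarIdx m}
    (hc : c = a ∨ c = b) {r : ℝ} (hr : 0 < r) :
    expect (piW fun _ : Fin k => p)
        (fun y => |matInner (diagDev p (freq y)) (wavePair m a b)|)
      ≤ (waveMass m p c / r + r) / 2 := by
  have hP : IsProb (piW fun _ : Fin k => p) := isProb_piW fun _ => hp
  have hk1 : (1 : ℝ) ≤ k := by exact_mod_cast hk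
  have hs1 : 1 ≤ Real.sqrt k := Real.one_le_sqrt.2 hk1
  set φ : Fin (2 ^ m) → ℝ := fun x => wavePair m a b x x with hφ
  have h1 : ∀ x, |φ x| ≤ |haarSign m c x| := by
    intro x
    change |haarSign m a x * haarSign m b x| ≤ _
    rw [abs_mul]
    rcases hc with rfl | rfl
    · exact mul_le_of_le_one_right (abs_nonneg _) (abs_haarSign_le _ x)
    · exact mul_le_of_le_one_left (abs_nonneg _) (abs_haarSign_le _ x)
  have h2 := hP.expect_abs_mul_le (fun y => Real.sqrt k * ((freq y - p) ⬝ᵥ φ)) (fun _ => 1) hr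
  have h3 := div_le_div_of_nonneg_right (expect_sq_le_waveMass (k := k) hk hp h1) hr.le
  rw [hP.expect_const] at h2
  refine le_trans (hP.expect_mono fun y => ?_) (h2.trans (by linarith))
  rw [matInner_diagDev, mul_one, abs_mul, abs_mul, abs_of_pos (by norm_num : (0 : ℝ) < 1 / 2),
    abs_of_pos (by linarith : 0 < Real.sqrt k)]
  exact mul_le_mul_of_nonneg_right (by linarith) (abs_nonneg _)

lemma expect_abs_crossDev_le (hk : 1 ≤ k) (hp : IsProb p) (v : Fin (2 ^ m) → ℝ) (a b : HaarIdx m)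
    {r : ℝ} (hr : 0 < r) :
    expect (piW fun _ : Fin k => p)
        (fun y => |matInner (crossDev k v p (freq y)) (wavePair m a b)|)
      ≤ waveMass m (fun x => |v x|) a / 8 * ((waveMass m p b / r + r) / 2) := by
  have hP : IsProb (piW fun _ : Fin k => p) := isProb_piW fun _ => hp
  have h2 := hP.expect_abs_mul_le (fun y => Real.sqrt k * ((freq y - p) ⬝ᵥ haarSign m b))
    (fun _ => 1) hr
  have h3 := div_le_div_of_nonneg_right
    (expect_sq_le_waveMass (k := k) (a := b) hk hp (fun _ => le_rfl)) hr.le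
  rw [hP.expect_const] at h2
  have h4 : |v ⬝ᵥ haarSign m a| ≤ waveMass m (fun x => |v x|) a :=
    (Finset.abs_sum_le_sum_abs _ _).trans_eq
      (Finset.sum_congr rfl fun x _ => by rw [abs_mul])
  have h5 : 0 ≤ waveMass m (fun x => |v x|) a := waveMass_nonneg (fun x => abs_nonneg _) a
  have h6 : expect (piW fun _ : Fin k => p) (fun y =>
      |Real.sqrt k * ((freq y - p) ⬝ᵥ haarSign m b) * 1|) ≤ (waveMass m p b / r + r) / 2 := by
    linarith
  refine le_trans ?_ (mul_le_mul_of_nonneg_left h6 (by linarith))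
  rw [← expect_const_mul]
  refine hP.expect_mono fun y => ?_
  rw [matInner_crossDev, bilin_wavePair, mul_one]
  have : Real.sqrt k / 8 * ((v ⬝ᵥ haarSign m a) * ((freq y - p) ⬝ᵥ haarSign m b))
      = (v ⬝ᵥ haarSign m a) / 8 * (Real.sqrt k * ((freq y - p) ⬝ᵥ haarSign m b)) := by ring
  rw [this, abs_mul, abs_div, abs_of_pos (by norm_num : (0 : ℝ) < 8)]
  gcongr

end light

/-! ### Uniform laws for the batches -/

section batches

variable {m ℓ k : ℕ} {I : Type*} [Fintype I]

/-- The reference mass: the average of the distributions and of the absolute values of the `v i`. -/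
noncomputable def refMass (μ v : I → Fin (2 ^ m) → ℝ) : Fin (2 ^ m) → ℝ :=
  fun x => 1 / (Fintype.card I : ℝ) * ∑ i, (μ i x + |v i x|)

variable {μ v : I → Fin (2 ^ m) → ℝ}

lemma refMass_nonneg (hμ : ∀ i, IsProb (μ i)) (x : Fin (2 ^ m)) : 0 ≤ refMass μ v x :=
  mul_nonneg (by positivity) (Finset.sum_nonneg fun i _ =>
    add_nonneg ((hμ i).nonneg x) (abs_nonneg _))

lemma card_mul_waveMass_refMass [Nonempty I] (a : HaarIdx m) :
    Fintype.card I * waveMass m (refMass μ v) a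
      = ∑ i, waveMass m (μ i) a + ∑ i, waveMass m (fun x => |v i x|) a := by
  have hN : (Fintype.card I : ℝ) ≠ 0 := by exact_mod_cast Fintype.card_ne_zero
  simp only [waveMass, refMass]
  rw [← Finset.sum_add_distrib, Finset.mul_sum]
  simp only [← Finset.sum_add_distrib]
  rw [Finset.sum_comm]
  refine Finset.sum_congr rfl fun x _ => ?_
  rw [← mul_assoc, ← mul_assoc, mul_one_div_cancel hN, one_mul, Finset.sum_mul]
  exact Finset.sum_congr rfl fun i _ => by ring

lemma sum_refMass [Nonempty I] (hμ : ∀ i, IsProb (μ i)) (hv : ∀ i, ∑ x, |v i x| ≤ 4) :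
    1 ≤ ∑ x, refMass μ v x ∧ ∑ x, refMass μ v x ≤ 5 := by
  have hN : (0 : ℝ) < Fintype.card I := by exact_mod_cast Fintype.card_pos
  have h : ∑ x, refMass μ v x
      = 1 / (Fintype.card I : ℝ) * ∑ i, (1 + ∑ x, |v i x|) := by
    simp only [refMass]
    rw [← Finset.mul_sum, Finset.sum_comm]
    congr 1
    refine Finset.sum_congr rfl fun i _ => ?_
    rw [Finset.sum_add_distrib, (hμ i).sum_one]
  rw [h, one_div, le_inv_mul_iff₀ hN, inv_mul_le_iff₀ hN]
  constructor
  · calc (Fintype.card I : ℝ) * 1 = ∑ i : I, (1 : ℝ) := by simp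
      _ ≤ _ := Finset.sum_le_sum fun i _ => by
        linarith [Finset.sum_nonneg fun x (_ : x ∈ Finset.univ) => abs_nonneg (v i x)]
  · calc _ ≤ ∑ i : I, (5 : ℝ) := Finset.sum_le_sum fun i _ => by linarith [hv i]
      _ = _ := by simp

variable {ε δ : ℝ}

/-- If `a` is not heavy for the reference mass, the average mass of its support is small. -/
lemma sum_waveMass_le [Nonempty I] (hμ : ∀ i, IsProb (μ i)) {θ : ℝ} {a : HaarIdx m}
    (ha : a ∉ heavy m (refMass μ v) θ) :
    ∑ i, waveMass m (μ i) a ≤ Fintype.card I * θ ∧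
      ∑ i, waveMass m (fun x => |v i x|) a ≤ Fintype.card I * θ := by
  have hN : (0 : ℝ) < Fintype.card I := by exact_mod_cast Fintype.card_pos
  rw [mem_heavy, not_le] at ha
  have h := card_mul_waveMass_refMass (μ := μ) (v := v) a
  have h1 : 0 ≤ ∑ i, waveMass m (μ i) a :=
    Finset.sum_nonneg fun i _ => waveMass_nonneg (hμ i).nonneg a
  have h2 : 0 ≤ ∑ i, waveMass m (fun x => |v i x|) a :=
    Finset.sum_nonneg fun i _ => waveMass_nonneg (fun x => abs_nonneg _) a
  have := mul_le_mul_of_nonneg_left ha.le hN.le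
  constructor <;> linarith

lemma lightRoot_pos (hε : 0 < ε) : 0 < lightRoot m ℓ ε := by unfold lightRoot; positivity

lemma lightRoot_le_one (hm : 1 ≤ m) (hℓ : 1 ≤ ℓ) (hε2 : ε < 1 / 2) : lightRoot m ℓ ε ≤ 1 := by
  have hs := four_le_haarBound hm hℓ
  unfold lightRoot
  rw [div_le_one (by positivity)]
  linarith

/-- Linear bounds in the masses of the supports sum to the threshold for light pairs. -/
lemma sum_mass_div_add_le {x : I → ℝ} {r : ℝ} (hr : 0 < r)
    (hx : ∑ i, x i ≤ Fintype.card I * r ^ 4) :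
    ∑ i, (x i / r ^ 2 + r ^ 2) / 2 ≤ Fintype.card I * r ^ 2 := by
  rw [← Finset.sum_div, Finset.sum_add_distrib, ← Finset.sum_div]
  have h1 : (∑ i, x i) / r ^ 2 ≤ Fintype.card I * r ^ 2 := by
    rw [div_le_iff₀ (by positivity)]
    linarith
  simp only [Finset.sum_const, Finset.card_univ, nsmul_eq_mul]
  linarith

/-- The assumptions on the sample size and on the parameters under which the uniform laws hold. -/
structure Ample (m ℓ : ℕ) (ε δ N : ℝ) : Prop where
  hm : 1 ≤ m
  hℓ : 1 ≤ ℓ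
  hε : 0 < ε
  hε2 : ε < 1 / 2
  hδ : 0 < δ
  hδ1 : δ < 1
  hN : 30000 * ((m + 1) * ((ℓ : ℝ) * m + 1) ^ 2 * Real.log (netRatio m ℓ ε) ^ 2)
      * Real.log (2 / δ) ≤ ε ^ 2 * N

theorem prob_not_uniformBound_covDev_le [DecidableEq I] [Nonempty I] (hk : 1 ≤ k) (hμ : ∀ i, IsProb (μ i))
    (h : Ample m ℓ ε δ (Fintype.card I)) :
    prob (piW fun i => piW fun _ : Fin k => μ i)
      (fun y => ¬ UniformBound m ℓ ε fun i => covDev k (μ i) (freq (y i))) ≤ δ / 4 := by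
  have hr := lightRoot_pos (m := m) (ℓ := ℓ) h.hε
  have hq := sum_refMass (v := fun _ _ => 0) hμ (by simp)
  have hw1 : ∀ i a, waveMass m (μ i) a ≤ 1 := fun i a =>
    (waveMass_le_sum (hμ i).nonneg a).trans_eq (hμ i).sum_one
  refine prob_not_uniformBound_le (fun i => isProb_piW fun _ => hμ i)
    (fun i y => covDev k (μ i) (freq y)) h.hm h.hℓ h.hε h.hε2 h.hδ h.hδ1
    (refMass_nonneg (v := fun _ _ => 0) hμ) hq.1 hq.2
    (fun i Δ hΔ t ht => expect_exp_covDev_le hk (hμ i) hΔ ht) (fun a b hab => ?_) h.hN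
  rcases not_and_or.1 hab with ha | hb
  · refine le_trans (Finset.sum_le_sum fun i _ => ?_)
      (sum_mass_div_add_le hr (sum_waveMass_le hμ ha).1)
    refine (expect_abs_covDev_le hk (hμ i) a b (pow_pos hr 2)).trans ?_
    have := mul_le_mul_of_nonneg_left (hw1 i b) (pow_pos hr 2).le
    linarith
  · refine le_trans (Finset.sum_le_sum fun i _ => ?_)
      (sum_mass_div_add_le hr (sum_waveMass_le hμ hb).1)
    refine (expect_abs_covDev_le hk (hμ i) a b (inv_pos.2 (pow_pos hr 2))).trans ?_
    have := mul_le_mul_of_nonneg_left (hw1 i a) (pow_pos hr 2).le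
    rw [div_inv_eq_mul, ← div_eq_inv_mul]
    linarith

theorem prob_not_uniformBound_diagDev_le [DecidableEq I] [Nonempty I] (hk : 1 ≤ k) (hμ : ∀ i, IsProb (μ i))
    (h : Ample m ℓ ε δ (Fintype.card I)) :
    prob (piW fun i => piW fun _ : Fin k => μ i)
      (fun y => ¬ UniformBound m ℓ ε fun i => diagDev (μ i) (freq (y i))) ≤ δ / 4 := by
  have hr := lightRoot_pos (m := m) (ℓ := ℓ) h.hε
  have hq := sum_refMass (v := fun _ _ => 0) hμ (by simp)
  refine prob_not_uniformBound_le (fun i => isProb_piW fun _ => hμ i)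
    (fun i y => diagDev (μ i) (freq y)) h.hm h.hℓ h.hε h.hε2 h.hδ h.hδ1
    (refMass_nonneg (v := fun _ _ => 0) hμ) hq.1 hq.2
    (fun i Δ hΔ t _ => expect_exp_diagDev_le hk (hμ i) hΔ t) (fun a b hab => ?_) h.hN
  rcases not_and_or.1 hab with ha | hb
  · exact le_trans (Finset.sum_le_sum fun i _ =>
      expect_abs_diagDev_le hk (hμ i) a b (Or.inl rfl) (pow_pos hr 2))
      (sum_mass_div_add_le hr (sum_waveMass_le hμ ha).1)
  · exact le_trans (Finset.sum_le_sum fun i _ =>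
      expect_abs_diagDev_le hk (hμ i) a b (Or.inr rfl) (pow_pos hr 2))
      (sum_mass_div_add_le hr (sum_waveMass_le hμ hb).1)

theorem prob_not_uniformBound_crossDev_le [DecidableEq I] [Nonempty I] (hk : 1 ≤ k) (hμ : ∀ i, IsProb (μ i))
    (hv : ∀ i, ∑ x, |v i x| ≤ 4) (h : Ample m ℓ ε δ (Fintype.card I)) :
    prob (piW fun i => piW fun _ : Fin k => μ i)
      (fun y => ¬ UniformBound m ℓ ε fun i => crossDev k (v i) (μ i) (freq (y i))) ≤ δ / 4 := by
  have hr := lightRoot_pos (m := m) (ℓ := ℓ) h.hε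
  have hr1 := lightRoot_le_one h.hm h.hℓ h.hε2
  have hq := sum_refMass hμ hv
  have hw1 : ∀ i a, waveMass m (μ i) a ≤ 1 := fun i a =>
    (waveMass_le_sum (hμ i).nonneg a).trans_eq (hμ i).sum_one
  refine prob_not_uniformBound_le (fun i => isProb_piW fun _ => hμ i)
    (fun i y => crossDev k (v i) (μ i) (freq y)) h.hm h.hℓ h.hε h.hε2 h.hδ h.hδ1
    (refMass_nonneg hμ) hq.1 hq.2
    (fun i Δ hΔ t _ => expect_exp_crossDev_le hk (hμ i) hΔ (hv i) t) (fun a b hab => ?_) h.hN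
  have hN : (0 : ℝ) ≤ Fintype.card I := Nat.cast_nonneg _
  rcases not_and_or.1 hab with ha | hb
  · calc _ ≤ ∑ i, waveMass m (fun x => |v i x|) a := Finset.sum_le_sum fun i _ => by
          refine (expect_abs_crossDev_le hk (hμ i) (v i) a b one_pos).trans ?_
          have h1 := waveMass_nonneg (fun x => abs_nonneg (v i x)) a
          nlinarith [hw1 i b]
      _ ≤ Fintype.card I * lightRoot m ℓ ε ^ 4 := (sum_waveMass_le hμ ha).2
      _ ≤ _ := mul_le_mul_of_nonneg_left (pow_le_pow_of_le_one hr.le hr1 (by norm_num)) hN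
  · refine le_trans (Finset.sum_le_sum fun i _ => ?_)
      (sum_mass_div_add_le hr (sum_waveMass_le hμ hb).1)
    refine (expect_abs_crossDev_le hk (hμ i) (v i) a b (pow_pos hr 2)).trans ?_
    have h1 := (waveMass_le_sum (fun x => abs_nonneg (v i x)) a).trans (hv i)
    have h2 : 0 ≤ (waveMass m (μ i) b / lightRoot m ℓ ε ^ 2 + lightRoot m ℓ ε ^ 2) / 2 := by
      have := waveMass_nonneg (hμ i).nonneg b
      positivity
    exact mul_le_of_le_one_left h2 (by linarith)

end batches

/-! ### The mean of all batches -/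

section mean

variable {m ℓ k : ℕ}

/-- The normalized sum of the tensor squares of all wavelet patterns. -/
noncomputable def waveSquare (m : ℕ) : Matrix (Fin (2 ^ m)) (Fin (2 ^ m)) ℝ :=
  fun x y => ∑ a, (1 / ((m : ℝ) + 1)) * wavePair m a a x y

lemma abs_waveSquare_le (x y : Fin (2 ^ m)) : |waveSquare m x y| ≤ 1 := by
  have hm : (0 : ℝ) < (m : ℝ) + 1 := by positivity
  calc |waveSquare m x y| ≤ ∑ a, (1 / ((m : ℝ) + 1)) * |haarSign m a x| := by
        refine (Finset.abs_sum_le_sum_abs _ _).trans (Finset.sum_le_sum fun a _ => ?_)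
        rw [abs_mul, abs_of_pos (by positivity), wavePair, abs_mul]
        exact mul_le_mul_of_nonneg_left
          (mul_le_of_le_one_right (abs_nonneg _) (abs_haarSign_le a y)) (by positivity)
    _ = 1 := by rw [← Finset.mul_sum, sum_abs_haarSign]; field_simp

lemma bilin_waveSquare (f : Fin (2 ^ m) → ℝ) :
    ((m : ℝ) + 1) * (f ⬝ᵥ (waveSquare m).mulVec f) = ∑ a, (f ⬝ᵥ haarSign m a) ^ 2 := by
  have hm : ((m : ℝ) + 1) ≠ 0 := by positivity
  have h : matInner (Matrix.vecMulVec f f) (waveSquare m)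
      = ∑ a, 1 / ((m : ℝ) + 1) * matInner (Matrix.vecMulVec f f) (wavePair m a a) :=
    matInner_sum _ _ _ _
  rw [← matInner_vecMulVec, h, ← Finset.mul_sum, ← mul_assoc, mul_one_div_cancel hm, one_mul]
  exact Finset.sum_congr rfl fun a _ => by rw [matInner_vecMulVec, bilin_wavePair, sq]

/-- The quadratic form of a test matrix is bounded through the Frobenius norm of its weighted Haar
transform. -/
lemma IsTest.bilin_le {S : Matrix (Fin (2 ^ m)) (Fin (2 ^ m)) ℝ} (hS : IsTest m ℓ S)
    (f : Fin (2 ^ m) → ℝ) :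
    f ⬝ᵥ S.mulVec f
      ≤ ((ℓ : ℝ) * m + 1) * (((m : ℝ) + 1) * (f ⬝ᵥ (waveSquare m).mulVec f)) := by
  rw [bilin_waveSquare, ← matInner_vecMulVec, matInner_eq_sum_wavePair]
  simp only [matInner_vecMulVec, bilin_wavePair]
  set c : HaarIdx m → ℝ := fun a => f ⬝ᵥ haarSign m a
  have h0 : 0 ≤ ∑ a, c a ^ 2 := Finset.sum_nonneg fun a _ => sq_nonneg _
  refine abs_le_of_sq_le_sq' ?_ (by positivity) |>.2
  have h := Finset.sum_mul_sq_le_sq_mul_sq (Finset.univ : Finset (HaarIdx m × HaarIdx m))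
    (fun α => weightedHaar m S α.1 α.2) (fun α => c α.1 * c α.2)
  simp only [Fintype.sum_prod_type] at h
  refine h.trans ?_
  have h2 : ∑ a, ∑ b, (c a * c b) ^ 2 = (∑ a, c a ^ 2) ^ 2 := by
    rw [sq (∑ a, c a ^ 2), Finset.sum_mul_sum]
    simp only [mul_pow]
  rw [h2, mul_pow]
  exact mul_le_mul_of_nonneg_right hS.haar_frobenius_le (sq_nonneg _)

variable {I : Type*} [Fintype I] [DecidableEq I] {μ : I → Fin (2 ^ m) → ℝ} {ε δ : ℝ}

lemma expect_piW_curry {α : Type*} [Fintype α] (p : I → Fin k → α → ℝ)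
    (f : (I → Fin k → α) → ℝ) :
    expect (piW fun i => piW (p i)) f
      = expect (piW fun j : I × Fin k => p j.1 j.2) (fun z => f fun i j => z (i, j)) := by
  unfold expect
  rw [← Equiv.sum_comp (Equiv.curry I (Fin k) α)]
  refine Finset.sum_congr rfl fun z _ => ?_
  have : piW (fun i => piW (p i)) (Equiv.curry I (Fin k) α z)
      = piW (fun j : I × Fin k => p j.1 j.2) z := by
    simp only [piW, Fintype.prod_prod_type]
    rfl
  rw [this]
  rfl

/-- The deviation of the mean of all batches. -/
noncomputable def meanDev (μ X : I → Fin (2 ^ m) → ℝ) : Fin (2 ^ m) → ℝ :=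
  (1 / (Fintype.card I : ℝ)) • ∑ i, (X i - μ i)

theorem prob_not_mean_le [Nonempty I] (hk : 1 ≤ k) (hμ : ∀ i, IsProb (μ i))
    (h : Ample m ℓ ε δ (Fintype.card I)) :
    prob (piW fun i => piW fun _ : Fin k => μ i)
      (fun y => ¬ ∀ S, IsTest m ℓ S → k * (meanDev μ (fun i => freq (y i)) ⬝ᵥ
        S.mulVec (meanDev μ fun i => freq (y i))) ≤ ε ^ 2) ≤ δ / 4 := by
  have hk0 : (0 : ℝ) < k := by positivity
  have hN : (0 : ℝ) < Fintype.card I := by exact_mod_cast Fintype.card_pos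
  have : Nonempty (Fin k) := ⟨⟨0, hk⟩⟩
  have hP : IsProb (piW fun i => piW fun _ : Fin k => μ i) :=
    isProb_piW fun i => isProb_piW fun _ => hμ i
  set p : I × Fin k → Fin (2 ^ m) → ℝ := fun j => μ j.1 with hp
  have hpp : ∀ j, IsProb (p j) := fun j => hμ j.1
  set Q : (I → Fin k → Fin (2 ^ m)) → ℝ := fun y => k * Fintype.card I *
    (meanDev μ (fun i => freq (y i)) ⬝ᵥ (waveSquare m).mulVec (meanDev μ fun i => freq (y i)))
    with hQ
  have hQz : ∀ z : I × Fin k → Fin (2 ^ m),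
      Q (fun i j => z (i, j)) = quadForm p (waveSquare m) z := by
    intro z
    have h1 : drawSum p z = ((k : ℝ) * Fintype.card I) •
        meanDev μ (fun i => freq fun j => z (i, j)) := by
      rw [meanDev, smul_smul, mul_assoc, mul_one_div_cancel hN.ne', mul_one, Finset.smul_sum,
        drawSum, Fintype.sum_prod_type]
      exact Finset.sum_congr rfl fun i _ => drawSum_eq_freq hk (μ i) fun j => z (i, j)
    rw [quadForm, h1, Matrix.mulVec_smul, smul_dotProduct, dotProduct_smul]
    simp only [hQ, smul_eq_mul, Fintype.card_prod, Fintype.card_fin]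
    push_cast
    field_simp
  set E := expect (piW p) (quadForm p (waveSquare m)) with hE
  have hE4 : E ≤ 4 := (le_abs_self _).trans (abs_expect_quadForm_le hpp abs_waveSquare_le)
  have hmgf : expect (piW fun i => piW fun _ : Fin k => μ i)
      (fun y => Real.exp (1 / 16 * (Q y - E))) ≤ Real.exp (3 / 4) := by
    rw [expect_piW_curry (fun i _ => μ i)]
    simp only [hQz]
    refine (expect_exp_quadForm_le hpp abs_waveSquare_le (t := 1 / 16)
      (by rw [abs_of_pos (by norm_num)])).trans (Real.exp_le_exp.2 (by norm_num))
  set lam := Real.log (2 / δ) with hlam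
  have hl2 := Real.log_two_gt_d9
  have hδ := h.hδ
  have hlam1 : Real.log 2 ≤ lam := by
    refine Real.log_le_log (by norm_num) ?_
    rw [le_div_iff₀ hδ]; linarith [h.hδ1]
  have hs := four_le_haarBound h.hm h.hℓ
  have hlog := two_le_log (eight_le_netRatio h.hm h.hℓ h.hε h.hε2)
  calc _ ≤ prob (piW fun i => piW fun _ : Fin k => μ i) (fun y => 60 * lam ≤ Q y) := by
        refine hP.prob_mono fun y hy => ?_
        by_contra hcon
        push Not at hcon
        refine hy fun S hS => ?_
        have h1 := hS.bilin_le (meanDev μ fun i => freq (y i))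
        set b := meanDev μ (fun i => freq (y i)) ⬝ᵥ
          (waveSquare m).mulVec (meanDev μ fun i => freq (y i)) with hb
        set w : ℝ := (ℓ : ℝ) * m + 1 with hw
        have hw1 : 2 ≤ w := by nlinarith [show 0 ≤ w by positivity]
        have hlN := h.hN
        rw [← hlam] at hlN
        have h2 : Q y = k * Fintype.card I * b := rfl
        rw [h2] at hcon
        have hlg : (1 : ℝ) ≤ Real.log (netRatio m ℓ ε) ^ 2 := one_le_pow₀ (by linarith)
        have hA : 0 < ((m : ℝ) + 1) * w := by positivity
        have h3 : ((m : ℝ) + 1) * w * (60 * lam) ≤ ε ^ 2 * Fintype.card I := by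
          refine le_trans ?_ hlN
          have hl0 : 0 < lam := by linarith
          have h5 : ((m : ℝ) + 1) * w ≤ ((m : ℝ) + 1) * w ^ 2 * Real.log (netRatio m ℓ ε) ^ 2 := by
            calc ((m : ℝ) + 1) * w ≤ ((m : ℝ) + 1) * w ^ 2 * 1 := by nlinarith
              _ ≤ _ := mul_le_mul_of_nonneg_left hlg (by positivity)
          have := mul_le_mul_of_nonneg_right h5 hl0.le
          have h6 : 0 < ((m : ℝ) + 1) * w * lam := by positivity
          linarith
        have h4 : ((m : ℝ) + 1) * w * (k * Fintype.card I * b) ≤ ε ^ 2 * Fintype.card I :=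
          (mul_le_mul_of_nonneg_left hcon.le hA.le).trans h3
        have h7 := mul_le_mul_of_nonneg_left h1 hk0.le
        refine h7.trans (le_of_mul_le_mul_right ?_ hN)
        linarith
    _ ≤ expect (piW fun i => piW fun _ : Fin k => μ i)
          (fun y => Real.exp (1 / 16 * (Q y - E)) * Real.exp (-(1 / 16 * (60 * lam - 4)))) := by
        refine hP.prob_le_expect (fun y => by positivity) fun y hy => ?_
        rw [← Real.exp_add]
        exact Real.one_le_exp (by linarith)
    _ ≤ Real.exp (3 / 4) * Real.exp (-(1 / 16 * (60 * lam - 4))) := by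
        rw [expect_mul_const]
        exact mul_le_mul_of_nonneg_right hmgf (Real.exp_pos _).le
    _ ≤ Real.exp (-(Real.log 2 + lam)) := by
        rw [← Real.exp_add]
        refine Real.exp_le_exp.2 ?_
        linarith
    _ = δ / 4 := by
        rw [hlam, ← Real.log_mul (by norm_num) (by positivity), Real.exp_neg,
          Real.exp_log (by positivity)]
        field_simp
        norm_num

end mean

/-! ### Regularity from the uniform laws -/

section tests

variable {m ℓ : ℕ} {S : Matrix (Fin (2 ^ m)) (Fin (2 ^ m)) ℝ}

lemma normK_le {M : Matrix (Fin (2 ^ m)) (Fin (2 ^ m)) ℝ} {b : ℝ} (hb : 0 ≤ b)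
    (h : ∀ S, IsTest m ℓ S → |matInner M S| ≤ b) : normK m ℓ M ≤ b := by
  refine Real.sSup_le ?_ hb
  rintro r ⟨S, hS, rfl⟩
  exact h S hS

lemma IsTest.bilin_nonneg (hS : IsTest m ℓ S) (f : Fin (2 ^ m) → ℝ) : 0 ≤ f ⬝ᵥ S.mulVec f := by
  have := hS.posSemidef.dotProduct_mulVec_nonneg f
  simpa using this

lemma IsTest.bilin_comm (hS : IsTest m ℓ S) (f g : Fin (2 ^ m) → ℝ) :
    f ⬝ᵥ S.mulVec g = g ⬝ᵥ S.mulVec f := by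
  have h : S.transpose = S := by
    have := hS.posSemidef.isHermitian
    rwa [Matrix.IsHermitian, Matrix.conjTranspose_eq_transpose_of_trivial] at this
  rw [← bilin_transpose S f g, h]

lemma IsTest.two_abs_bilin_le (hS : IsTest m ℓ S) (f g : Fin (2 ^ m) → ℝ) {r : ℝ} (hr : 0 < r) :
    2 * |f ⬝ᵥ S.mulVec g| ≤ r * (f ⬝ᵥ S.mulVec f) + (g ⬝ᵥ S.mulVec g) / r := by
  have h1 := hS.bilin_nonneg (r • f - g)
  have h2 := hS.bilin_nonneg (r • f + g)
  have hc := hS.bilin_comm g f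
  simp only [Matrix.mulVec_sub, Matrix.mulVec_add, Matrix.mulVec_smul, dotProduct_sub,
    dotProduct_add, sub_dotProduct, add_dotProduct, smul_dotProduct, dotProduct_smul, smul_eq_mul,
    hc] at h1 h2
  have h3 : r * (f ⬝ᵥ S.mulVec f) + (g ⬝ᵥ S.mulVec g) / r
      = (r * (r * (f ⬝ᵥ S.mulVec f)) + g ⬝ᵥ S.mulVec g) / r := by
    field_simp
  rw [h3, le_div_iff₀ hr]
  rcases abs_cases (f ⬝ᵥ S.mulVec g) with ⟨h, _⟩ | ⟨h, _⟩ <;> rw [h] <;> nlinarith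

lemma IsTest.bilin_self_le (hS : IsTest m ℓ S) {f : Fin (2 ^ m) → ℝ} {c : ℝ}
    (hf : ∑ x, |f x| ≤ c) : f ⬝ᵥ S.mulVec f ≤ c ^ 2 := by
  have h0 : 0 ≤ ∑ x, |f x| := Finset.sum_nonneg fun x _ => abs_nonneg _
  refine (le_abs_self _).trans ((abs_bilin_le hS.max_le f f).trans ?_)
  nlinarith

variable {ι : Type*}

lemma avg_eq_smul {n : ℕ} (V : Finset ι) (v : ι → Fin n → ℝ) :
    avg V v = (1 / (V.card : ℝ)) • ∑ i ∈ V, v i := by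
  funext a
  simp [avg]

/-- Jensen's inequality for the quadratic form of a test matrix, with the exact remainder. -/
lemma bilin_avg (hS : IsTest m ℓ S) {V : Finset ι} (hV : V.Nonempty) (v : ι → Fin (2 ^ m) → ℝ) :
    (1 / (V.card : ℝ)) * ∑ i ∈ V, v i ⬝ᵥ S.mulVec (v i)
      = avg V v ⬝ᵥ S.mulVec (avg V v)
        + (1 / (V.card : ℝ)) * ∑ i ∈ V, (v i - avg V v) ⬝ᵥ S.mulVec (v i - avg V v) := by
  have hN : (V.card : ℝ) ≠ 0 := by exact_mod_cast hV.card_pos.ne'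
  set u := avg V v with hu
  have hsum : ∑ i ∈ V, v i = (V.card : ℝ) • u := by
    rw [hu, avg_eq_smul, smul_smul, mul_one_div_cancel hN, one_smul]
  have h1 : ∀ i, (v i - u) ⬝ᵥ S.mulVec (v i - u)
      = v i ⬝ᵥ S.mulVec (v i) - 2 * (v i ⬝ᵥ S.mulVec u) + u ⬝ᵥ S.mulVec u := by
    intro i
    simp only [Matrix.mulVec_sub, dotProduct_sub, sub_dotProduct, hS.bilin_comm u (v i)]
    ring
  simp only [h1]
  rw [Finset.sum_add_distrib, Finset.sum_sub_distrib, ← Finset.mul_sum, ← sum_dotProduct, hsum,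
    smul_dotProduct, Finset.sum_const, nsmul_eq_mul, smul_eq_mul]
  field_simp
  ring

end tests

/-! ### Good samples on the regular event -/

section regular

variable {m ℓ k : ℕ} {ι : Type*} {ε ω : ℝ} {U : Finset ι} {μ X : ι → Fin (2 ^ m) → ℝ}

/-- The event on which the batches `X i` behave regularly. -/
structure Regular (m ℓ k : ℕ) (ε ω : ℝ) (U : Finset ι) (μ X : ι → Fin (2 ^ m) → ℝ) : Prop where
  one_le : 1 ≤ k
  pos : 0 < ε
  lt_half : ε < 1 / 2
  nonneg : 0 ≤ ω
  two_le : 2 ≤ ε * U.card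
  isProb_mean : ∀ i ∈ U, IsProb (μ i)
  isProb_sample : ∀ i ∈ U, IsProb (X i)
  near : ∀ i ∈ U, ∑ x, |(μ i - avg U μ) x| ≤ 4 * ω
  cov : UniformBound m ℓ ε fun i : U => covDev k (μ i) (X i)
  diag : UniformBound m ℓ ε fun i : U => diagDev (μ i) (X i)
  cross : UniformBound m ℓ ε fun i : U =>
    crossDev k ((1 / ω) • (μ i - avg U μ)) (μ i) (X i)
  mean : ∀ S, IsTest m ℓ S → k * (meanDev (fun i : U => μ i) (fun i : U => X i) ⬝ᵥ
    S.mulVec (meanDev (fun i : U => μ i) fun i : U => X i)) ≤ ε ^ 2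

variable {S : Matrix (Fin (2 ^ m)) (Fin (2 ^ m)) ℝ}

lemma log_inv_ge (hε : 0 < ε) (hε2 : ε < 1 / 2) : 0.69 ≤ Real.log (1 / ε) := by
  have h := Real.log_two_gt_d9
  have : Real.log 2 ≤ Real.log (1 / ε) := by
    refine Real.log_le_log (by norm_num) ?_
    rw [le_div_iff₀ hε]; linarith
  linarith

lemma meanDev_eq (U : Finset ι) (μ X : ι → Fin (2 ^ m) → ℝ) :
    meanDev (fun i : U => μ i) (fun i : U => X i) = avg U X - avg U μ := by
  rw [meanDev, avg_eq_smul, avg_eq_smul, ← smul_sub, ← Finset.sum_sub_distrib, Fintype.card_coe,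
    Finset.sum_coe_sort U fun i => X i - μ i]

lemma isProb_avg (hU : U.Nonempty) (h : ∀ i ∈ U, IsProb (μ i)) : IsProb (avg U μ) where
  nonneg x := mul_nonneg (by positivity) (Finset.sum_nonneg fun i hi => (h i hi).nonneg x)
  sum_one := by
    have hN : (U.card : ℝ) ≠ 0 := by exact_mod_cast hU.card_pos.ne'
    simp only [avg]
    rw [← Finset.mul_sum, Finset.sum_comm, Finset.sum_congr rfl fun i hi => (h i hi).sum_one]
    simp [hN]

lemma Regular.sum_le (_ : Regular m ℓ k ε ω U μ X) (A : ι → Matrix (Fin (2 ^ m)) (Fin (2 ^ m)) ℝ)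
    (hA : UniformBound m ℓ ε fun i : U => A i) (hS : IsTest m ℓ S) :
    |∑ i ∈ U, matInner (A i) S| ≤ 4 * ε * U.card ∧
      ∑ i ∈ U, max (|matInner (A i) S| - 2 * Real.log (1 / ε)) 0 ≤ 16 * ε * U.card := by
  have := hA S hS
  rwa [Finset.sum_coe_sort U fun i => matInner (A i) S,
    Finset.sum_coe_sort U fun i => max (|matInner (A i) S| - 2 * Real.log (1 / ε)) 0,
    Fintype.card_coe] at this

lemma Regular.card_pos (h : Regular m ℓ k ε ω U μ X) : (0 : ℝ) < U.card := by
  by_contra hcon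
  have := h.two_le
  have h0 := h.pos
  nlinarith

/-- The linear functional of the matrix of a single batch, in terms of the deviation. -/
lemma bilin_sample (hk : 1 ≤ k) (x p : Fin (2 ^ m) → ℝ) :
    (x - p) ⬝ᵥ S.mulVec (x - p)
      = 1 / k * (16 * matInner (covDev k p x) S + k * matInner (matB k p) S) := by
  have hk0 : (k : ℝ) ≠ 0 := by positivity
  rw [covDev, matInner_smul, matInner_sub, matInner_vecMulVec]
  field_simp
  ring

lemma k_mul_matInner_matB_le (hk : 1 ≤ k) {p : Fin (2 ^ m) → ℝ} (hp : IsProb p)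
    (hS : IsTest m ℓ S) : k * matInner (matB k p) S ≤ 4 := by
  have hk0 : (k : ℝ) ≠ 0 := by positivity
  have : Nonempty (Fin k) := ⟨⟨0, hk⟩⟩
  have h := abs_expect_quadForm_le (J := Fin k) (p := fun _ => p) (fun _ => hp) hS.max_le
  have h2 : quadForm (fun _ : Fin k => p) S
      = fun y => (k : ℝ) * ((freq y - p) ⬝ᵥ S.mulVec (freq y - p)) := by
    funext y; exact quadForm_eq_freq hk p S y
  rw [matInner_matB hp, ← expect_const_mul, ← h2]
  exact (le_abs_self _).trans h

lemma Regular.card_part_ge (h : Regular m ℓ k ε ω U μ X) {W : Finset ι} (hW : IsFraction ε U W) :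
    ε * U.card / 2 ≤ (W.card : ℝ) := by
  have h1 := Nat.lt_floor_add_one (ε * (U.card : ℝ))
  have h2 : ((⌊ε * (U.card : ℝ)⌋₊ : ℕ) : ℝ) ≤ W.card := by exact_mod_cast hW.2.1
  have := h.two_le
  linarith

/-- A small part of the sample has an average which exceeds `2 log (1 / ε)` only by a constant,
since the excesses over the whole sample sum to `O(ε |U|)`. -/
lemma Regular.avg_part_le (h : Regular m ℓ k ε ω U μ X) {W : Finset ι} (hW : IsFraction ε U W)
    (hS : IsTest m ℓ S) :
    (1 / (W.card : ℝ)) * ∑ i ∈ W, (X i - μ i) ⬝ᵥ S.mulVec (X i - μ i)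
      ≤ 800 * Real.log (1 / ε) / k := by
  have hk0 : (0 : ℝ) < k := by have := h.one_le; positivity
  have hε := h.pos
  have hNW := h.card_part_ge hW
  have hN := h.card_pos
  have hW0 : (0 : ℝ) < W.card := lt_of_lt_of_le (by positivity) hNW
  have hlg := log_inv_ge h.pos h.lt_half
  set lg := Real.log (1 / ε) with hlgdef
  have h1 : ∀ i ∈ W, (X i - μ i) ⬝ᵥ S.mulVec (X i - μ i)
      ≤ 1 / k * (16 * (max (|matInner (covDev k (μ i) (X i)) S| - 2 * lg) 0 + 2 * lg) + 4) := by
    intro i hi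
    rw [bilin_sample h.one_le]
    refine mul_le_mul_of_nonneg_left ?_ (by positivity)
    have h2 := k_mul_matInner_matB_le h.one_le (h.isProb_mean i (hW.1 hi)) hS
    have h3 := le_max_left (|matInner (covDev k (μ i) (X i)) S| - 2 * lg) 0
    have h4 := le_abs_self (matInner (covDev k (μ i) (X i)) S)
    linarith
  have h2 : ∑ i ∈ W, max (|matInner (covDev k (μ i) (X i)) S| - 2 * lg) 0
      ≤ 32 * W.card := by
    refine (Finset.sum_le_sum_of_subset_of_nonneg hW.1 fun _ _ _ => le_max_right _ _).trans
      ((h.sum_le (fun i => covDev k (μ i) (X i)) h.cov hS).2.trans ?_)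
    linarith
  rw [one_div, inv_mul_le_iff₀ hW0]
  calc _ ≤ _ := Finset.sum_le_sum h1
    _ = 1 / k * (16 * ∑ i ∈ W, max (|matInner (covDev k (μ i) (X i)) S| - 2 * lg) 0
        + (32 * lg + 4) * W.card) := by
        rw [← Finset.mul_sum]
        congr 1
        rw [Finset.sum_add_distrib, ← Finset.mul_sum, Finset.sum_add_distrib]
        simp only [Finset.sum_const, nsmul_eq_mul]
        ring
    _ ≤ 1 / k * (16 * (32 * W.card) + (32 * lg + 4) * W.card) := by gcongr
    _ ≤ _ := by
        rw [one_div, inv_mul_le_iff₀ hk0]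
        have : (k : ℝ) * (W.card * (800 * lg / k)) = 800 * lg * W.card := by field_simp
        rw [this]
        nlinarith

lemma matInner_matA (V : Finset ι) :
    matInner (matA V X μ) S
      = (1 / (V.card : ℝ)) * ∑ i ∈ V, (X i - μ i) ⬝ᵥ S.mulVec (X i - μ i) := by
  rw [matA, matInner_smul, matInner_sum_left]
  simp only [matInner_vecMulVec]

lemma avg_sub (V : Finset ι) : avg V X - avg V μ = avg V fun i => X i - μ i := by
  rw [avg_eq_smul, avg_eq_smul, avg_eq_smul, ← smul_sub, ← Finset.sum_sub_distrib]

lemma vecNormK_le {v : Fin (2 ^ m) → ℝ} {b : ℝ} (hb : 0 ≤ b)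
    (h : ∀ S, IsTest m ℓ S → v ⬝ᵥ S.mulVec v ≤ b ^ 2) : vecNormK m ℓ v ≤ b := by
  refine Real.sqrt_le_iff.2 ⟨hb, normK_le (sq_nonneg b) fun S hS => ?_⟩
  rw [matInner_vecMulVec, abs_of_nonneg (hS.bilin_nonneg v)]
  exact h S hS

lemma Regular.mean_bilin_le (h : Regular m ℓ k ε ω U μ X) (hS : IsTest m ℓ S) :
    (avg U X - avg U μ) ⬝ᵥ S.mulVec (avg U X - avg U μ) ≤ ε ^ 2 / k := by
  have hk0 : (0 : ℝ) < k := by have := h.one_le; positivity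
  have := h.mean S hS
  rw [meanDev_eq] at this
  rw [le_div_iff₀ hk0]
  linarith

lemma Regular.matInner_matM_le (h : Regular m ℓ k ε ω U μ X) (hS : IsTest m ℓ S) :
    |matInner (matM k U X μ) S| ≤ 64 * ε / k := by
  have hk0 : (0 : ℝ) < k := by have := h.one_le; positivity
  have hN := h.card_pos
  have h1 := (h.sum_le (fun i => covDev k (μ i) (X i)) h.cov hS).1
  have h2 : matInner (matM k U X μ) S
      = 16 / (k * U.card) * ∑ i ∈ U, matInner (covDev k (μ i) (X i)) S := by
    rw [matM, matInner_sub, matInner_matA, matBs, matInner_smul, matInner_sum_left, ← mul_sub,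
      ← Finset.sum_sub_distrib, Finset.mul_sum, Finset.mul_sum]
    refine Finset.sum_congr rfl fun i _ => ?_
    rw [bilin_sample h.one_le]
    field_simp
    ring
  rw [h2, abs_mul, abs_of_pos (by positivity)]
  refine (mul_le_mul_of_nonneg_left h1 (by positivity)).trans_eq ?_
  field_simp
  ring

lemma Regular.matInner_proxy_le (h : Regular m ℓ k ε ω U μ X) (hS : IsTest m ℓ S) :
    |matInner (matB k (avg U X) - matBs k U μ) S| ≤ (16 * ω ^ 2 + 12 * ε) / k := by
  have hk1 : (1 : ℝ) ≤ k := by exact_mod_cast h.one_le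
  have hk0 : (0 : ℝ) < k := by linarith
  have hN := h.card_pos
  have hε := h.pos
  have hε2 := h.lt_half
  have hU : U.Nonempty := Finset.card_pos.1 (by exact_mod_cast hN)
  set v := avg U X - avg U μ with hv
  set c := avg U μ with hc
  have hcp : IsProb c := isProb_avg hU h.isProb_mean
  set R := (1 / (U.card : ℝ)) * ∑ i ∈ U, (μ i - c) ⬝ᵥ S.mulVec (μ i - c) with hR
  set d := v ⬝ᵥ fun x => S x x with hd
  -- the identity
  have hid : matInner (matB k (avg U X) - matBs k U μ) S
      = 1 / k * (d - 2 * (v ⬝ᵥ S.mulVec c) - v ⬝ᵥ S.mulVec v + R) := by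
    have hXv : avg U X = c + v := by rw [hv]; abel
    have h1 : matInner (matB k (avg U X)) S
        = 1 / k * ((c + v) ⬝ᵥ (fun x => S x x) - (c + v) ⬝ᵥ S.mulVec (c + v)) := by
      rw [matB_eq h.one_le (isProb_avg hU h.isProb_sample), matInner_smul, matInner_sub,
        matInner_diagonal, matInner_vecMulVec, hXv]
    have h2 : matInner (matBs k U μ) S = 1 / k * (c ⬝ᵥ (fun x => S x x)
        - (c ⬝ᵥ S.mulVec c + R)) := by
      rw [hR, hc, ← bilin_avg hS hU, avg_eq_smul, smul_dotProduct, sum_dotProduct, matBs,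
        matInner_smul, matInner_sum_left, smul_eq_mul, ← mul_sub, ← Finset.sum_sub_distrib,
        Finset.mul_sum, Finset.mul_sum, Finset.mul_sum]
      refine Finset.sum_congr rfl fun i hi => ?_
      rw [matB_eq h.one_le (h.isProb_mean i hi), matInner_smul, matInner_sub, matInner_diagonal,
        matInner_vecMulVec]
      ring
    rw [matInner_sub, h1, h2]
    simp only [Matrix.mulVec_add, dotProduct_add, add_dotProduct, hS.bilin_comm c v]
    ring
  -- the four terms
  have e1 : |d| ≤ 8 * ε := by
    have h1 := (h.sum_le (fun i => diagDev (μ i) (X i)) h.diag hS).1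
    have h2 : ∑ i ∈ U, matInner (diagDev (μ i) (X i)) S = U.card / 2 * d := by
      simp only [matInner_diagDev]
      rw [← Finset.mul_sum, ← sum_dotProduct, hd, hv, avg_sub, avg_eq_smul, smul_dotProduct,
        smul_eq_mul]
      field_simp
    rw [h2, abs_mul, abs_of_pos (by positivity)] at h1
    refine le_of_mul_le_mul_left ?_ hN
    linarith
  have hvv := h.mean_bilin_le hS
  have hvv0 := hS.bilin_nonneg v
  have hvε : v ⬝ᵥ S.mulVec v ≤ ε ^ 2 := hvv.trans (div_le_self (sq_nonneg ε) hk1)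
  have e2 : 2 * |v ⬝ᵥ S.mulVec c| ≤ 2 * ε := by
    have h1 := hS.two_abs_bilin_le v c (inv_pos.2 hε)
    have h2 : c ⬝ᵥ S.mulVec c ≤ 1 ^ 2 := hS.bilin_self_le (by
      rw [Finset.sum_congr rfl fun x _ => abs_of_nonneg (hcp.nonneg x), hcp.sum_one])
    have h3 : ε⁻¹ * (v ⬝ᵥ S.mulVec v) ≤ ε := by
      rw [inv_mul_le_iff₀ hε]; linarith
    rw [div_inv_eq_mul] at h1
    have h4 := mul_le_mul_of_nonneg_right h2 hε.le
    linarith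
  have e3 : v ⬝ᵥ S.mulVec v ≤ ε := by nlinarith
  have hR0 : 0 ≤ R := mul_nonneg (by positivity) (Finset.sum_nonneg fun i _ => hS.bilin_nonneg _)
  have hR1 : R ≤ 16 * ω ^ 2 := by
    rw [hR, one_div, inv_mul_le_iff₀ hN]
    calc _ ≤ ∑ i ∈ U, (4 * ω) ^ 2 :=
          Finset.sum_le_sum fun i hi => hS.bilin_self_le (h.near i hi)
      _ = _ := by rw [Finset.sum_const, nsmul_eq_mul]; ring
  rw [hid, abs_mul, abs_of_pos (by positivity), one_div, inv_mul_le_iff₀ hk0]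
  have : (k : ℝ) * ((16 * ω ^ 2 + 12 * ε) / k) = 16 * ω ^ 2 + 12 * ε := by field_simp
  rw [this]
  have e1' := abs_le.1 e1
  have e2' := abs_le.1 (show |v ⬝ᵥ S.mulVec c| ≤ ε by linarith)
  exact abs_le.2 ⟨by nlinarith [e1'.1, e2'.2], by nlinarith [e1'.2, e2'.1]⟩

lemma Regular.eq_avg_of_eq_zero (h : Regular m ℓ k ε ω U μ X) (hω : ω = 0) {i : ι} (hi : i ∈ U) :
    μ i - avg U μ = 0 := by
  have h1 := h.near i hi
  rw [hω, mul_zero] at h1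
  have h2 := (Finset.sum_eq_zero_iff_of_nonneg fun x _ => abs_nonneg _).1
    (le_antisymm h1 (Finset.sum_nonneg fun x _ => abs_nonneg ((μ i - avg U μ) x)))
  funext x
  exact abs_eq_zero.1 (h2 x (Finset.mem_univ x))

/-- The interaction with the heterogeneity over the whole sample. -/
lemma Regular.heterogeneity_all_le (h : Regular m ℓ k ε ω U μ X) (hS : IsTest m ℓ S) :
    (1 / (U.card : ℝ)) * ∑ i ∈ U, (μ i - avg U μ) ⬝ᵥ S.mulVec (X i - μ i)
      ≤ 32 * (ω * (ε / Real.sqrt k)) := by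
  have hk0 : (0 : ℝ) < k := by have := h.one_le; positivity
  have hsk : 0 < Real.sqrt k := Real.sqrt_pos.2 hk0
  have hN := h.card_pos
  have h1 := (h.sum_le (fun i => crossDev k ((1 / ω) • (μ i - avg U μ)) (μ i) (X i)) h.cross hS).1
  have h2 : ∑ i ∈ U, (μ i - avg U μ) ⬝ᵥ S.mulVec (X i - μ i) = ω * (8 / Real.sqrt k) *
      ∑ i ∈ U, matInner (crossDev k ((1 / ω) • (μ i - avg U μ)) (μ i) (X i)) S := by
    rw [Finset.mul_sum]
    refine Finset.sum_congr rfl fun i hi => ?_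
    rw [matInner_crossDev]
    rcases eq_or_ne ω 0 with h0 | h0
    · rw [h.eq_avg_of_eq_zero h0 hi, h0]; simp
    · rw [smul_dotProduct, smul_eq_mul]
      field_simp
  rw [h2, one_div, inv_mul_le_iff₀ hN]
  have hω := h.nonneg
  refine (mul_le_mul_of_nonneg_left ((le_abs_self _).trans h1) (by positivity)).trans_eq ?_
  field_simp
  ring

/-- The interaction with the heterogeneity over a small part of the sample. -/
lemma Regular.heterogeneity_part_le (h : Regular m ℓ k ε ω U μ X) {W : Finset ι}
    (hW : IsFraction ε U W) (hS : IsTest m ℓ S) :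
    (1 / (W.card : ℝ)) * ∑ i ∈ W, (μ i - avg U μ) ⬝ᵥ S.mulVec (X i - μ i)
      ≤ 500 * (ω * (Real.sqrt (Real.log (1 / ε)) / Real.sqrt k)) := by
  have hk0 : (0 : ℝ) < k := by have := h.one_le; positivity
  have hsk : 0 < Real.sqrt k := Real.sqrt_pos.2 hk0
  have hNW := h.card_part_ge hW
  have hN := h.card_pos
  have hε := h.pos
  have hW0 : (0 : ℝ) < W.card := lt_of_lt_of_le (by positivity) hNW
  have hlg := log_inv_ge h.pos h.lt_half
  have hpart := h.avg_part_le hW hS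
  set lg := Real.log (1 / ε) with hlgdef
  have hsl : 0 < Real.sqrt lg := Real.sqrt_pos.2 (by linarith)
  rcases eq_or_lt_of_le h.nonneg with h0 | h0
  · rw [Finset.sum_eq_zero fun i hi => ?_]
    · rw [← h0]; simp
    · rw [h.eq_avg_of_eq_zero h0.symm (hW.1 hi), zero_dotProduct]
  · set r := Real.sqrt lg / Real.sqrt k / ω with hr
    have hr0 : 0 < r := by positivity
    have h1 : ∀ i ∈ W, (μ i - avg U μ) ⬝ᵥ S.mulVec (X i - μ i)
        ≤ 8 * r * ω ^ 2 + 1 / (2 * r) * ((X i - μ i) ⬝ᵥ S.mulVec (X i - μ i)) := by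
      intro i hi
      have h2 := hS.two_abs_bilin_le (μ i - avg U μ) (X i - μ i) hr0
      have h3 := hS.bilin_self_le (h.near i (hW.1 hi))
      have h4 := le_abs_self ((μ i - avg U μ) ⬝ᵥ S.mulVec (X i - μ i))
      have h5 := mul_le_mul_of_nonneg_left h3 hr0.le
      have h6 : 1 / (2 * r) * ((X i - μ i) ⬝ᵥ S.mulVec (X i - μ i))
          = ((X i - μ i) ⬝ᵥ S.mulVec (X i - μ i)) / r / 2 := by field_simp
      rw [h6]
      linarith
    have h2 : (1 / (W.card : ℝ)) * ∑ i ∈ W, (μ i - avg U μ) ⬝ᵥ S.mulVec (X i - μ i)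
        ≤ 8 * r * ω ^ 2 + 1 / (2 * r) *
          ((1 / (W.card : ℝ)) * ∑ i ∈ W, (X i - μ i) ⬝ᵥ S.mulVec (X i - μ i)) := by
      rw [one_div, inv_mul_le_iff₀ hW0]
      refine (Finset.sum_le_sum h1).trans_eq ?_
      rw [Finset.sum_add_distrib, Finset.sum_const, nsmul_eq_mul, ← Finset.mul_sum]
      generalize ∑ i ∈ W, (X i - μ i) ⬝ᵥ S.mulVec (X i - μ i) = x
      field_simp
    have h3 := mul_le_mul_of_nonneg_left hpart (show 0 ≤ 1 / (2 * r) by positivity)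
    have h4 : 1 / (2 * r) * (800 * lg / k)
        = 400 * (ω * (Real.sqrt lg / Real.sqrt k)) := by
      have e1 : lg = Real.sqrt lg * Real.sqrt lg := (Real.mul_self_sqrt (by linarith)).symm
      have e2 : (k : ℝ) = Real.sqrt k * Real.sqrt k := (Real.mul_self_sqrt hk0.le).symm
      rw [hr]
      generalize Real.sqrt lg = a at *
      generalize Real.sqrt (k : ℝ) = b at *
      rw [e1, e2]
      field_simp
      norm_num
    have h5 : 8 * r * ω ^ 2 = 8 * (ω * (Real.sqrt lg / Real.sqrt k)) := by
      rw [hr]; field_simp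
    have h6 : 0 ≤ ω * (Real.sqrt lg / Real.sqrt k) := by positivity
    linarith

theorem Regular.isGood (h : Regular m ℓ k ε ω U μ X) : IsGood 1000 m ℓ k ε ω U μ X := by
  have hk0 : (0 : ℝ) < k := by have := h.one_le; positivity
  have hsk : 0 < Real.sqrt k := Real.sqrt_pos.2 hk0
  have hsk2 : Real.sqrt k ^ 2 = k := Real.sq_sqrt hk0.le
  have hN := h.card_pos
  have hε := h.pos
  have hω := h.nonneg
  have hlg := log_inv_ge h.pos h.lt_half
  have hsl2 : Real.sqrt (Real.log (1 / ε)) ^ 2 = Real.log (1 / ε) :=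
    Real.sq_sqrt (by linarith)
  have hsl : (1 / 2 : ℝ) ≤ Real.sqrt (Real.log (1 / ε)) :=
    Real.le_sqrt_of_sq_le (by linarith)
  refine ⟨?_, ?_, ?_, ?_, ?_, ?_, ?_⟩
  · refine vecNormK_le (by positivity) fun S hS => (h.mean_bilin_le hS).trans ?_
    have : (1000 * (ε * Real.sqrt (Real.log (1 / ε)) / Real.sqrt k)) ^ 2
        = 1000000 * Real.log (1 / ε) * (ε ^ 2 / k) := by
      rw [← hsk2]
      nth_rewrite 2 [← hsl2]
      rw [hsk2]
      rw [mul_pow, div_pow, mul_pow, hsl2, hsk2]; ring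
    rw [this]
    have h0 : 0 ≤ ε ^ 2 / k := by positivity
    nlinarith
  · intro W hW
    have hNW := h.card_part_ge hW
    have hW0 : (0 : ℝ) < W.card := lt_of_lt_of_le (by positivity) hNW
    have hWne : W.Nonempty := Finset.card_pos.1 (by exact_mod_cast hW0)
    refine vecNormK_le (by positivity) fun S hS => ?_
    rw [avg_sub]
    have h1 := bilin_avg hS hWne fun i => X i - μ i
    have h2 := h.avg_part_le hW hS
    have h3 : 0 ≤ (1 / (W.card : ℝ)) * ∑ i ∈ W, (X i - μ i - avg W fun i => X i - μ i) ⬝ᵥ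
        S.mulVec (X i - μ i - avg W fun i => X i - μ i) :=
      mul_nonneg (by positivity) (Finset.sum_nonneg fun i _ => hS.bilin_nonneg _)
    have : (1000 * (Real.sqrt (Real.log (1 / ε)) / Real.sqrt k)) ^ 2
        = 1000000 * Real.log (1 / ε) / k := by
      rw [mul_pow, div_pow, hsl2, hsk2]; ring
    rw [this]
    have h4 : 800 * Real.log (1 / ε) / k ≤ 1000000 * Real.log (1 / ε) / k := by gcongr; norm_num
    linarith
  · refine normK_le (by positivity) fun S hS => (h.matInner_matM_le hS).trans ?_
    rw [← mul_div_assoc]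
    exact div_le_div_of_nonneg_right (by nlinarith) hk0.le
  · intro W hW
    refine normK_le (by positivity) fun S hS => ?_
    rw [matInner_matA, abs_of_nonneg (mul_nonneg (by positivity)
      (Finset.sum_nonneg fun i _ => hS.bilin_nonneg _))]
    refine (h.avg_part_le hW hS).trans ?_
    rw [← mul_div_assoc]
    gcongr
    norm_num
  · refine normK_le (by positivity) fun S hS => (h.matInner_proxy_le hS).trans ?_
    rw [← add_div, ← mul_div_assoc]
    gcongr
    nlinarith [sq_nonneg ω]
  · refine Real.sSup_le ?_ (by positivity)
    rintro r ⟨S, hS, rfl⟩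
    refine (h.heterogeneity_all_le hS).trans ?_
    have h1 : 0 ≤ ω * (ε / Real.sqrt k) := by positivity
    have : 1000 * (ω * (ε * Real.sqrt (Real.log (1 / ε)) / Real.sqrt k))
        = 1000 * Real.sqrt (Real.log (1 / ε)) * (ω * (ε / Real.sqrt k)) := by ring
    rw [this]
    nlinarith
  · intro W hW
    refine Real.sSup_le ?_ (by positivity)
    rintro r ⟨S, hS, rfl⟩
    refine (h.heterogeneity_part_le hW hS).trans ?_
    gcongr
    norm_num

end regular

/-! ### From independent batches to finite sums -/

section transfer

variable {n k : ℕ}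

/-- Events of independent batches are at least as likely as the corresponding events of the finite
product of all draws. Neither side has to be measurable: there are only finitely many values. -/
theorem prob_le_measureReal {I Ω : Type*} [Fintype I] [DecidableEq I] [MeasurableSpace Ω]
    {P : Measure Ω} [IsProbabilityMeasure P] {μ : I → Fin n → ℝ} (hμ : ∀ i, IsProb (μ i))
    {X : I → Ω → Fin n → ℝ} (hX : ∀ i, HasLaw (X i) (mulDist k (μ i)) P) (hind : iIndepFun X P)
    (A : (I → Fin n → ℝ) → Prop) :
    prob (piW fun i => piW fun _ : Fin k => μ i) (fun y => A fun i => freq (y i))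
      ≤ P.real {o | A fun i => X i o} := by
  classical
  have hcat : ∀ i, IsProbabilityMeasure (categorical (μ i)) := fun i =>
    isProbabilityMeasure_categorical (hμ i)
  have hfreq : ∀ i, AEMeasurable (freq (n := n) (k := k))
      (Measure.pi fun _ : Fin k => categorical (μ i)) := fun i => measurable_freq.aemeasurable
  have hmul : ∀ i, IsProbabilityMeasure (mulDist k (μ i)) := fun i =>
    Measure.isProbabilityMeasure_map (hfreq i)
  set Q : Measure (I → Fin k → Fin n) :=
    Measure.pi fun i => Measure.pi fun _ : Fin k => categorical (μ i) with hQ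
  set F : (I → Fin k → Fin n) → I → Fin n → ℝ := fun y i => freq (y i) with hF
  set G : Set (I → Fin k → Fin n) := {y | A (F y)} with hG
  -- the values of good samples form a finite, hence measurable set
  have hT : MeasurableSet (F '' G) := (Set.toFinite _).measurableSet
  have hXm : ∀ i, AEMeasurable (X i) P := fun i => (hX i).aemeasurable
  have hmap : P.map (fun o i => X i o) = Q.map F := by
    rw [(iIndepFun_iff_map_fun_eq_pi_map hXm).1 hind]
    have h1 : ∀ i, P.map (X i)
        = (Measure.pi fun _ : Fin k => categorical (μ i)).map freq := fun i => (hX i).map_eq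
    have h2 : (fun i => P.map (X i))
        = fun i => (Measure.pi fun _ : Fin k => categorical (μ i)).map freq := funext h1
    rw [h2]
    have : ∀ i, SigmaFinite ((Measure.pi fun _ : Fin k => categorical (μ i)).map
        (freq (n := n) (k := k))) := fun i => by
      have := hmul i
      rw [mulDist] at this
      infer_instance
    exact (Measure.pi_map_pi hfreq).symm
  have hQG : Q G ≤ P {o | A fun i => X i o} := by
    calc Q G ≤ Q (F ⁻¹' (F '' G)) := measure_mono (Set.subset_preimage_image F G)
      _ = Q.map F (F '' G) := (Measure.map_apply (measurable_of_finite F) hT).symm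
      _ = P ((fun o i => X i o) ⁻¹' (F '' G)) := by
          rw [← hmap, Measure.map_apply_of_aemeasurable (aemeasurable_pi_lambda _ hXm) hT]
      _ ≤ _ := by
          refine measure_mono ?_
          rintro o ⟨y, hy, hyo⟩
          have : F y = fun i => X i o := hyo
          change A fun i => X i o
          rw [← this]
          exact hy
  have hsum : Q.real G = prob (piW fun i => piW fun _ : Fin k => μ i) (fun y => A (F y)) := by
    rw [← integral_indicator_one (Set.toFinite G).measurableSet,
      integral_fintype Integrable.of_finite]
    refine Finset.sum_congr rfl fun y _ => ?_
    have h1 : Q.real {y} = piW (fun i => piW fun _ : Fin k => μ i) y := by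
      rw [Measure.real, hQ, Measure.pi_singleton]
      simp only [pi_categorical_singleton (hμ _)]
      rw [← ENNReal.ofReal_prod_of_nonneg fun i _ => (isProb_piW fun _ => hμ i).nonneg _,
        ENNReal.toReal_ofReal (Finset.prod_nonneg fun i _ =>
          (isProb_piW fun _ => hμ i).nonneg (y i))]
      rfl
    rw [h1, smul_eq_mul]
    refine congrArg _ ?_
    by_cases hy : A (F y)
    · rw [Set.indicator_of_mem (show y ∈ G from hy)]; exact (if_pos hy).symm
    · rw [Set.indicator_of_notMem (show y ∉ G from hy)]; exact (if_neg hy).symm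
  rw [← hsum]
  exact ENNReal.toReal_mono (measure_ne_top _ _) hQG

lemma IsProb.prob_not {Y : Type*} [Fintype Y] {w : Y → ℝ} (hw : IsProb w) (A : Y → Prop) :
    prob w (fun y => ¬ A y) = 1 - prob w A := by
  classical
  have h : expect w (fun y => 1 - if A y then (1 : ℝ) else 0) = 1 - prob w A := by
    rw [expect_sub, hw.expect_const]; rfl
  rw [← h]
  unfold prob
  refine congrArg _ (funext fun y => ?_)
  by_cases hA : A y <;> simp [hA]

end transfer

/-! ### Distances of the means -/

section distance

variable {n : ℕ} {p q : Fin n → ℝ} {ω : ℝ}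

lemma sum_abs_sub_le_of_tvDist_le (hp : IsProb p) (hq : IsProb q) (h : tvDist p q ≤ ω) :
    ∑ x, |p x - q x| ≤ 2 * ω := by
  set s := Finset.univ.filter fun x => q x ≤ p x with hs
  have h1 : ∑ x ∈ s, (p x - q x) ≤ ω := by
    rw [Finset.sum_sub_distrib]
    exact (le_ciSup (f := fun S : Finset (Fin n) => ∑ a ∈ S, p a - ∑ a ∈ S, q a)
      (Set.finite_range _).bddAbove s).trans h
  have h2 : ∑ x, |p x - q x| = ∑ x, (2 * (if q x ≤ p x then p x - q x else 0) - (p x - q x)) := by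
    refine Finset.sum_congr rfl fun x _ => ?_
    split_ifs with hx
    · rw [abs_of_nonneg (by linarith)]; ring
    · rw [abs_of_neg (by linarith)]; ring
  have h3 : ∑ x, (p x - q x) = 0 := by
    rw [Finset.sum_sub_distrib, hp.sum_one, hq.sum_one, sub_self]
  rw [h2, Finset.sum_sub_distrib, h3, ← Finset.mul_sum, ← Finset.sum_filter]
  linarith

lemma sum_abs_sub_avg_le {ι : Type*} {U : Finset ι} {μ : ι → Fin n → ℝ}
    (h : ∀ i ∈ U, ∑ x, |p x - μ i x| ≤ 2 * ω) {i : ι} (hi : i ∈ U) :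
    ∑ x, |(μ i - avg U μ) x| ≤ 4 * ω := by
  have hN : (0 : ℝ) < U.card := by exact_mod_cast Finset.card_pos.2 ⟨i, hi⟩
  have h1 : ∀ x, |p x - avg U μ x| ≤ (1 / (U.card : ℝ)) * ∑ j ∈ U, |p x - μ j x| := by
    intro x
    have : p x - avg U μ x = (1 / (U.card : ℝ)) * ∑ j ∈ U, (p x - μ j x) := by
      rw [Finset.sum_sub_distrib, avg, Finset.sum_const, nsmul_eq_mul]
      field_simp
    rw [this, abs_mul, abs_of_pos (by positivity)]
    exact mul_le_mul_of_nonneg_left (Finset.abs_sum_le_sum_abs _ _) (by positivity)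
  have h2 : ∑ x, |p x - avg U μ x| ≤ 2 * ω := by
    refine (Finset.sum_le_sum fun x _ => h1 x).trans ?_
    rw [← Finset.mul_sum, Finset.sum_comm, one_div, inv_mul_le_iff₀ hN]
    refine (Finset.sum_le_sum h).trans_eq ?_
    rw [Finset.sum_const, nsmul_eq_mul]
  calc ∑ x, |(μ i - avg U μ) x| ≤ ∑ x, (|p x - μ i x| + |p x - avg U μ x|) := by
        refine Finset.sum_le_sum fun x _ => ?_
        rw [Pi.sub_apply, show μ i x - avg U μ x = -(p x - μ i x) + (p x - avg U μ x) by ring]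
        exact (abs_add_le _ _).trans_eq (by rw [abs_neg])
    _ ≤ 4 * ω := by
        rw [Finset.sum_add_distrib]
        linarith [h i hi]

end distance

/-! ### The sample size -/

lemma ample_of_rate {m ℓ : ℕ} {ε δ N : ℝ} (hm : 1 ≤ m) (hℓ : 1 ≤ ℓ) (hε : 0 < ε)
    (hε2 : ε < 1 / 2) (hδ : 0 < δ) (hδ1 : δ < 1)
    (hN : 30000000 * rate m ℓ ε δ * Real.log (2 + rate m ℓ ε δ) ^ 2 ≤ N) : Ample m ℓ ε δ N := by
  refine ⟨hm, hℓ, hε, hε2, hδ, hδ1, ?_⟩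
  have hm1 : (1 : ℝ) ≤ m := by exact_mod_cast hm
  have hℓ1 : (1 : ℝ) ≤ ℓ := by exact_mod_cast hℓ
  have hl2 := Real.log_two_gt_d9
  have hlam : Real.log 2 ≤ Real.log (2 / δ) := by
    refine Real.log_le_log (by norm_num) ?_
    rw [le_div_iff₀ hδ]; linarith
  have hg8 := eight_le_netRatio hm hℓ hε hε2
  set lam := Real.log (2 / δ)
  have hlam0 : 0 < lam := by linarith
  set f := rate m ℓ ε δ with hf
  have hfdef : f = lam * ((ℓ : ℝ) ^ 2 / ε ^ 2) * (m * Real.log 2) ^ 3 := by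
    rw [hf, rate, Real.log_pow]
  have h3 : (0.3 : ℝ) ≤ Real.log 2 ^ 3 :=
    le_trans (by norm_num) (pow_le_pow_left₀ (by norm_num) hl2.le 3)
  -- the main part of the rate
  set b := (ℓ : ℝ) ^ 2 * m ^ 3 / ε ^ 2 with hb
  have hb0 : 0 < b := by positivity
  have hfb : 0.3 * (lam * b) ≤ f := by
    have : f = Real.log 2 ^ 3 * (lam * b) := by rw [hfdef, hb]; ring
    rw [this]
    exact mul_le_mul_of_nonneg_right h3 (by positivity)
  have hf0 : 0 < f := lt_of_lt_of_le (by positivity) hfb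
  have hs : ((ℓ : ℝ) * m + 1) ^ 2 ≤ 4 * ((ℓ : ℝ) ^ 2 * m ^ 2) := by
    have h1 : 1 ≤ (ℓ : ℝ) * m := one_le_mul_of_one_le_of_one_le hℓ1 hm1
    nlinarith
  have hg : netRatio m ℓ ε ≤ (2 + f) ^ 6 := by
    have h1 : netRatio m ℓ ε ≤ 4 * b := by
      rw [netRatio, hb, div_le_iff₀ hε]
      refine hs.trans ?_
      have : 4 * ((ℓ : ℝ) ^ 2 * m ^ 3 / ε ^ 2) * ε = 4 * ((ℓ : ℝ) ^ 2 * m ^ 2) * (m / ε) := by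
        field_simp
      rw [this]
      refine le_mul_of_one_le_right (by positivity) ?_
      rw [le_div_iff₀ hε]; linarith
    have h2 : 0.69 * b ≤ lam * b := mul_le_mul_of_nonneg_right (by linarith) hb0.le
    have h4 : (2 : ℝ) ^ 5 ≤ (2 + f) ^ 5 := pow_le_pow_left₀ (by norm_num) (by linarith) 5
    have h5 : (2 : ℝ) ^ 5 * (2 + f) ≤ (2 + f) ^ 5 * (2 + f) :=
      mul_le_mul_of_nonneg_right h4 (by linarith)
    have h6 : (2 + f) ^ 6 = (2 + f) ^ 5 * (2 + f) := by ring
    rw [h6]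
    linarith
  have hlog : Real.log (netRatio m ℓ ε) ≤ 6 * Real.log (2 + f) := by
    have h1 := Real.log_le_log (by linarith : 0 < netRatio m ℓ ε) hg
    rw [Real.log_pow] at h1
    exact_mod_cast h1
  have hlog0 := two_le_log hg8
  have hlog2 : Real.log (netRatio m ℓ ε) ^ 2 ≤ 36 * Real.log (2 + f) ^ 2 :=
    (pow_le_pow_left₀ (by linarith) hlog 2).trans_eq (by ring)
  have hms : (m + 1) * ((ℓ : ℝ) * m + 1) ^ 2 * lam ≤ 27 * (ε ^ 2 * f) := by
    have h1 : (m + 1) * ((ℓ : ℝ) * m + 1) ^ 2 ≤ (2 * m) * (4 * ((ℓ : ℝ) ^ 2 * m ^ 2)) :=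
      mul_le_mul (by linarith) hs (by positivity) (by positivity)
    have h2 : ε ^ 2 * (lam * b) = (ℓ : ℝ) ^ 2 * m ^ 3 * lam := by rw [hb]; field_simp
    have h4 := mul_le_mul_of_nonneg_left hfb (sq_nonneg ε)
    have h5 := mul_le_mul_of_nonneg_right h1 hlam0.le
    have h6 : 0 ≤ ε ^ 2 * (lam * b) := by positivity
    linarith
  have hL0 : 0 ≤ Real.log (2 + f) ^ 2 := sq_nonneg _
  calc _ = 30000 * ((m + 1) * ((ℓ : ℝ) * m + 1) ^ 2 * lam) * Real.log (netRatio m ℓ ε) ^ 2 := by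
        ring
    _ ≤ 30000 * (27 * (ε ^ 2 * f)) * (36 * Real.log (2 + f) ^ 2) := by gcongr
    _ ≤ ε ^ 2 * (30000000 * f * Real.log (2 + f) ^ 2) := by
        have : 0 ≤ ε ^ 2 * (f * Real.log (2 + f) ^ 2) := by positivity
        linarith
    _ ≤ _ := mul_le_mul_of_nonneg_left hN (sq_nonneg ε)

lemma Ample.two_le {m ℓ : ℕ} {ε δ N : ℝ} (h : Ample m ℓ ε δ N) : 2 ≤ ε * N := by
  have hs := four_le_haarBound h.hm h.hℓ
  have hlog := two_le_log (eight_le_netRatio h.hm h.hℓ h.hε h.hε2)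
  have hl2 := Real.log_two_gt_d9
  have hlam : Real.log 2 ≤ Real.log (2 / δ) := by
    refine Real.log_le_log (by norm_num) ?_
    rw [le_div_iff₀ h.hδ]; linarith [h.hδ1]
  have h1 : (1 : ℝ) ≤ (m + 1) * ((ℓ : ℝ) * m + 1) ^ 2 * Real.log (netRatio m ℓ ε) ^ 2 := by
    have : (1 : ℝ) ≤ (m + 1) * ((ℓ : ℝ) * m + 1) ^ 2 := by
      nlinarith [(Nat.cast_nonneg m : (0 : ℝ) ≤ m)]
    exact one_le_mul_of_one_le_of_one_le this (one_le_pow₀ (by linarith))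
  have h2 := h.hN
  have h3 : 2 ≤ ε ^ 2 * N := by nlinarith
  have hN : 0 < N := by
    by_contra hcon
    push Not at hcon
    nlinarith [sq_nonneg ε]
  have hε := h.hε
  have hε2 := h.hε2
  nlinarith [mul_pos hε hN]

theorem prob_regular_ge {m ℓ k : ℕ} {ε δ ω : ℝ} {ι : Type*} {U : Finset ι} [DecidableEq U]
    {μ : ι → Fin (2 ^ m) → ℝ} (hk : 1 ≤ k) (hω : 0 ≤ ω) (h : Ample m ℓ ε δ U.card)
    (hμ : ∀ i ∈ U, IsProb (μ i)) (hnear : ∀ i ∈ U, ∑ x, |(μ i - avg U μ) x| ≤ 4 * ω) :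
    1 - δ ≤ prob (piW fun i : U => piW fun _ : Fin k => μ i) (fun y =>
      ∀ X' : ι → Fin (2 ^ m) → ℝ, (∀ i : U, X' i = freq (y i)) → IsGood 1000 m ℓ k ε ω U μ X') := by
  have htwo := h.two_le
  have hU : U.Nonempty := by
    rw [Finset.nonempty_iff_ne_empty]
    rintro rfl
    norm_num at htwo
  have : Nonempty U := hU.to_subtype
  have hk0 : (k : ℝ) ≠ 0 := by positivity
  have hμ' : ∀ i : U, IsProb (μ i) := fun i => hμ i i.2
  have hP : IsProb (piW fun i : U => piW fun _ : Fin k => μ i) :=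
    isProb_piW fun i => isProb_piW fun _ => hμ' i
  have hA : Ample m ℓ ε δ (Fintype.card U) := by rwa [Fintype.card_coe]
  have hv : ∀ i : U, ∑ x, |((1 / ω) • (μ i - avg U μ)) x| ≤ 4 := by
    intro i
    simp only [Pi.smul_apply, smul_eq_mul, abs_mul, ← Finset.mul_sum]
    rcases eq_or_lt_of_le hω with h0 | h0
    · rw [← h0]; simp
    · rw [abs_of_pos (by positivity), one_div, inv_mul_le_iff₀ h0]
      linarith [hnear i i.2]
  have p1 := prob_not_uniformBound_covDev_le hk hμ' hA
  have p2 := prob_not_uniformBound_diagDev_le hk hμ' hA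
  have p3 := prob_not_uniformBound_crossDev_le (v := fun i : U => (1 / ω) • (μ i - avg U μ))
    hk hμ' hv hA
  have p4 := prob_not_mean_le hk hμ' hA
  have key : prob (piW fun i : U => piW fun _ : Fin k => μ i) (fun y => ¬
      ∀ X' : ι → Fin (2 ^ m) → ℝ, (∀ i : U, X' i = freq (y i)) → IsGood 1000 m ℓ k ε ω U μ X')
      ≤ δ := by
    refine le_trans ?_ (show δ / 4 + δ / 4 + δ / 4 + δ / 4 ≤ δ by linarith)
    refine le_trans ?_ (add_le_add (add_le_add (add_le_add p1 p2) p3) p4)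
    refine le_trans ?_ (add_le_add_left ((hP.prob_or_le _ _).trans
      (add_le_add_left (hP.prob_or_le _ _) _)) _)
    refine le_trans (hP.prob_mono fun y hy => ?_) (hP.prob_or_le _ _)
    by_contra hno
    push Not at hno
    obtain ⟨⟨⟨n1, n2⟩, n3⟩, n4⟩ := hno
    refine hy fun X' hX' => Regular.isGood ⟨hk, h.hε, h.hε2, hω, htwo, hμ, fun i hi => ?_, hnear,
      ?_, ?_, ?_, ?_⟩
    · rw [hX' ⟨i, hi⟩]
      refine ⟨fun x => div_nonneg (Nat.cast_nonneg _) (Nat.cast_nonneg _), ?_⟩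
      simp only [freq]
      rw [← Finset.sum_div, ← Nat.cast_sum, ← Finset.card_eq_sum_card_fiberwise
        (fun j _ => Finset.mem_coe.2 (Finset.mem_univ _))]
      simp [hk0]
    · simp only [hX']; exact n1
    · simp only [hX']; exact n2
    · simp only [hX']; exact n3
    · simp only [hX']; exact n4
  rw [hP.prob_not] at key
  linarith

end UntrustedBatches

open UntrustedBatches
theorem lemma4p5 :
    ∃ C₀ > (0 : ℝ), ∃ C > (0 : ℝ), ∃ c : ℕ,
      ∀ (m ℓ k : ℕ), 1 ≤ m → 1 ≤ ℓ → 1 ≤ k →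
      ∀ (ε δ ω : ℝ), 0 < ε → ε < 1 / 2 → 0 < δ → δ < 1 → 0 ≤ ω →
      ∀ (ι : Type*) (U : Finset ι),
        C * rate m ℓ ε δ * Real.log (2 + rate m ℓ ε δ) ^ c ≤ (U.card : ℝ) →
      ∀ (μ₀ : Fin (2 ^ m) → ℝ) (μ : ι → Fin (2 ^ m) → ℝ),
        μ₀ ∈ stdSimplex ℝ (Fin (2 ^ m)) →
        (∀ i ∈ U, μ i ∈ stdSimplex ℝ (Fin (2 ^ m))) →
        (∀ i ∈ U, tvDist μ₀ (μ i) ≤ ω) →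
      ∀ (Ω : Type*) (_ : MeasurableSpace Ω) (P : Measure Ω) (_ : IsProbabilityMeasure P)
        (X : ι → Ω → Fin (2 ^ m) → ℝ),
        (∀ i ∈ U, HasLaw (X i) (mulDist k (μ i)) P) →
        iIndepFun (fun i : U => X i) P →
        1 - δ ≤ P.real {o | IsGood C₀ m ℓ k ε ω U μ (fun i => X i o)} := by
  refine ⟨1000, by norm_num, 30000000, by norm_num, 2, ?_⟩
  intro m ℓ k hm hℓ hk ε δ ω hε hε2 hδ hδ1 hω ι U hN μ₀ μ hμ₀ hμ htv Ω _ P _ X hX hind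
  classical
  have hμ' : ∀ i ∈ U, IsProb (μ i) := fun i hi => isProb_of_mem_stdSimplex (hμ i hi)
  have hnear : ∀ i ∈ U, ∑ x, |(μ i - avg U μ) x| ≤ 4 * ω := fun i hi =>
    sum_abs_sub_avg_le (fun j hj => sum_abs_sub_le_of_tvDist_le (isProb_of_mem_stdSimplex hμ₀)
      (hμ' j hj) (htv j hj)) hi
  refine (prob_regular_ge hk hω (ample_of_rate hm hℓ hε hε2 hδ hδ1 hN) hμ' hnear).trans ?_
  refine (prob_le_measureReal (fun i : U => hμ' i i.2) (fun i : U => hX i i.2) hind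
    (fun x => ∀ X' : ι → Fin (2 ^ m) → ℝ, (∀ i : U, X' i = x i) →
      IsGood 1000 m ℓ k ε ω U μ X')).trans ?_
  exact measureReal_mono (fun o ho => ho (fun i => X i o) fun _ => rfl)
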